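/- Let $q_2,q_3\in L_2(0,1)$ be complex-valued, put $\omega_j=\int_0^1 q_j(x)\,dx$ for $j=2,3$, and for $k\in\{1,2\}$ let $\Lambda_k$ be the spectrum (the collection of eigenvalues, counted with algebraic multiplicity) of the boundary value problem with delay on the star graph with three edges $$-y_1''(x)=\lambda y_1(x),\qquad -y_j''(x)+q_j(x)y_1(x)=\lambda y_j(x),\quad j=2,3,\qquad 0<x<1,$$ $$y_1(1)=y_2(0)=y_3(0),\qquad y_1'(1)=y_2'(0)+y_3'(0),\qquad y_1(0)=y_2^{(k-1)}(1)=y_3^{(2-k)}(1)=0,$$ where $y_1,y_2,y_3\in W_2^2[0,1]$. Then, with account of multiplicity, $$\Lambda_k=\{\mu_{n,k}\}_{n\in\mathbb Z\setminus\{0\}}\cup\{\xi_{n,k}\}_{n\ge0},$$ where $\mu_{n,k}=\eta_{n,k}^2$ and $\xi_{n,k}=\zeta_{n,k}^2$ with $$\eta_{n,k}=\pi n+\sigma+(-1)^n\frac{\gamma_k}{\pi n}+\frac{\varkappa_n}{n}\quad(n\in\mathbb Z\setminus\{0\}),\qquad \zeta_{n,k}=\pi n+(-1)^n\frac{\omega_{k+1}}{4\pi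 n}+\frac{\varkappa'_n}{n}\quad(n\ge1),$$ for some complex sequences $\{\varkappa_n\}_{n\in\mathbb Z\setminus\{0\}}$ and $\{\varkappa'_n\}_{n\ge1}$ in $\ell_2$ (which depend on $k$), and $$\sigma=\frac12\arccos\Bigl(-\frac13\Bigr),\qquad \gamma_k=\frac{\sqrt3}{16}\Bigl(\frac{\omega_2+\omega_3}{3}+(-1)^k(\omega_2-\omega_3)\Bigr).$$ -/

import Mathlib

open MeasureTheory Set

/-- The three edges of the star graph; each is parametrized by `[0, 1]`. The edge `e1` enters the
internal vertex at `x = 1`, the edges `e2` and `e3` leave it at `x = 0`. -/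
inductive Edge
  | e1
  | e2
  | e3

/-- `d 0` belongs to the Sobolev space `W₂²[0, 1]`, and `d 1`, `d 2` are its first and second
derivatives: `d 0` and `d 1` are absolutely continuous on `[0, 1]`, `(d 0)' = d 1`, and
`(d 1)' = d 2` with `d 2` in `L₂(0, 1)`. -/
structure IsW22 (d : ℕ → ℝ → ℂ) : Prop where
  memLp : MemLp (d 2) 2 (volume.restrict (Ioo (0 : ℝ) 1))
  eq_zero_add_integral : ∀ x ∈ Icc (0 : ℝ) 1, d 0 x = d 0 0 + ∫ t in (0 : ℝ)..x, d 1 t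
  deriv_eq_add_integral : ∀ x ∈ Icc (0 : ℝ) 1, d 1 x = d 1 0 + ∫ t in (0 : ℝ)..x, d 2 t

/-- `(ℓ - lam) y = f`, where `ℓ` is the operator of the boundary value problem with global delay
`a = 1` on the star graph with three edges: `y` is in `W₂²` on each edge, satisfies the matching
conditions at the internal vertex and the boundary conditions
`y₁(0) = y₂^{(k-1)}(1) = y₃^{(2-k)}(1) = 0`, and
`-y₁'' - lam y₁ = f₁`, `-yⱼ'' + qⱼ y₁ - lam yⱼ = fⱼ` (`j = 2, 3`) almost everywhere on `(0, 1)`.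
Here `d j ν` is the `ν`-th derivative of `yⱼ`, and `k` is `1` or `2`. -/
def SolvesProblem (k : ℕ) (q₂ q₃ : ℝ → ℂ) (lam : ℂ) (y f : Edge → ℝ → ℂ) : Prop :=
  ∃ d : Edge → ℕ → ℝ → ℂ,
    (∀ j, d j 0 = y j) ∧
    (∀ j, IsW22 (d j)) ∧
    (∀ᵐ x ∂(volume.restrict (Ioo (0 : ℝ) 1)),
      -(d .e1 2 x) - lam * y .e1 x = f .e1 x ∧
      -(d .e2 2 x) + q₂ x * y .e1 x - lam * y .e2 x = f .e2 x ∧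
      -(d .e3 2 x) + q₃ x * y .e1 x - lam * y .e3 x = f .e3 x) ∧
    (y .e1 1 = y .e2 0 ∧ y .e2 0 = y .e3 0 ∧ d .e1 1 1 = d .e2 1 0 + d .e3 1 0) ∧
    (y .e1 0 = 0 ∧ d .e2 (k - 1) 1 = 0 ∧ d .e3 (2 - k) 1 = 0)

/-- The spectrum as a set: those `lam` for which the homogeneous problem has a solution that does
not vanish identically on the graph. -/
def spectrumSet (k : ℕ) (q₂ q₃ : ℝ → ℂ) : Set ℂ :=
  {lam | ∃ y : Edge → ℝ → ℂ, SolvesProblem k q₂ q₃ lam y (fun _ _ => 0) ∧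
    ∃ j, ∃ x ∈ Icc (0 : ℝ) 1, y j x ≠ 0}

/-- Functions on the graph annihilated by `(ℓ - lam) ^ m` (eigenfunctions and associated functions;
only the values on `[0, 1]` are relevant). -/
def IsRootFunction (k : ℕ) (q₂ q₃ : ℝ → ℂ) (lam : ℂ) : ℕ → (Edge → ℝ → ℂ) → Prop
  | 0, y => ∀ j, ∀ x ∈ Icc (0 : ℝ) 1, y j x = 0
  | m + 1, y => ∃ f, IsRootFunction k q₂ q₃ lam m f ∧ SolvesProblem k q₂ q₃ lam y f

/-- The root subspace of `ℓ` at `lam`, i.e. the union over `m` of the kernels of `(ℓ - lam) ^ m`, as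
a space of functions on the graph. (This union is a linear subspace, so that it coincides with its
span.) -/
def rootSpace (k : ℕ) (q₂ q₃ : ℝ → ℂ) (lam : ℂ) :
    Submodule ℂ (Edge → Icc (0 : ℝ) 1 → ℂ) :=
  Submodule.span ℂ {v | ∃ m y, IsRootFunction k q₂ q₃ lam m y ∧ v = fun j (x : Icc (0 : ℝ) 1) => y j (x : ℝ)}

/-- The (algebraic) multiplicity of `lam` as an eigenvalue, i.e. the dimension of the root subspace;
it is `0` if `lam` is not an eigenvalue. -/
noncomputable def eigenMultiplicity (k : ℕ) (q₂ q₃ : ℝ → ℂ) (lam : ℂ) : ℕ∞ :=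
  Cardinal.toENat (Module.rank ℂ (rootSpace k q₂ q₃ lam))

/-- The mean value `∫₀¹ q(x) dx` of a potential. -/
noncomputable def omega (q : ℝ → ℂ) : ℂ := ∫ x in (0 : ℝ)..1, q x

/-- `σ = ½ arccos(-1/3)`. -/
noncomputable def sigma : ℝ := Real.arccos (-1 / 3) / 2

/-- `γ_k = (√3 / 16) ((ω₂ + ω₃) / 3 + (-1)^k (ω₂ - ω₃))`. -/
noncomputable def gammaCoeff (k : ℕ) (q₂ q₃ : ℝ → ℂ) : ℂ :=
  ((Real.sqrt 3 : ℝ) : ℂ) / 16 *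
    ((omega q₂ + omega q₃) / 3 + (-1) ^ k * (omega q₂ - omega q₃))

/-! Write C(x, λ) and S(x, λ) for the solutions of −y″ = λy with Cauchy data (1, 0) and (0, 1) at x
= 0; they are entire in λ and C² + λS² = 1. On the first edge a solution is a multiple of S, so the
delay terms are known sources and the other two edges are solved by variation of parameters
(`edgeSol`). For k = 1 the two conditions at the far ends then form a 2 × 2 linear system whose
determinant is, up to sign, the entire function Δ = `charFun₁`.

Eigenvalues with algebraic multiplicity are the zeros of Δ with their orders
(`eigenMultiplicity_one_eq`). The free slope at the vertex is chosen entire in λ so that the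
resulting family Y(λ) violates the far conditions only by C(1)Δ and λS(1)Δ. If Δ has a zero of order
p at c, the first p Taylor coefficients of Y at c therefore satisfy all conditions, and expanding ℓY
= λY shows that they form a chain of root functions. They are independent because on the first edge
they are Taylor coefficients of S, and they span the root subspace because C² + λS² = 1 leaves no
room for a further solution.

With λ = z² one has exactly zΔ(z²) = F(z) + G(z)/(2z) (`mul_charFun₁_sq`), where F(z) = sin z (3cos²
z − 1) = −3 sin z sin(z − σ) sin(z + σ) and G is `subPart`. Away from its zeros |F| is at least a
constant times exp(3|Im z|), while G is O(exp(2|Im z|)). Rouché's theorem, proved through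
logarithmic derivatives (`Differentiable.rouche`), gives one simple zero near every large zero of F,
and in large discs of the λ-plane as many zeros of Δ as for the free problem. Up to sign the nonzero
zeros of F are πn + σ (n ∈ ℤ) and πn (n ≥ 1); the point σ itself gets the index of ξ₀
(`exists_spectral_enumeration`).

Finally, for a zero r near πn + θ, θ ∈ {0, σ}, linearizing F at θ gives n(r − πn − θ) = −(−1)ⁿ G(πn
+ θ)/(2πF′(θ)) + O(1/n). The value G(πn + θ) is −ω₂cos²θ + ω₃sin²θ plus Fourier coefficients of L₂
functions, which are square summable by Parseval (`exists_summable_remainder`). Inserting θ yields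
the coefficients ω₂/(4π) and γ₁/π. The problem k = 2 is the problem k = 1 with the two outgoing
edges interchanged. -/

open Filter Topology Function

/-! ### Entire functions of the square root -/

/-- An even entire function composed with the principal square root. -/
theorem Complex.differentiable_comp_cpow_half {f : ℂ → ℂ} (hf : Differentiable ℂ f)
    (heven : ∀ z, f (-z) = f z) :
    Differentiable ℂ (fun w : ℂ => f (w ^ (1 / 2 : ℂ))) ∧
      ∀ z : ℂ, f ((z ^ 2) ^ (1 / 2 : ℂ)) = f z := by
  have hsq : ∀ w : ℂ, (w ^ (1 / 2 : ℂ)) ^ 2 = w := fun w => by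
    rw [one_div]; exact_mod_cast Complex.cpow_nat_inv_pow w two_ne_zero
  have hval : ∀ z w : ℂ, w ^ 2 = z ^ 2 → f w = f z := fun z w h => by
    rcases sq_eq_sq_iff_eq_or_eq_neg.1 h with h | h
    · rw [h]
    · rw [h, heven]
  refine ⟨?_, fun z => hval _ _ (hsq _)⟩
  have hslit : ∀ w ∈ Complex.slitPlane, DifferentiableAt ℂ (fun w : ℂ => w ^ (1 / 2 : ℂ)) w :=
    fun w hw => (differentiableAt_id).cpow_const hw
  have hne : ∀ w : ℂ, w ≠ 0 → DifferentiableAt ℂ (fun w : ℂ => f (w ^ (1 / 2 : ℂ))) w := by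
    intro w hw
    by_cases h : w ∈ Complex.slitPlane
    · exact (hf _).comp w (hslit w h)
    · have h' : -w ∈ Complex.slitPlane := by
        rw [Complex.mem_slitPlane_iff] at h ⊢
        push Not at h
        left
        rcases lt_or_eq_of_le h.1 with h1 | h1
        · simpa using h1
        · exact absurd (Complex.ext h1 h.2) hw
      -- On the cut, i√(−w) is another square root of w, analytic there; evenness of f makes the
      -- choice of root irrelevant.
      have heq : (fun w : ℂ => f (w ^ (1 / 2 : ℂ)))
          = fun w : ℂ => f (Complex.I * (-w) ^ (1 / 2 : ℂ)) := by
        funext v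
        refine hval _ _ ?_
        rw [hsq, mul_pow, hsq]; simp
      rw [heq]
      refine (hf _).comp w ?_
      exact (DifferentiableAt.comp w (f := fun w : ℂ => -w) (g := fun w : ℂ => w ^ (1 / 2 : ℂ))
        (hslit _ h') differentiableAt_id.neg).const_mul _
  -- Only the origin is left. Since |√w| is the real square root of |w|, the composition is
  -- continuous there, and the singularity is removable.
  have hcont : ContinuousAt (fun w : ℂ => f (w ^ (1 / 2 : ℂ))) 0 := by
    have : ContinuousAt (fun w : ℂ => w ^ (1 / 2 : ℂ)) 0 := by
      have h0 : (0 : ℂ) ^ (1 / 2 : ℂ) = 0 := by simp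
      rw [ContinuousAt, h0, tendsto_zero_iff_norm_tendsto_zero]
      have : (fun w : ℂ => ‖w ^ (1 / 2 : ℂ)‖) = fun w => Real.sqrt ‖w‖ := by
        funext w
        rw [eq_comm, Real.sqrt_eq_iff_mul_self_eq (norm_nonneg _) (norm_nonneg _), ← norm_mul,
          ← sq, hsq]
      rw [this]
      have : ContinuousAt (fun w : ℂ => Real.sqrt ‖w‖) 0 := by fun_prop
      simpa [ContinuousAt] using this
    exact (hf.continuous.continuousAt).comp this
  have := (Complex.differentiableOn_compl_singleton_and_continuousAt_iff (s := univ)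
    (c := (0 : ℂ)) univ_mem).1 ⟨fun w hw => (hne w hw.2).differentiableWithinAt, hcont⟩
  exact fun w => (this w trivial).differentiableAt univ_mem

/-- The entire function `w ↦ cos √w`. -/
noncomputable def cosSqrt (w : ℂ) : ℂ := Complex.cos (w ^ (1 / 2 : ℂ))

/-- The entire function `w ↦ sin √w / √w`. -/
noncomputable def sincSqrt (w : ℂ) : ℂ := dslope Complex.sin 0 (w ^ (1 / 2 : ℂ))

theorem dslope_sin_neg (z : ℂ) : dslope Complex.sin 0 (-z) = dslope Complex.sin 0 z := by
  by_cases h : z = 0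
  · simp [h]
  · rw [dslope_of_ne _ h, dslope_of_ne _ (neg_ne_zero.2 h)]
    simp [slope_def_field]

theorem differentiable_dslope_sin : Differentiable ℂ (dslope Complex.sin 0) := by
  have := (Complex.differentiableOn_dslope (f := Complex.sin) (c := 0) (s := univ) univ_mem).2
    Complex.differentiable_sin.differentiableOn
  exact fun w => (this w trivial).differentiableAt univ_mem

theorem differentiable_cosSqrt : Differentiable ℂ cosSqrt :=
  (Complex.differentiable_comp_cpow_half Complex.differentiable_cos Complex.cos_neg).1

theorem cosSqrt_sq (z : ℂ) : cosSqrt (z ^ 2) = Complex.cos z :=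
  (Complex.differentiable_comp_cpow_half Complex.differentiable_cos Complex.cos_neg).2 z

theorem differentiable_sincSqrt : Differentiable ℂ sincSqrt :=
  (Complex.differentiable_comp_cpow_half differentiable_dslope_sin dslope_sin_neg).1

theorem mul_sincSqrt_sq (z : ℂ) : z * sincSqrt (z ^ 2) = Complex.sin z := by
  have : sincSqrt (z ^ 2) = dslope Complex.sin 0 z :=
    (Complex.differentiable_comp_cpow_half differentiable_dslope_sin dslope_sin_neg).2 z
  rw [this]
  have := sub_smul_dslope Complex.sin 0 z
  simpa using this

theorem sincSqrt_zero : sincSqrt 0 = 1 := by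
  have : sincSqrt (0 ^ 2) = dslope Complex.sin 0 0 :=
    (Complex.differentiable_comp_cpow_half differentiable_dslope_sin dslope_sin_neg).2 0
  simpa using this

/-! ### The fundamental solutions C and S -/

/-- The solution of `-y'' = lam y` with `y 0 = 1`, `y' 0 = 0`. -/
noncomputable def cosSol (x : ℝ) (lam : ℂ) : ℂ := cosSqrt ((x : ℂ) ^ 2 * lam)

/-- The solution of `-y'' = lam y` with `y 0 = 0`, `y' 0 = 1`. -/
noncomputable def sinSol (x : ℝ) (lam : ℂ) : ℂ := x * sincSqrt ((x : ℂ) ^ 2 * lam)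

theorem cosSol_sq (x : ℝ) (r : ℂ) : cosSol x (r ^ 2) = Complex.cos (r * x) := by
  rw [cosSol, ← cosSqrt_sq]; ring_nf

theorem mul_sinSol_sq (x : ℝ) (r : ℂ) : r * sinSol x (r ^ 2) = Complex.sin (r * x) := by
  rw [sinSol, ← mul_sincSqrt_sq]; ring_nf

theorem sinSol_zero_right (x : ℝ) : sinSol x 0 = x := by simp [sinSol, sincSqrt_zero]

theorem cosSol_zero_right (x : ℝ) : cosSol x 0 = 1 := by
  have := cosSol_sq x 0
  simpa using this

@[simp] theorem sinSol_zero (lam : ℂ) : sinSol 0 lam = 0 := by simp [sinSol]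

@[simp] theorem cosSol_zero (lam : ℂ) : cosSol 0 lam = 1 := by
  have := cosSqrt_sq 0
  simpa [cosSol] using this

theorem exists_eq_sq (lam : ℂ) : ∃ r : ℂ, lam = r ^ 2 := by
  obtain ⟨r, hr⟩ := IsAlgClosed.exists_pow_nat_eq lam two_pos
  exact ⟨r, hr.symm⟩

theorem cosSol_sq_add_sinSol_sq (x : ℝ) (lam : ℂ) :
    cosSol x lam ^ 2 + lam * sinSol x lam ^ 2 = 1 := by
  obtain ⟨r, rfl⟩ := exists_eq_sq lam
  rw [← mul_pow, mul_sinSol_sq, cosSol_sq, Complex.cos_sq_add_sin_sq]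

theorem hasDerivAt_cosSol (x : ℝ) (lam : ℂ) :
    HasDerivAt (fun x => cosSol x lam) (-lam * sinSol x lam) x := by
  obtain ⟨r, rfl⟩ := exists_eq_sq lam
  simp only [cosSol_sq]
  have h : HasDerivAt (fun z : ℂ => Complex.cos (r * z)) (-Complex.sin (r * x) * r) x := by
    simpa using ((hasDerivAt_id (x : ℂ)).const_mul r).ccos
  have := h.comp_ofReal
  convert this using 1
  rw [← mul_sinSol_sq]; ring

theorem hasDerivAt_sinSol (x : ℝ) (lam : ℂ) :
    HasDerivAt (fun x => sinSol x lam) (cosSol x lam) x := by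
  obtain ⟨r, rfl⟩ := exists_eq_sq lam
  by_cases hr : r = 0
  · subst hr
    simp only [ne_eq, OfNat.ofNat_ne_zero, not_false_eq_true, zero_pow, sinSol_zero_right,
      cosSol_zero_right]
    exact (hasDerivAt_id (x : ℂ)).comp_ofReal
  · have heq : (fun x => sinSol x (r ^ 2)) = fun x : ℝ => r⁻¹ * Complex.sin (r * x) := by
      funext x
      rw [← mul_sinSol_sq, inv_mul_cancel_left₀ hr]
    rw [heq, cosSol_sq]
    have h : HasDerivAt (fun z : ℂ => r⁻¹ * Complex.sin (r * z)) (Complex.cos (r * x)) x := by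
      refine ((((hasDerivAt_id (x : ℂ)).const_mul r).csin).const_mul r⁻¹).congr_deriv ?_
      simp only [id]
      field_simp
    exact h.comp_ofReal

/-! ### Families of entire functions and their primitives in x -/

/-- A jointly continuous family of entire functions. -/
structure EntireFamily (K : ℝ → ℂ → ℂ) : Prop where
  cont : Continuous (uncurry K)
  diff : ∀ t, Differentiable ℂ (K t)

namespace EntireFamily

variable {K K₁ K₂ : ℝ → ℂ → ℂ}

theorem add (h₁ : EntireFamily K₁) (h₂ : EntireFamily K₂) :
    EntireFamily (fun t z => K₁ t z + K₂ t z) :=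
  ⟨h₁.cont.add h₂.cont, fun t => (h₁.diff t).add (h₂.diff t)⟩

theorem sub (h₁ : EntireFamily K₁) (h₂ : EntireFamily K₂) :
    EntireFamily (fun t z => K₁ t z - K₂ t z) :=
  ⟨h₁.cont.sub h₂.cont, fun t => (h₁.diff t).sub (h₂.diff t)⟩

theorem mul (h₁ : EntireFamily K₁) (h₂ : EntireFamily K₂) :
    EntireFamily (fun t z => K₁ t z * K₂ t z) :=
  ⟨h₁.cont.mul h₂.cont, fun t => (h₁.diff t).mul (h₂.diff t)⟩

theorem const {f : ℂ → ℂ} (hf : Differentiable ℂ f) : EntireFamily (fun _ z => f z) :=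
  ⟨hf.continuous.comp continuous_snd, fun _ => hf⟩

theorem lam : EntireFamily (fun _ z => z) := const differentiable_id

theorem continuous_left (h : EntireFamily K) (z : ℂ) : Continuous (fun t => K t z) :=
  h.cont.comp (by fun_prop : Continuous fun t : ℝ => (t, z))

end EntireFamily

theorem entireFamily_cosSol : EntireFamily cosSol where
  cont := differentiable_cosSqrt.continuous.comp (by fun_prop)
  diff t := differentiable_cosSqrt.comp (by fun_prop)

theorem entireFamily_sinSol : EntireFamily sinSol where
  cont := (by fun_prop : Continuous fun p : ℝ × ℂ => (p.1 : ℂ)).mul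
    (differentiable_sincSqrt.continuous.comp (by fun_prop))
  diff t := (differentiable_sincSqrt.comp (by fun_prop)).const_mul _

instance isFiniteMeasure_restrict_uIoc (a b : ℝ) :
    IsFiniteMeasure (volume.restrict (uIoc a b)) :=
  inferInstanceAs (IsFiniteMeasure (volume.restrict (Ioc (min a b) (max a b))))

/-- On compact sets K is bounded by some M, so ‖q‖·M dominates the integrand locally uniformly in z.
The same M dominates the z-derivative on the unit ball around z, by Cauchy's estimate on unit
circles; hence the bound on the ball of radius 2. -/
theorem EntireFamily.primitive {q : ℝ → ℂ} {K : ℝ → ℂ → ℂ} (hK : EntireFamily K)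
    (hq : Integrable q) : EntireFamily (fun x z => ∫ t in (0 : ℝ)..x, q t * K t z) := by
  have hmeas : ∀ z (s : Set ℝ), AEStronglyMeasurable (fun t => q t * K t z) (volume.restrict s) :=
    fun z s => (hq.1.mul (hK.continuous_left z).aestronglyMeasurable).restrict
  have hbdd : ∀ (a b : ℝ) (z : ℂ) (R : ℝ), ∃ M : ℝ, 0 ≤ M ∧
      ∀ t ∈ uIcc a b, ∀ w ∈ Metric.closedBall z R, ‖K t w‖ ≤ M := by
    intro a b z R
    obtain ⟨M, hM⟩ := (isCompact_uIcc.prod (isCompact_closedBall z R)).exists_bound_of_continuousOn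
      (f := uncurry K) (s := uIcc a b ×ˢ Metric.closedBall z R) hK.cont.continuousOn
    exact ⟨max M 0, le_max_right _ _,
      fun t ht w hw => (hM (t, w) ⟨ht, hw⟩).trans (le_max_left _ _)⟩
  refine ⟨?_, fun x z => ?_⟩
  · rw [continuous_iff_continuousAt]
    rintro ⟨x, z⟩
    obtain ⟨M, hM0, hM⟩ := hbdd (-(|x| + 1)) (|x| + 1) z 1
    have := intervalIntegral.continuousAt_parametric_primitive_of_dominated (μ := volume)
      (F := fun (w : ℂ) t => q t * K t w) (fun t => ‖q t‖ * M) (-(|x| + 1)) (|x| + 1)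
      (a₀ := 0) (b₀ := x) (x₀ := z) (fun w => hmeas w _) ?_
      ((hq.norm.mul_const M).intervalIntegrable) ?_ ?_ ?_ (by simp)
    · exact this.comp (f := fun p : ℝ × ℂ => (p.2, p.1)) (x := (x, z))
        (by fun_prop : Continuous fun p : ℝ × ℂ => (p.2, p.1)).continuousAt
    · filter_upwards [Metric.closedBall_mem_nhds z one_pos] with w hw
      refine ae_restrict_of_forall_mem measurableSet_uIoc fun t ht => ?_
      rw [norm_mul]
      exact mul_le_mul_of_nonneg_left (hM t (uIoc_subset_uIcc ht) w hw) (norm_nonneg _)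
    · exact ae_of_all _ fun t => ((hK.diff t).continuous.const_mul _ |>.continuousAt)
    · constructor <;> linarith [abs_nonneg x]
    · constructor <;> linarith [neg_abs_le x, le_abs_self x]
  · obtain ⟨M, hM0, hM⟩ := hbdd 0 x z 2
    have hd := stronglyMeasurable_deriv_with_param hK.cont
    refine (intervalIntegral.hasDerivAt_integral_of_dominated_loc_of_deriv_le
      (F := fun (w : ℂ) t => q t * K t w) (F' := fun w t => q t * deriv (K t) w)
      (bound := fun t => ‖q t‖ * M) (Metric.ball_mem_nhds z one_pos)
      (Eventually.of_forall fun w => hmeas w _) ?_ ?_ ?_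
      ((hq.norm.mul_const M).intervalIntegrable) ?_).2.differentiableAt
    · exact hq.intervalIntegrable.mul_continuousOn (hK.continuous_left z).continuousOn
    · refine (hq.1.mul ?_).restrict
      exact (hd.comp_measurable (measurable_id.prodMk measurable_const)).aestronglyMeasurable
    · refine ae_of_all _ fun t ht w hw => ?_
      rw [norm_mul]
      refine mul_le_mul_of_nonneg_left ?_ (norm_nonneg _)
      have := Complex.norm_deriv_le_of_forall_mem_sphere_norm_le (f := K t) (c := w) (C := M)
        one_pos (hK.diff t).diffContOnCl (fun v hv => hM t (uIoc_subset_uIcc ht) v ?_)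
      · simpa using this
      · rw [Metric.mem_closedBall]
        have h1 : dist v w = 1 := hv
        have h2 : dist w z < 1 := hw
        linarith [dist_triangle v w z]
    · exact ae_of_all _ fun t _ w _ => ((hK.diff t w).hasDerivAt).const_mul _

/-! ### Taylor coefficients as contour integrals -/

/-- The coefficient at `(z - c) ^ (i - 1)` of the Taylor series of `g` at `c`, as a contour
integral. -/
noncomputable def circleCoeff (c : ℂ) (i : ℕ) (g : ℂ → ℂ) : ℂ :=
  (2 * Real.pi * Complex.I)⁻¹ * ∮ z in C(c, 1), ((z - c) ^ i)⁻¹ * g z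

namespace circleCoeff

variable {c : ℂ} {i : ℕ} {f g : ℂ → ℂ}

theorem circleIntegrable_aux (c : ℂ) (i : ℕ) (hg : Continuous g) :
    CircleIntegrable (fun z => ((z - c) ^ i)⁻¹ * g z) c 1 := by
  refine ContinuousOn.circleIntegrable zero_le_one
    (ContinuousOn.mul (ContinuousOn.inv₀ (by fun_prop) fun z hz => ?_) hg.continuousOn)
  refine pow_ne_zero _ fun h => ?_
  rw [Metric.mem_sphere, dist_eq_norm, h] at hz
  simp at hz

theorem add (hf : Continuous f) (hg : Continuous g) :
    circleCoeff c i (fun z => f z + g z) = circleCoeff c i f + circleCoeff c i g := by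
  simp only [circleCoeff, mul_add]
  rw [circleIntegral.integral_add (circleIntegrable_aux c i hf) (circleIntegrable_aux c i hg),
    mul_add]

theorem sub (hf : Continuous f) (hg : Continuous g) :
    circleCoeff c i (fun z => f z - g z) = circleCoeff c i f - circleCoeff c i g := by
  simp only [circleCoeff, mul_sub]
  rw [circleIntegral.integral_sub (circleIntegrable_aux c i hf) (circleIntegrable_aux c i hg),
    mul_sub]

theorem const_mul (a : ℂ) :
    circleCoeff c i (fun z => a * g z) = a * circleCoeff c i g := by
  simp only [circleCoeff, mul_left_comm _ a]
  rw [circleIntegral.integral_const_mul, mul_left_comm]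

/-- At index 0 the integrand has no pole. The index is shifted by one precisely so that chains of
Taylor coefficients start from this zero. -/
theorem zero_of_differentiable (hg : Differentiable ℂ g) : circleCoeff c 0 g = 0 := by
  have := (hg.diffContOnCl (s := Metric.ball c 1)).circleIntegral_eq_zero zero_le_one
  simp [circleCoeff, this]

/-- Write z = c + (z − c); the factor z − c cancels one power of the pole. Applied to ℓY = zY, this
is the chain relation (ℓ − c)Yᵢ₊₁ = Yᵢ. -/
theorem lam_mul (hg : Continuous g) :
    circleCoeff c (i + 1) (fun z => z * g z) = c * circleCoeff c (i + 1) g + circleCoeff c i g := by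
  rw [← const_mul, circleCoeff, circleCoeff, circleCoeff, ← mul_add,
    ← circleIntegral.integral_add (circleIntegrable_aux c _ (by fun_prop))
      (circleIntegrable_aux c i hg)]
  congr 1
  refine circleIntegral.integral_congr zero_le_one fun z hz => ?_
  have hz' : z - c ≠ 0 := fun h => by
    rw [Metric.mem_sphere, dist_eq_norm, h] at hz
    simp at hz
  field_simp
  ring

theorem one (hg : Differentiable ℂ g) : circleCoeff c 1 g = g c := by
  have := (hg.differentiableOn (s := Metric.closedBall c 1)).circleIntegral_sub_inv_smul
    (Metric.mem_ball_self one_pos)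
  simp only [smul_eq_mul] at this
  simp only [circleCoeff, pow_one, this]
  rw [inv_mul_cancel_left₀]
  simp [Real.pi_ne_zero]

theorem pow_mul_of_le {p : ℕ} (hg : Differentiable ℂ g) (hi : i ≤ p) :
    circleCoeff c i (fun z => (z - c) ^ p * g z) = 0 := by
  have h : circleCoeff c i (fun z => (z - c) ^ p * g z)
      = circleCoeff c 0 (fun z => (z - c) ^ (p - i) * g z) := by
    simp only [circleCoeff]
    congr 1
    refine circleIntegral.integral_congr zero_le_one fun z hz => ?_
    have hz' : z - c ≠ 0 := fun h => by
      rw [Metric.mem_sphere, dist_eq_norm, h] at hz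
      simp at hz
    obtain ⟨k, rfl⟩ := Nat.exists_eq_add_of_le hi
    simp only [Nat.add_sub_cancel_left]
    field_simp
    ring
  rw [h]
  exact zero_of_differentiable (by fun_prop)

theorem pow_mul_succ {p : ℕ} (hg : Differentiable ℂ g) :
    circleCoeff c (p + 1) (fun z => (z - c) ^ p * g z) = g c := by
  rw [← one hg]
  simp only [circleCoeff]
  congr 1
  refine circleIntegral.integral_congr zero_le_one fun z hz => ?_
  have hz' : z - c ≠ 0 := fun h => by
    rw [Metric.mem_sphere, dist_eq_norm, h] at hz
    simp at hz
  field_simp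
  ring

theorem circleMap_sub_ne (c : ℂ) (θ : ℝ) : circleMap c 1 θ - c ≠ 0 := by simp [circleMap]

/-- `circleCoeff` as an interval integral with a continuous weight. -/
theorem exists_weight (c : ℂ) (i : ℕ) : ∃ w : ℝ → ℂ, Continuous w ∧ ∀ g : ℂ → ℂ,
    circleCoeff c i g = ∫ θ in (0 : ℝ)..2 * Real.pi, w θ * g (circleMap c 1 θ) := by
  refine ⟨fun θ => (2 * Real.pi * Complex.I)⁻¹ * (deriv (circleMap c 1) θ *
    ((circleMap c 1 θ - c) ^ i)⁻¹), ?_, fun g => ?_⟩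
  · have h1 : Continuous (deriv (circleMap c 1)) := by
      rw [show deriv (circleMap c 1) = fun θ => circleMap 0 1 θ * Complex.I from
        funext fun θ => deriv_circleMap c 1 θ]
      fun_prop
    refine continuous_const.mul (h1.mul (Continuous.inv₀ ?_ ?_))
    · fun_prop
    · exact fun θ => pow_ne_zero _ (circleMap_sub_ne c θ)
  · simp only [circleCoeff, circleIntegral, smul_eq_mul, mul_assoc]
    rw [intervalIntegral.integral_const_mul]

theorem continuous {K : ℝ → ℂ → ℂ} (hK : EntireFamily K) :
    Continuous fun x => circleCoeff c i (K x) := by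
  obtain ⟨w, hw, h⟩ := exists_weight c i
  simp only [h]
  refine intervalIntegral.continuous_parametric_intervalIntegral_of_continuous'
    (f := fun x θ => w θ * K x (circleMap c 1 θ)) ?_ _ _
  exact (hw.comp continuous_snd).mul (hK.cont.comp
    (by fun_prop : Continuous fun p : ℝ × ℝ => (p.1, circleMap c 1 p.2)))

/-- Fubini: on the compact rectangle the continuous factor is bounded, so q dominates the double
integral. -/
theorem primitive {q : ℝ → ℂ} {K : ℝ → ℂ → ℂ} (hK : EntireFamily K) (hq : Integrable q) (x : ℝ) :
    circleCoeff c i (fun z => ∫ t in (0 : ℝ)..x, q t * K t z)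
      = ∫ t in (0 : ℝ)..x, q t * circleCoeff c i (K t) := by
  obtain ⟨w, hw, h⟩ := exists_weight c i
  simp only [h, ← intervalIntegral.integral_const_mul]
  have hcont : Continuous (fun p : ℝ × ℝ => w p.1 * K p.2 (circleMap c 1 p.1)) :=
    (hw.comp continuous_fst).mul (hK.cont.comp
      (by fun_prop : Continuous fun p : ℝ × ℝ => (p.2, circleMap c 1 p.1)))
  rw [intervalIntegral_intervalIntegral_swap]
  · refine intervalIntegral.integral_congr fun t _ => ?_
    exact intervalIntegral.integral_congr fun θ _ => by ring
  · obtain ⟨M, hM⟩ := ((isCompact_uIcc (a := (0 : ℝ)) (b := 2 * Real.pi)).prod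
      (isCompact_uIcc (a := (0 : ℝ)) (b := x))).exists_bound_of_continuousOn hcont.continuousOn
    have h1 : IntegrableOn (fun p : ℝ × ℝ => q p.2) (uIoc 0 (2 * Real.pi) ×ˢ uIoc 0 x) := by
      rw [IntegrableOn, Measure.volume_eq_prod, ← Measure.prod_restrict]
      exact hq.integrableOn.comp_snd _
    have h2 := h1.mul_bdd (c := M) (g := fun p : ℝ × ℝ => w p.1 * K p.2 (circleMap c 1 p.1))
      hcont.aestronglyMeasurable
      (ae_restrict_of_forall_mem (measurableSet_uIoc.prod measurableSet_uIoc) fun p hp =>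
        hM p ⟨uIoc_subset_uIcc hp.1, uIoc_subset_uIcc hp.2⟩)
    refine h2.congr (ae_of_all _ fun p => ?_)
    simp only [uncurry]; ring

end circleCoeff

/-! ### Variation of parameters on one edge -/

/-- Product rule for u·∫g. As g is merely integrable, its primitive need not be differentiable
everywhere; the identity comes instead from exchanging the order of integration over the triangle t
≤ s ≤ x. -/
theorem integral_deriv_mul_primitive {u u' g : ℝ → ℂ} (hu : ∀ x, HasDerivAt u (u' x) x)
    (hu' : Continuous u') (hg : ∀ a b, IntervalIntegrable g volume a b) {x : ℝ} (hx : 0 ≤ x) :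
    IntervalIntegrable (fun s => (u' s * ∫ t in (0 : ℝ)..s, g t) + u s * g s) volume 0 x ∧
      ∫ s in (0 : ℝ)..x, (u' s * ∫ t in (0 : ℝ)..s, g t) + u s * g s
        = u x * ∫ t in (0 : ℝ)..x, g t := by
  have hucont : Continuous u := continuous_iff_continuousAt.2 fun x => (hu x).continuousAt
  have hprim : Continuous fun s => ∫ t in (0 : ℝ)..s, g t :=
    intervalIntegral.continuous_primitive hg 0
  have hug : IntervalIntegrable (fun s => u s * g s) volume 0 x :=
    (hg 0 x).continuousOn_mul hucont.continuousOn
  refine ⟨((hu'.mul hprim).intervalIntegrable _ _).add hug, ?_⟩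
  rw [intervalIntegral.integral_add (f := fun s => u' s * ∫ t in (0 : ℝ)..s, g t)
    ((hu'.mul hprim).intervalIntegrable _ _) hug]
  have key : ∫ s in (0 : ℝ)..x, (u' s * ∫ t in (0 : ℝ)..s, g t)
      = ∫ t in (0 : ℝ)..x, g t * (u x - u t) := by
    have e1 : ∀ s ∈ uIcc 0 x, (u' s * ∫ t in (0 : ℝ)..s, g t)
        = ∫ t in (0 : ℝ)..x, (Iic s).indicator (fun t => u' s * g t) t := by
      intro s hs
      rw [uIcc_of_le hx] at hs
      rw [intervalIntegral.integral_of_le hx, setIntegral_indicator measurableSet_Iic,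
        Ioc_inter_Iic, min_eq_right hs.2, ← intervalIntegral.integral_of_le hs.1,
        intervalIntegral.integral_const_mul]
    have e2 : ∀ t ∈ uIcc 0 x, g t * (u x - u t)
        = ∫ s in (0 : ℝ)..x, (Iic s).indicator (fun t => u' s * g t) t := by
      intro t ht
      rw [uIcc_of_le hx] at ht
      have : ∀ s, (Iic s).indicator (fun t => u' s * g t) t
          = (Ici t).indicator (fun s => u' s * g t) s := fun s => by
        simp [indicator_apply]
      simp only [this]
      rw [intervalIntegral.integral_of_le hx, ← integral_Icc_eq_integral_Ioc,
        setIntegral_indicator measurableSet_Ici,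
        show Icc 0 x ∩ Ici t = Icc t x by ext s; simp; grind, integral_Icc_eq_integral_Ioc,
        ← intervalIntegral.integral_of_le ht.2, intervalIntegral.integral_mul_const,
        intervalIntegral.integral_eq_sub_of_hasDerivAt (fun s _ => hu s)
          (hu'.intervalIntegrable _ _), mul_comm]
    rw [intervalIntegral.integral_congr e1, intervalIntegral.integral_congr e2,
      intervalIntegral_intervalIntegral_swap]
    obtain ⟨M, hM⟩ := (isCompact_uIcc (a := (0 : ℝ)) (b := x)).exists_bound_of_continuousOn
      hu'.continuousOn
    have h1 : IntegrableOn (fun p : ℝ × ℝ => g p.2) (uIoc 0 x ×ˢ uIoc 0 x) := by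
      rw [IntegrableOn, Measure.volume_eq_prod, ← Measure.prod_restrict]
      exact (intervalIntegrable_iff.1 (hg 0 x)).comp_snd _
    have h2 : IntegrableOn (fun p : ℝ × ℝ => u' p.1 * g p.2) (uIoc 0 x ×ˢ uIoc 0 x) :=
      h1.bdd_mul (c := M) (f := fun p : ℝ × ℝ => u' p.1)
        (hu'.comp continuous_fst).aestronglyMeasurable
        (ae_restrict_of_forall_mem (measurableSet_uIoc.prod measurableSet_uIoc) fun p hp =>
          hM p.1 (uIoc_subset_uIcc hp.1))
    have hm : MeasurableSet {p : ℝ × ℝ | p.2 ≤ p.1} := measurableSet_le measurable_snd measurable_fst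
    refine (h2.indicator hm).congr (ae_of_all _ fun p => ?_)
    simp [uncurry, indicator_apply]
  rw [key, ← intervalIntegral.integral_add, ← intervalIntegral.integral_const_mul]
  · exact intervalIntegral.integral_congr fun t _ => by ring
  · exact (hg 0 x).mul_continuousOn (by fun_prop)
  · exact hug

theorem memLp_two_mul_continuous {q φ : ℝ → ℂ} {a b : ℝ}
    (hq : MemLp q 2 (volume.restrict (Ioo a b))) (hφ : Continuous φ) :
    MemLp (fun x => q x * φ x) 2 (volume.restrict (Ioo a b)) := by
  obtain ⟨M, hM⟩ := (isCompact_Icc (a := a) (b := b)).exists_bound_of_continuousOn hφ.continuousOn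
  refine hq.of_le_mul (c := M) (hq.1.mul hφ.aestronglyMeasurable)
    (ae_restrict_of_forall_mem measurableSet_Ioo fun x hx => ?_)
  rw [norm_mul, mul_comm]
  exact mul_le_mul_of_nonneg_right (hM x (Ioo_subset_Icc_self hx)) (norm_nonneg _)

theorem memLp_two_of_continuous {φ : ℝ → ℂ} {a b : ℝ} (hφ : Continuous φ) :
    MemLp φ 2 (volume.restrict (Ioo a b)) := by
  have := memLp_two_mul_continuous (a := a) (b := b) (memLp_const (1 : ℂ)) hφ
  simpa using this

/-- The moment `∫₀ˣ q C S`. -/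
noncomputable def csMoment (q : ℝ → ℂ) (x : ℝ) (lam : ℂ) : ℂ :=
  ∫ t in (0 : ℝ)..x, q t * (cosSol t lam * sinSol t lam)

/-- The moment `∫₀ˣ q S²`. -/
noncomputable def ssMoment (q : ℝ → ℂ) (x : ℝ) (lam : ℂ) : ℂ :=
  ∫ t in (0 : ℝ)..x, q t * (sinSol t lam * sinSol t lam)

/-- The solution of `-y'' + q S = lam y` with `y 0 = a`, `y' 0 = b`. -/
noncomputable def edgeSol (q : ℝ → ℂ) (a b : ℂ) (x : ℝ) (lam : ℂ) : ℂ :=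
  sinSol x lam * (b + csMoment q x lam) + cosSol x lam * (a - ssMoment q x lam)

/-- The derivative of `edgeSol` in `x`. -/
noncomputable def edgeDer (q : ℝ → ℂ) (a b : ℂ) (x : ℝ) (lam : ℂ) : ℂ :=
  cosSol x lam * (b + csMoment q x lam) - lam * sinSol x lam * (a - ssMoment q x lam)

section edge

variable {q : ℝ → ℂ} {a b : ℂ} {lam : ℂ}

theorem entireFamily_csMoment (hq : Integrable q) : EntireFamily (csMoment q) :=
  (entireFamily_cosSol.mul entireFamily_sinSol).primitive hq

theorem entireFamily_ssMoment (hq : Integrable q) : EntireFamily (ssMoment q) :=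
  (entireFamily_sinSol.mul entireFamily_sinSol).primitive hq

theorem entireFamily_edgeSol (hq : Integrable q) {a b : ℂ → ℂ} (ha : Differentiable ℂ a)
    (hb : Differentiable ℂ b) : EntireFamily (fun x lam => edgeSol q (a lam) (b lam) x lam) :=
  (entireFamily_sinSol.mul ((EntireFamily.const hb).add (entireFamily_csMoment hq))).add
    (entireFamily_cosSol.mul ((EntireFamily.const ha).sub (entireFamily_ssMoment hq)))

theorem entireFamily_edgeDer (hq : Integrable q) {a b : ℂ → ℂ} (ha : Differentiable ℂ a)
    (hb : Differentiable ℂ b) : EntireFamily (fun x lam => edgeDer q (a lam) (b lam) x lam) :=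
  (entireFamily_cosSol.mul ((EntireFamily.const hb).add (entireFamily_csMoment hq))).sub
    ((EntireFamily.lam.mul entireFamily_sinSol).mul
      ((EntireFamily.const ha).sub (entireFamily_ssMoment hq)))

@[simp] theorem edgeSol_zero : edgeSol q a b 0 lam = a := by simp [edgeSol, ssMoment]

@[simp] theorem edgeDer_zero : edgeDer q a b 0 lam = b := by simp [edgeDer, csMoment]

/-- The product rule is applied to S∫qCS and C∫qS²; the terms containing q pointwise, S·qCS and
C·qS², cancel. -/
theorem edgeSol_eq_add_integral (hq : Integrable q) {x : ℝ} (hx : 0 ≤ x) :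
    edgeSol q a b x lam = a + ∫ t in (0 : ℝ)..x, edgeDer q a b t lam := by
  have hS := entireFamily_sinSol.continuous_left lam
  have hC := entireFamily_cosSol.continuous_left lam
  have hP := (entireFamily_csMoment hq).continuous_left lam
  have hQ := (entireFamily_ssMoment hq).continuous_left lam
  have hqI : ∀ φ : ℝ → ℂ, Continuous φ → ∀ a b, IntervalIntegrable (fun t => q t * φ t) volume a b :=
    fun φ hφ a b => hq.intervalIntegrable.mul_continuousOn hφ.continuousOn
  have i1 := intervalIntegral.integral_eq_sub_of_hasDerivAt (a := 0) (b := x)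
    (fun s _ => hasDerivAt_sinSol s lam) (hC.intervalIntegrable _ _)
  have i2 := intervalIntegral.integral_eq_sub_of_hasDerivAt (a := 0) (b := x)
    (fun s _ => hasDerivAt_cosSol s lam)
    ((by fun_prop : Continuous fun t => -lam * sinSol t lam).intervalIntegrable _ _)
  obtain ⟨j3, i3⟩ := integral_deriv_mul_primitive (fun s => hasDerivAt_sinSol s lam) hC
    (hqI (fun t => cosSol t lam * sinSol t lam) (by fun_prop)) hx
  obtain ⟨j4, i4⟩ := integral_deriv_mul_primitive (fun s => hasDerivAt_cosSol s lam) (by fun_prop)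
    (hqI (fun t => sinSol t lam * sinSol t lam) (by fun_prop)) hx
  simp only [sinSol_zero, cosSol_zero, sub_zero] at i1 i2
  have e : ∀ t, edgeDer q a b t lam = (b * cosSol t lam + a * (-lam * sinSol t lam))
      + ((cosSol t lam * csMoment q t lam + sinSol t lam * (q t * (cosSol t lam * sinSol t lam)))
      - (-lam * sinSol t lam * ssMoment q t lam
        + cosSol t lam * (q t * (sinSol t lam * sinSol t lam)))) := fun t => by
    rw [edgeDer]; ring
  simp only [e, csMoment, ssMoment] at hP hQ ⊢
  rw [intervalIntegral.integral_add ((by fun_prop : Continuous _).intervalIntegrable _ _)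
    (j3.sub j4), intervalIntegral.integral_sub j3 j4,
    intervalIntegral.integral_add ((by fun_prop : Continuous _).intervalIntegrable _ _)
      ((by fun_prop : Continuous _).intervalIntegrable _ _),
    intervalIntegral.integral_const_mul, intervalIntegral.integral_const_mul]
  rw [i1, i2, i3, i4, edgeSol, csMoment, ssMoment]
  ring

/-- Same product rule, but now the pointwise terms add up to qS(C² + λS²) = qS, the delay term. The
two integrals stay separate because contour integrals are later taken of each: one has the
integrable weight q, the other a continuous integrand. -/
theorem edgeDer_eq_add_integral (hq : Integrable q) {x : ℝ} (hx : 0 ≤ x) :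
    edgeDer q a b x lam = b + ((∫ t in (0 : ℝ)..x, q t * sinSol t lam)
      - ∫ t in (0 : ℝ)..x, lam * edgeSol q a b t lam) := by
  have hS := entireFamily_sinSol.continuous_left lam
  have hC := entireFamily_cosSol.continuous_left lam
  have hP := (entireFamily_csMoment hq).continuous_left lam
  have hQ := (entireFamily_ssMoment hq).continuous_left lam
  have hqI : ∀ φ : ℝ → ℂ, Continuous φ → ∀ a b, IntervalIntegrable (fun t => q t * φ t) volume a b :=
    fun φ hφ a b => hq.intervalIntegrable.mul_continuousOn hφ.continuousOn
  have i1 := intervalIntegral.integral_eq_sub_of_hasDerivAt (a := 0) (b := x)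
    (fun s _ => hasDerivAt_sinSol s lam) (hC.intervalIntegrable _ _)
  have i2 := intervalIntegral.integral_eq_sub_of_hasDerivAt (a := 0) (b := x)
    (fun s _ => hasDerivAt_cosSol s lam)
    ((by fun_prop : Continuous fun t => -lam * sinSol t lam).intervalIntegrable _ _)
  obtain ⟨j3, i3⟩ := integral_deriv_mul_primitive (fun s => hasDerivAt_cosSol s lam) (by fun_prop)
    (hqI (fun t => cosSol t lam * sinSol t lam) (by fun_prop)) hx
  obtain ⟨j4, i4⟩ := integral_deriv_mul_primitive (fun s => hasDerivAt_sinSol s lam) hC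
    (hqI (fun t => sinSol t lam * sinSol t lam) (by fun_prop)) hx
  simp only [sinSol_zero, cosSol_zero, sub_zero] at i1 i2
  rw [← intervalIntegral.integral_sub (hqI _ hS 0 x)
    (((entireFamily_edgeSol hq (differentiable_const a)
      (differentiable_const b)).continuous_left lam).const_mul lam |>.intervalIntegrable _ _)]
  have e : ∀ t, q t * sinSol t lam - lam * edgeSol q a b t lam
      = (b * (-lam * sinSol t lam) + (-lam * a) * cosSol t lam)
      + ((-lam * sinSol t lam * csMoment q t lam
        + cosSol t lam * (q t * (cosSol t lam * sinSol t lam)))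
      + lam * (cosSol t lam * ssMoment q t lam
        + sinSol t lam * (q t * (sinSol t lam * sinSol t lam)))) := fun t => by
    rw [edgeSol]
    linear_combination (-q t * sinSol t lam) * cosSol_sq_add_sinSol_sq t lam
  simp only [e, csMoment, ssMoment] at hP hQ ⊢
  rw [intervalIntegral.integral_add ((by fun_prop : Continuous _).intervalIntegrable _ _)
    (j3.add (j4.const_mul lam)), intervalIntegral.integral_add j3 (j4.const_mul lam),
    intervalIntegral.integral_add ((by fun_prop : Continuous _).intervalIntegrable _ _)
      ((by fun_prop : Continuous _).intervalIntegrable _ _),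
    intervalIntegral.integral_const_mul b, intervalIntegral.integral_const_mul (-lam * a),
    intervalIntegral.integral_const_mul lam]
  rw [i1, i2, i3, i4, edgeDer, csMoment, ssMoment]
  ring

end edge

/-! ### Characteristic function and distinguished family of solutions -/

/-- The potentials on the three edges. -/
def edgePot (q₂ q₃ : ℝ → ℂ) : Edge → ℝ → ℂ
  | .e1 => fun _ => 0
  | .e2 => q₂
  | .e3 => q₃

/-- Value at the far end of the second edge of the solution with slope `0` at the vertex. -/
noncomputable def farValue (q₂ : ℝ → ℂ) (lam : ℂ) : ℂ := edgeSol q₂ (sinSol 1 lam) 0 1 lam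

/-- Slope at the far end of the third edge of the solution which takes the whole flow. -/
noncomputable def farSlope (q₃ : ℝ → ℂ) (lam : ℂ) : ℂ :=
  edgeDer q₃ (sinSol 1 lam) (cosSol 1 lam) 1 lam

/-- The characteristic function of the boundary value problem with `k = 1`. -/
noncomputable def charFun₁ (q₂ q₃ : ℝ → ℂ) (lam : ℂ) : ℂ :=
  cosSol 1 lam * farValue q₂ lam + sinSol 1 lam * farSlope q₃ lam

/-- The slope at the vertex on the second edge of the distinguished family of solutions. -/
noncomputable def vertexSlope (q₂ q₃ : ℝ → ℂ) (lam : ℂ) : ℂ :=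
  cosSol 1 lam * farSlope q₃ lam - lam * sinSol 1 lam * farValue q₂ lam

noncomputable def initVal : Edge → ℂ → ℂ
  | .e1 => fun _ => 0
  | .e2 => sinSol 1
  | .e3 => sinSol 1

noncomputable def initSlope (q₂ q₃ : ℝ → ℂ) : Edge → ℂ → ℂ
  | .e1 => fun _ => 1
  | .e2 => vertexSlope q₂ q₃
  | .e3 => fun lam => cosSol 1 lam - vertexSlope q₂ q₃ lam

/-- The distinguished family of solutions, entire in `lam`. -/
noncomputable def solFam (q₂ q₃ : ℝ → ℂ) (j : Edge) (x : ℝ) (lam : ℂ) : ℂ :=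
  edgeSol (edgePot q₂ q₃ j) (initVal j lam) (initSlope q₂ q₃ j lam) x lam

/-- The derivative in `x` of the distinguished family of solutions. -/
noncomputable def derFam (q₂ q₃ : ℝ → ℂ) (j : Edge) (x : ℝ) (lam : ℂ) : ℂ :=
  edgeDer (edgePot q₂ q₃ j) (initVal j lam) (initSlope q₂ q₃ j lam) x lam

/-! ### The problem without the conditions at the far ends -/

/-- `d j ν`, the derivatives of functions on the graph, solve `(ℓ - lam) y = f` except for the
conditions at the far ends of the second and third edges, where `b₂` and `b₃` are attained. -/
structure SolvesInner (q₂ q₃ : ℝ → ℂ) (lam : ℂ) (d : Edge → ℕ → ℝ → ℂ) (f : Edge → ℝ → ℂ)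
    (b₂ b₃ : ℂ) : Prop where
  isW22 : ∀ j, IsW22 (d j)
  eqn : ∀ j, ∀ᵐ x ∂(volume.restrict (Ioo (0 : ℝ) 1)),
    -(d j 2 x) + edgePot q₂ q₃ j x * d .e1 0 x - lam * d j 0 x = f j x
  match₂ : d .e1 0 1 = d .e2 0 0
  match₃ : d .e2 0 0 = d .e3 0 0
  flow : d .e1 1 1 = d .e2 1 0 + d .e3 1 0
  root : d .e1 0 0 = 0
  far₂ : d .e2 0 1 = b₂
  far₃ : d .e3 1 1 = b₃

theorem solvesProblem_one_iff {q₂ q₃ : ℝ → ℂ} {lam : ℂ} {y f : Edge → ℝ → ℂ} :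
    SolvesProblem 1 q₂ q₃ lam y f ↔
      ∃ d : Edge → ℕ → ℝ → ℂ, (∀ j, d j 0 = y j) ∧ SolvesInner q₂ q₃ lam d f 0 0 := by
  constructor
  · rintro ⟨d, h0, hW, heq, ⟨h1, h2, h3⟩, h4, h5, h6⟩
    simp only [← h0] at heq h1 h2 h3 h4 h5 h6
    refine ⟨d, h0, hW, fun j => ?_, h1, h2, h3, h4, h5, h6⟩
    filter_upwards [heq] with x hx
    cases j
    · simpa [edgePot] using hx.1
    · exact hx.2.1
    · exact hx.2.2
  · rintro ⟨d, h0, h⟩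
    refine ⟨d, h0, h.isW22, ?_, ?_⟩
    · filter_upwards [h.eqn .e1, h.eqn .e2, h.eqn .e3] with x h1 h2 h3
      simp only [← h0]
      exact ⟨by simpa [edgePot] using h1, h2, h3⟩
    · simp only [← h0]
      exact ⟨⟨h.match₂, h.match₃, h.flow⟩, h.root, h.far₂, h.far₃⟩

theorem IsW22.intervalIntegrable_two {d : ℕ → ℝ → ℂ} (h : IsW22 d) :
    IntegrableOn (d 2) (Icc (0 : ℝ) 1) := by
  rw [integrableOn_Icc_iff_integrableOn_Ioo]
  exact h.memLp.integrable one_le_two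

theorem IsW22.continuousOn_one {d : ℕ → ℝ → ℂ} (h : IsW22 d) :
    ContinuousOn (d 1) (Icc (0 : ℝ) 1) := by
  have := intervalIntegral.continuousOn_primitive_interval (a := 0) (b := 1) (f := d 2)
    (μ := volume) (by rw [uIcc_of_le zero_le_one]; exact h.intervalIntegrable_two)
  rw [uIcc_of_le zero_le_one] at this
  exact (continuousOn_const.add this).congr fun x hx => h.deriv_eq_add_integral x hx

theorem IsW22.add_mul {d e : ℕ → ℝ → ℂ} (hd : IsW22 d) (he : IsW22 e) (a : ℂ) :
    IsW22 (fun ν x => d ν x + a * e ν x) := by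
  have sub : ∀ x ∈ Icc (0 : ℝ) 1, uIcc 0 x ⊆ Icc (0 : ℝ) 1 := fun x hx => by
    rw [uIcc_of_le hx.1]; exact Icc_subset_Icc_right hx.2
  have i1 : ∀ {d : ℕ → ℝ → ℂ}, IsW22 d → ∀ x ∈ Icc (0 : ℝ) 1,
      IntervalIntegrable (d 1) volume 0 x := fun h x hx =>
    (h.continuousOn_one.mono (sub x hx)).intervalIntegrable
  have i2 : ∀ {d : ℕ → ℝ → ℂ}, IsW22 d → ∀ x ∈ Icc (0 : ℝ) 1,
      IntervalIntegrable (d 2) volume 0 x := fun h x hx =>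
    (h.intervalIntegrable_two.mono_set (sub x hx)).intervalIntegrable
  refine ⟨hd.memLp.add (he.memLp.const_mul a), fun x hx => ?_, fun x hx => ?_⟩
  · rw [intervalIntegral.integral_add (i1 hd x hx) ((i1 he x hx).const_mul a),
      intervalIntegral.integral_const_mul, hd.eq_zero_add_integral x hx,
      he.eq_zero_add_integral x hx]
    ring
  · rw [intervalIntegral.integral_add (i2 hd x hx) ((i2 he x hx).const_mul a),
      intervalIntegral.integral_const_mul, hd.deriv_eq_add_integral x hx,
      he.deriv_eq_add_integral x hx]
    ring

section

variable {q₂ q₃ : ℝ → ℂ} {lam : ℂ}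

theorem SolvesInner.add_mul {d d' : Edge → ℕ → ℝ → ℂ} {f f' : Edge → ℝ → ℂ} {b₂ b₃ b₂' b₃' : ℂ}
    (h : SolvesInner q₂ q₃ lam d f b₂ b₃) (h' : SolvesInner q₂ q₃ lam d' f' b₂' b₃') (a : ℂ) :
    SolvesInner q₂ q₃ lam (fun j ν x => d j ν x + a * d' j ν x)
      (fun j x => f j x + a * f' j x) (b₂ + a * b₂') (b₃ + a * b₃') where
  isW22 j := (h.isW22 j).add_mul (h'.isW22 j) a
  eqn j := by
    filter_upwards [h.eqn j, h'.eqn j] with x h1 h2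
    rw [← h1, ← h2]; ring
  match₂ := by rw [h.match₂, h'.match₂]
  match₃ := by rw [h.match₃, h'.match₃]
  flow := by rw [h.flow, h'.flow]; ring
  root := by rw [h.root, h'.root]; ring
  far₂ := by rw [h.far₂, h'.far₂]
  far₃ := by rw [h.far₃, h'.far₃]

theorem SolvesInner.zero : SolvesInner q₂ q₃ lam (fun _ _ _ => 0) (fun _ _ => 0) 0 0 where
  isW22 j := ⟨MemLp.zero', by simp, by simp⟩
  eqn j := by simp
  match₂ := rfl
  match₃ := rfl
  flow := by simp
  root := rfl
  far₂ := rfl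
  far₃ := rfl

theorem SolvesInner.sum {ι : Type*} (s : Finset ι) (a : ι → ℂ) {d : ι → Edge → ℕ → ℝ → ℂ}
    {f : ι → Edge → ℝ → ℂ} {b₂ b₃ : ι → ℂ}
    (h : ∀ i ∈ s, SolvesInner q₂ q₃ lam (d i) (f i) (b₂ i) (b₃ i)) :
    SolvesInner q₂ q₃ lam (fun j ν x => ∑ i ∈ s, a i * d i j ν x)
      (fun j x => ∑ i ∈ s, a i * f i j x) (∑ i ∈ s, a i * b₂ i) (∑ i ∈ s, a i * b₃ i) := by
  classical
  induction s using Finset.induction_on with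
  | empty => simpa using SolvesInner.zero
  | insert i s hi ih =>
    simp only [Finset.sum_insert hi, add_comm (a i * _)]
    exact (ih fun k hk => h k (Finset.mem_insert_of_mem hk)).add_mul
      (h i (Finset.mem_insert_self i s)) (a i)

theorem SolvesInner.congr_right {d : Edge → ℕ → ℝ → ℂ} {f f' : Edge → ℝ → ℂ} {b₂ b₃ : ℂ}
    (h : SolvesInner q₂ q₃ lam d f b₂ b₃) (hf : ∀ j, ∀ x ∈ Icc (0 : ℝ) 1, f j x = f' j x) :
    SolvesInner q₂ q₃ lam d f' b₂ b₃ :=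
  { h with
    eqn := fun j => by
      filter_upwards [h.eqn j, ae_restrict_mem measurableSet_Ioo] with x h1 h2
      rw [h1, hf j x (Ioo_subset_Icc_self h2)] }

/-- Uniqueness for the Cauchy problem in W₂², by means of two conserved Wronskians. -/
theorem IsW22.eq_sinSol {d : ℕ → ℝ → ℂ} (h : IsW22 d)
    (heq : ∀ᵐ x ∂(volume.restrict (Ioo (0 : ℝ) 1)), d 2 x = -lam * d 0 x) (h0 : d 0 0 = 0) :
    ∀ x ∈ Icc (0 : ℝ) 1, d 0 x = d 1 0 * sinSol x lam ∧ d 1 x = d 1 0 * cosSol x lam := by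
  -- The continuous extension of `d 1` to the line provides a solution with genuine two-sided
  -- derivatives, also at the end points.
  set e₁ : ℝ → ℂ := IccExtend (zero_le_one' ℝ) ((Icc (0 : ℝ) 1).domRestrict (d 1)) with he₁
  have he₁c : Continuous e₁ :=
    (continuousOn_iff_continuous_domRestrict.1 h.continuousOn_one).Icc_extend'
  have he₁d : ∀ x ∈ Icc (0 : ℝ) 1, e₁ x = d 1 x := fun x hx => by
    rw [he₁, IccExtend_of_mem _ _ hx]; rfl
  set E₀ : ℝ → ℂ := fun x => ∫ t in (0 : ℝ)..x, e₁ t with hE₀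
  have hE₀' : ∀ x, HasDerivAt E₀ (e₁ x) x := fun x =>
    intervalIntegral.integral_hasDerivAt_right (he₁c.intervalIntegrable _ _)
      (he₁c.stronglyMeasurableAtFilter _ _) he₁c.continuousAt
  have hE₀c : Continuous E₀ := continuous_iff_continuousAt.2 fun x => (hE₀' x).continuousAt
  have hE₀d : ∀ x ∈ Icc (0 : ℝ) 1, d 0 x = E₀ x := fun x hx => by
    rw [h.eq_zero_add_integral x hx, h0, zero_add]
    refine intervalIntegral.integral_congr fun t ht => (he₁d t ?_).symm
    rw [uIcc_of_le hx.1] at ht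
    exact ⟨ht.1, ht.2.trans hx.2⟩
  set E₁ : ℝ → ℂ := fun x => d 1 0 + ∫ t in (0 : ℝ)..x, -lam * E₀ t with hE₁
  have hE₁' : ∀ x, HasDerivAt E₁ (-lam * E₀ x) x := fun x =>
    (intervalIntegral.integral_hasDerivAt_right
      ((by fun_prop : Continuous fun t => -lam * E₀ t).intervalIntegrable _ _)
      ((by fun_prop : Continuous fun t => -lam * E₀ t).stronglyMeasurableAtFilter _ _)
      (by fun_prop : Continuous fun t => -lam * E₀ t).continuousAt).const_add _
  have hE₁d : ∀ x ∈ Icc (0 : ℝ) 1, d 1 x = E₁ x := fun x hx => by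
    rw [h.deriv_eq_add_integral x hx, hE₁]
    congr 1
    rw [intervalIntegral.integral_of_le hx.1, intervalIntegral.integral_of_le hx.1,
      integral_Ioc_eq_integral_Ioo, integral_Ioc_eq_integral_Ioo]
    refine integral_congr_ae ?_
    have hs : Ioo 0 x ⊆ Ioo (0 : ℝ) 1 := Ioo_subset_Ioo_right hx.2
    filter_upwards [ae_restrict_of_ae_restrict_of_subset hs heq,
      ae_restrict_mem measurableSet_Ioo] with t ht ht'
    rw [ht, hE₀d t (Ioo_subset_Icc_self (hs ht'))]
  have hconst : ∀ F : ℝ → ℂ, (∀ x ∈ Icc (0 : ℝ) 1, HasDerivAt F 0 x) →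
      ∀ x ∈ Icc (0 : ℝ) 1, F x = F 0 := fun F hF =>
    constant_of_has_deriv_right_zero (fun x hx => (hF x hx).continuousAt.continuousWithinAt)
      fun x hx => (hF x (Ico_subset_Icc_self hx)).hasDerivWithinAt
  -- The constants are, up to sign, the Wronskians of the solution with S and with C; C² + λS² = 1
  -- inverts these two linear relations.
  have hA := hconst (fun x => E₀ x * cosSol x lam - E₁ x * sinSol x lam) fun x hx => by
    refine (((hE₀' x).mul (hasDerivAt_cosSol x lam)).sub
      ((hE₁' x).mul (hasDerivAt_sinSol x lam))).congr_deriv ?_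
    rw [he₁d x hx, hE₁d x hx]; ring
  have hB := hconst (fun x => lam * (E₀ x * sinSol x lam) + E₁ x * cosSol x lam) fun x hx => by
    refine ((((hE₀' x).mul (hasDerivAt_sinSol x lam)).const_mul lam).add
      ((hE₁' x).mul (hasDerivAt_cosSol x lam))).congr_deriv ?_
    rw [he₁d x hx, hE₁d x hx]; ring
  intro x hx
  have a := hA x hx
  have b := hB x hx
  have z0 : E₀ 0 = 0 := by simp [hE₀]
  have z1 : E₁ 0 = d 1 0 := by simp [hE₁]
  simp only [z0, z1, sinSol_zero, cosSol_zero, mul_zero, sub_zero, zero_add,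
    mul_one] at a b
  rw [hE₀d x hx, hE₁d x hx]
  have p := cosSol_sq_add_sinSol_sq x lam
  constructor
  · linear_combination (cosSol x lam) * a + sinSol x lam * b - E₀ x * p
  · linear_combination (-lam * sinSol x lam) * a + cosSol x lam * b - E₁ x * p

end

/-! ### Taylor coefficients of the distinguished family -/

theorem circleCoeff.primitive_one {c : ℂ} {i : ℕ} {K : ℝ → ℂ → ℂ} (hK : EntireFamily K) (x : ℝ) :
    circleCoeff c i (fun z => ∫ t in (0 : ℝ)..x, K t z)
      = ∫ t in (0 : ℝ)..x, circleCoeff c i (K t) := by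
  -- The weight 1 is not integrable on the line; the indicator of [0, x] is, and gives the same
  -- integral.
  have hq : Integrable ((uIcc 0 x).indicator (fun _ => (1 : ℂ))) :=
    (integrable_indicator_iff measurableSet_uIcc).2 (integrableOn_const (by simp [uIcc]))
  have key : ∀ g : ℝ → ℂ, ∫ t in (0 : ℝ)..x, (uIcc 0 x).indicator (fun _ => (1 : ℂ)) t * g t
      = ∫ t in (0 : ℝ)..x, g t := fun g =>
    intervalIntegral.integral_congr fun t ht => by simp only [indicator_of_mem ht, one_mul]
  have := circleCoeff.primitive (c := c) (i := i) hK hq x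
  simpa only [key] using this

theorem EntireFamily.primitive_one {K : ℝ → ℂ → ℂ} (hK : EntireFamily K) (x : ℝ) :
    Differentiable ℂ (fun z => ∫ t in (0 : ℝ)..x, K t z) := by
  have hq : Integrable ((uIcc 0 x).indicator (fun _ => (1 : ℂ))) :=
    (integrable_indicator_iff measurableSet_uIcc).2 (integrableOn_const (by simp [uIcc]))
  have key : ∀ g : ℝ → ℂ, ∫ t in (0 : ℝ)..x, (uIcc 0 x).indicator (fun _ => (1 : ℂ)) t * g t
      = ∫ t in (0 : ℝ)..x, g t := fun g =>
    intervalIntegral.integral_congr fun t ht => by simp only [indicator_of_mem ht, one_mul]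
  have := (hK.primitive hq).diff x
  simpa only [key] using this

/-- A square integrable potential on `(0, 1)`, extended to an integrable function on the line. -/
structure IsPotential (q : ℝ → ℂ) : Prop where
  integrable : Integrable q
  memLp : MemLp q 2 (volume.restrict (Ioo (0 : ℝ) 1))

section

variable {q₂ q₃ : ℝ → ℂ} (hq₂ : IsPotential q₂) (hq₃ : IsPotential q₃)
include hq₂ hq₃

theorem isPotential_edgePot (j : Edge) : IsPotential (edgePot q₂ q₃ j) := by
  cases j
  · exact ⟨integrable_zero _ _ _, MemLp.zero'⟩
  · exact hq₂
  · exact hq₃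

omit hq₃ in
theorem differentiable_farValue : Differentiable ℂ (farValue q₂) :=
  (entireFamily_edgeSol hq₂.integrable (entireFamily_sinSol.diff 1)
    (differentiable_const 0)).diff 1

omit hq₂ in
theorem differentiable_farSlope : Differentiable ℂ (farSlope q₃) :=
  (entireFamily_edgeDer hq₃.integrable (entireFamily_sinSol.diff 1)
    (entireFamily_cosSol.diff 1)).diff 1

theorem differentiable_charFun₁ : Differentiable ℂ (charFun₁ q₂ q₃) :=
  ((entireFamily_cosSol.diff 1).mul (differentiable_farValue hq₂)).add
    ((entireFamily_sinSol.diff 1).mul (differentiable_farSlope hq₃))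

theorem differentiable_vertexSlope : Differentiable ℂ (vertexSlope q₂ q₃) :=
  ((entireFamily_cosSol.diff 1).mul (differentiable_farSlope hq₃)).sub
    ((differentiable_id.mul (entireFamily_sinSol.diff 1)).mul (differentiable_farValue hq₂))

omit hq₂ hq₃ in
theorem differentiable_initVal (j : Edge) : Differentiable ℂ (initVal j) := by
  cases j
  · exact differentiable_const 0
  · exact entireFamily_sinSol.diff 1
  · exact entireFamily_sinSol.diff 1

theorem differentiable_initSlope (j : Edge) : Differentiable ℂ (initSlope q₂ q₃ j) := by
  cases j
  · exact differentiable_const 1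
  · exact differentiable_vertexSlope hq₂ hq₃
  · exact (entireFamily_cosSol.diff 1).sub (differentiable_vertexSlope hq₂ hq₃)

theorem entireFamily_solFam (j : Edge) : EntireFamily (solFam q₂ q₃ j) :=
  entireFamily_edgeSol (isPotential_edgePot hq₂ hq₃ j).integrable (differentiable_initVal j)
    (differentiable_initSlope hq₂ hq₃ j)

theorem entireFamily_derFam (j : Edge) : EntireFamily (derFam q₂ q₃ j) :=
  entireFamily_edgeDer (isPotential_edgePot hq₂ hq₃ j).integrable (differentiable_initVal j)
    (differentiable_initSlope hq₂ hq₃ j)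

omit hq₂ hq₃ in
theorem solFam_e1 (x : ℝ) : solFam q₂ q₃ .e1 x = sinSol x := by
  funext lam
  simp [solFam, edgeSol, edgePot, initVal, initSlope, csMoment, ssMoment]

omit hq₂ hq₃ in
theorem derFam_e1 (x : ℝ) : derFam q₂ q₃ .e1 x = cosSol x := by
  funext lam
  simp [derFam, edgeDer, edgePot, initVal, initSlope, csMoment, ssMoment]

omit hq₂ hq₃ in
-- This and the next identity explain `vertexSlope`: with C² + λS² = 1 both far values become
-- multiples of Δ, with factors C(1) and λS(1) that never vanish simultaneously.
theorem solFam_e2_one : solFam q₂ q₃ .e2 1 = fun lam => cosSol 1 lam * charFun₁ q₂ q₃ lam := by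
  funext lam
  have h : solFam q₂ q₃ .e2 1 lam = farValue q₂ lam + sinSol 1 lam * vertexSlope q₂ q₃ lam := by
    simp only [solFam, edgeSol, edgePot, initVal, initSlope, farValue]; ring
  rw [h, charFun₁, vertexSlope]
  linear_combination (-farValue q₂ lam) * cosSol_sq_add_sinSol_sq 1 lam

omit hq₂ hq₃ in
theorem derFam_e3_one :
    derFam q₂ q₃ .e3 1 = fun lam => lam * (sinSol 1 lam * charFun₁ q₂ q₃ lam) := by
  funext lam
  have h : derFam q₂ q₃ .e3 1 lam = farSlope q₃ lam - cosSol 1 lam * vertexSlope q₂ q₃ lam := by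
    simp only [derFam, edgeDer, edgePot, initVal, initSlope, farSlope]; ring
  rw [h, charFun₁, vertexSlope]
  linear_combination (-farSlope q₃ lam) * cosSol_sq_add_sinSol_sq 1 lam

/-- The Taylor coefficients at `c` (shifted by one) of the distinguished family of solutions and
their derivatives in `x`. -/
noncomputable def coeffFam (q₂ q₃ : ℝ → ℂ) (c : ℂ) (i : ℕ) (j : Edge) : ℕ → ℝ → ℂ
  | 0 => fun x => circleCoeff c i (solFam q₂ q₃ j x)
  | 1 => fun x => circleCoeff c i (derFam q₂ q₃ j x)
  | _ => fun x => edgePot q₂ q₃ j x * circleCoeff c i (sinSol x)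
      - circleCoeff c i (fun z => z * solFam q₂ q₃ j x z)

theorem isW22_coeffFam (c : ℂ) (i : ℕ) (j : Edge) : IsW22 (coeffFam q₂ q₃ c i j) := by
  have hq := isPotential_edgePot hq₂ hq₃ j
  have hF := entireFamily_solFam hq₂ hq₃ j
  have hG := entireFamily_derFam hq₂ hq₃ j
  have hlF : EntireFamily fun x z => z * solFam q₂ q₃ j x z := EntireFamily.lam.mul hF
  refine ⟨?_, fun x hx => ?_, fun x hx => ?_⟩
  · exact (memLp_two_mul_continuous hq.memLp (circleCoeff.continuous entireFamily_sinSol)).sub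
      (memLp_two_of_continuous (circleCoeff.continuous hlF))
  · have e : ∀ x, 0 ≤ x → solFam q₂ q₃ j x
        = fun z => initVal j z + ∫ t in (0 : ℝ)..x, derFam q₂ q₃ j t z := fun x hx =>
      funext fun z => edgeSol_eq_add_integral hq.integrable hx
    have e0 : solFam q₂ q₃ j 0 = initVal j := funext fun z => edgeSol_zero
    simp only [coeffFam, e0]
    rw [e x hx.1, circleCoeff.add (differentiable_initVal j).continuous
      (hG.primitive_one x).continuous, circleCoeff.primitive_one hG]
  · have e : ∀ x, 0 ≤ x → derFam q₂ q₃ j x = fun z => initSlope q₂ q₃ j z +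
        ((∫ t in (0 : ℝ)..x, edgePot q₂ q₃ j t * sinSol t z)
          - ∫ t in (0 : ℝ)..x, z * solFam q₂ q₃ j t z) := fun x hx =>
      funext fun z => edgeDer_eq_add_integral hq.integrable hx
    have e0 : derFam q₂ q₃ j 0 = initSlope q₂ q₃ j := funext fun z => edgeDer_zero
    have c1 := ((entireFamily_sinSol.primitive hq.integrable).diff x).continuous
    have c2 := (hlF.primitive_one x).continuous
    simp only [coeffFam, e0]
    rw [e x hx.1, circleCoeff.add (differentiable_initSlope hq₂ hq₃ j).continuous (c1.fun_sub c2),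
      circleCoeff.sub c1 c2, circleCoeff.primitive_one hlF,
      circleCoeff.primitive entireFamily_sinSol hq.integrable, intervalIntegral.integral_sub]
    · exact hq.integrable.intervalIntegrable.mul_continuousOn
        (circleCoeff.continuous entireFamily_sinSol).continuousOn
    · exact (circleCoeff.continuous hlF).intervalIntegrable _ _

/-- Take Taylor coefficients at c in ℓY = zY and in the inner conditions: the factor z produces the
previous coefficient as right-hand side, and the far values are the coefficients of C(1)Δ and
zS(1)Δ. -/
theorem solvesInner_coeffFam (c : ℂ) (i : ℕ) :
    SolvesInner q₂ q₃ c (coeffFam q₂ q₃ c (i + 1)) (fun j => coeffFam q₂ q₃ c i j 0)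
      (circleCoeff c (i + 1) fun z => cosSol 1 z * charFun₁ q₂ q₃ z)
      (circleCoeff c (i + 1) fun z => z * (sinSol 1 z * charFun₁ q₂ q₃ z)) where
  isW22 := isW22_coeffFam hq₂ hq₃ c (i + 1)
  eqn j := ae_of_all _ fun x => by
    have := circleCoeff.lam_mul (c := c) (i := i)
      ((entireFamily_solFam hq₂ hq₃ j).diff x).continuous
    simp only [coeffFam, this, solFam_e1]
    ring
  match₂ := by
    simp only [coeffFam, solFam_e1]
    congr 1; funext z; simp [solFam, initVal]
  match₃ := by
    simp only [coeffFam]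
    congr 1; funext z; simp [solFam, initVal]
  flow := by
    simp only [coeffFam, derFam_e1]
    rw [← circleCoeff.add ((entireFamily_derFam hq₂ hq₃ _).diff 0).continuous
      ((entireFamily_derFam hq₂ hq₃ _).diff 0).continuous]
    congr 1; funext z; simp [derFam, initSlope]
  root := by
    simp [coeffFam, solFam_e1, circleCoeff, circleIntegral]
  far₂ := by simp only [coeffFam, solFam_e2_one]
  far₃ := by simp only [coeffFam, derFam_e3_one]

theorem coeffFam_zero (c : ℂ) (j : Edge) (x : ℝ) : coeffFam q₂ q₃ c 0 j 0 x = 0 :=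
  circleCoeff.zero_of_differentiable ((entireFamily_solFam hq₂ hq₃ j).diff x)

/-- Every solution of the homogeneous equation which satisfies the inner conditions is a linear
combination of the distinguished one and the one supported on the second and third edges. -/
theorem SolvesInner.exists_eq {c b₂ b₃ : ℂ} {d : Edge → ℕ → ℝ → ℂ}
    (h : SolvesInner q₂ q₃ c d (fun _ _ => 0) b₂ b₃) :
    ∃ a e : ℂ, (∀ x ∈ Icc (0 : ℝ) 1, d .e1 0 x = a * coeffFam q₂ q₃ c 1 .e1 0 x ∧
      d .e2 0 x = a * coeffFam q₂ q₃ c 1 .e2 0 x + e * sinSol x c ∧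
      d .e3 0 x = a * coeffFam q₂ q₃ c 1 .e3 0 x - e * sinSol x c) ∧
      b₂ = a * (cosSol 1 c * charFun₁ q₂ q₃ c) + e * sinSol 1 c ∧
      b₃ = a * (c * (sinSol 1 c * charFun₁ q₂ q₃ c)) - e * cosSol 1 c := by
  have hD := differentiable_charFun₁ hq₂ hq₃
  have hY := solvesInner_coeffFam hq₂ hq₃ c 0
  rw [zero_add, circleCoeff.one ((entireFamily_cosSol.diff 1).fun_mul hD), circleCoeff.one
    (differentiable_fun_id.fun_mul ((entireFamily_sinSol.diff 1).fun_mul hD))] at hY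
  set a := d .e1 1 0 with ha
  -- Subtracting the distinguished solution with the same slope at the root kills the first edge,
  -- hence the delay terms. What remains on the other edges vanishes at the vertex and has opposite
  -- slopes there, so it is ±eS.
  have hw := h.add_mul hY (-a)
  have hw0 : ∀ j, ∀ᵐ x ∂(volume.restrict (Ioo (0 : ℝ) 1)), _ := hw.eqn
  simp only [coeffFam_zero hq₂ hq₃, mul_zero, add_zero] at hw0
  have hone : coeffFam q₂ q₃ c 1 .e1 1 0 = 1 := by
    simp only [coeffFam, derFam_e1]
    rw [circleCoeff.one (entireFamily_cosSol.diff 0), cosSol_zero]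
  have w1 : ∀ x ∈ Icc (0 : ℝ) 1, d .e1 0 x + -a * coeffFam q₂ q₃ c 1 .e1 0 x = 0 ∧
      d .e1 1 x + -a * coeffFam q₂ q₃ c 1 .e1 1 x = 0 := by
    have := (hw.isW22 .e1).eq_sinSol (lam := c) (by
      filter_upwards [hw0 .e1] with x hx
      simp only [edgePot, zero_mul, add_zero] at hx ⊢
      linear_combination -hx) hw.root
    intro x hx
    have h1 := this x hx
    simp only [hone, ← ha] at h1
    exact ⟨by linear_combination h1.1, by linear_combination h1.2⟩
  have w23 : ∀ j : Edge, d j 0 0 + -a * coeffFam q₂ q₃ c 1 j 0 0 = 0 → ∀ x ∈ Icc (0 : ℝ) 1,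
      d j 0 x + -a * coeffFam q₂ q₃ c 1 j 0 x
        = (d j 1 0 + -a * coeffFam q₂ q₃ c 1 j 1 0) * sinSol x c ∧
      d j 1 x + -a * coeffFam q₂ q₃ c 1 j 1 x
        = (d j 1 0 + -a * coeffFam q₂ q₃ c 1 j 1 0) * cosSol x c := by
    intro j hj
    refine (hw.isW22 j).eq_sinSol (lam := c) ?_ hj
    filter_upwards [hw0 j, ae_restrict_mem measurableSet_Ioo] with x hx hx1
    have := (w1 x (Ioo_subset_Icc_self hx1)).1
    linear_combination -hx + edgePot q₂ q₃ j x * this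
  have o1 : (1 : ℝ) ∈ Icc (0 : ℝ) 1 := right_mem_Icc.2 zero_le_one
  have m2 := hw.match₂
  have m3 := hw.match₃
  have fl := hw.flow
  have f2 := hw.far₂
  have f3 := hw.far₃
  rw [(w1 1 o1).1] at m2
  rw [(w1 1 o1).2] at fl
  have e2 := w23 .e2 m2.symm
  have e3 := w23 .e3 (m3.symm.trans m2.symm)
  refine ⟨a, d .e2 1 0 + -a * coeffFam q₂ q₃ c 1 .e2 1 0, fun x hx => ⟨?_, ?_, ?_⟩, ?_, ?_⟩
  · linear_combination (w1 x hx).1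
  · linear_combination (e2 x hx).1
  · linear_combination (e3 x hx).1 - sinSol x c * fl
  · linear_combination (e2 1 o1).1 - f2
  · linear_combination (e3 1 o1).2 - f3 - cosSol 1 c * fl

end

/-! ### Root subspaces: algebraic multiplicity equals the order of the zero -/

theorem Differentiable.exists_eq_pow_mul_of_analyticOrderAt {f : ℂ → ℂ} (hf : Differentiable ℂ f)
    {c : ℂ} {p : ℕ} (h : analyticOrderAt f c = p) :
    ∃ u : ℂ → ℂ, Differentiable ℂ u ∧ u c ≠ 0 ∧ ∀ z, f z = (z - c) ^ p * u z := by
  induction p generalizing f with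
  | zero =>
    refine ⟨f, hf, ?_, by simp⟩
    exact (hf.analyticAt c).analyticOrderAt_eq_zero.1 (by simpa using h)
  | succ p ih =>
    have h0 : f c = 0 := apply_eq_zero_of_analyticOrderAt_ne_zero (by simp [h])
    have hg : Differentiable ℂ (dslope f c) := fun w =>
      ((Complex.differentiableOn_dslope (f := f) (c := c) (s := univ) univ_mem).2
        hf.differentiableOn w trivial).differentiableAt univ_mem
    have hfg : f = (fun z => z - c) * dslope f c := by
      funext z
      have := sub_smul_dslope f c z
      simpa [h0] using this.symm
    have hord : analyticOrderAt (dslope f c) c = p := by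
      have h1 := h
      rw [hfg, analyticOrderAt_mul (by fun_prop) (hg.analyticAt c)] at h1
      have h2 : analyticOrderAt (fun z : ℂ => z - c) c = 1 := analyticOrderAt_id_sub_const_self
      rw [h2] at h1
      generalize analyticOrderAt (dslope f c) c = o at h1 ⊢
      induction o using ENat.recTopCoe with
      | top => rw [add_top] at h1; exact (ENat.top_ne_natCast _ h1).elim
      | coe o => norm_cast at h1 ⊢; omega
    obtain ⟨u, hu, huc, hgu⟩ := ih hg hord
    refine ⟨u, hu, huc, fun z => ?_⟩
    rw [hfg, Pi.mul_apply, hgu]; ring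

section

variable {q₂ q₃ : ℝ → ℂ} {c : ℂ} {p : ℕ} {u : ℂ → ℂ}

/-- The far values are coefficients of functions divisible by (z − c)ᵖ, so they vanish up to index p
and the chain satisfies every boundary condition. -/
theorem isRootFunction_coeffFam (hq₂ : IsPotential q₂) (hq₃ : IsPotential q₃)
    (hu : Differentiable ℂ u) (hfac : ∀ z, charFun₁ q₂ q₃ z = (z - c) ^ p * u z) {i : ℕ}
    (hi : i ≤ p) : IsRootFunction 1 q₂ q₃ c i fun j => coeffFam q₂ q₃ c i j 0 := by
  induction i with
  | zero => exact fun j x _ => coeffFam_zero hq₂ hq₃ c j x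
  | succ i ih =>
    refine ⟨_, ih (by omega), solvesProblem_one_iff.2 ⟨coeffFam q₂ q₃ c (i + 1), fun j => rfl, ?_⟩⟩
    have hS := entireFamily_sinSol.diff 1
    have hC := entireFamily_cosSol.diff 1
    convert solvesInner_coeffFam hq₂ hq₃ c i using 1
    · rw [eq_comm]
      convert circleCoeff.pow_mul_of_le (c := c) (hC.fun_mul hu) hi using 2
      funext z; rw [hfac]; ring
    · rw [eq_comm]
      convert circleCoeff.pow_mul_of_le (c := c) (differentiable_fun_id.fun_mul (hS.fun_mul hu)) hi
        using 2
      funext z; rw [hfac]; ring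

/-- Write Yᵢ for the Taylor coefficients. If (ℓ − c)y = ∑ aᵢYᵢ₊₁, then y − ∑ aᵢYᵢ₊₂ solves the
homogeneous problem except at the far ends, so it equals a₀Y₁ + e·(0, S, −S). In the resulting
expression for y only Yₚ₊₁ and the e-term have nonzero far values. The two far conditions are a
linear system for (a′ₚu(c), e) with rows (C, S) and (cS, −C), whose determinant is −(C² + cS²) = −1;
both unknowns vanish. -/
theorem exists_eq_sum_of_isRootFunction (hq₂ : IsPotential q₂) (hq₃ : IsPotential q₃)
    (hu : Differentiable ℂ u) (huc : u c ≠ 0)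
    (hfac : ∀ z, charFun₁ q₂ q₃ z = (z - c) ^ p * u z) {m : ℕ} {y : Edge → ℝ → ℂ}
    (h : IsRootFunction 1 q₂ q₃ c m y) : ∃ a : ℕ → ℂ, ∀ j, ∀ x ∈ Icc (0 : ℝ) 1,
      y j x = ∑ i ∈ Finset.range p, a i * coeffFam q₂ q₃ c (i + 1) j 0 x := by
  induction m generalizing y with
  | zero => exact ⟨0, fun j x hx => by simpa using h j x hx⟩
  | succ m ih =>
    obtain ⟨f, hf, hy⟩ := h
    obtain ⟨a, ha⟩ := ih hf
    obtain ⟨d, hd, hdS⟩ := solvesProblem_one_iff.1 hy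
    have hS := entireFamily_sinSol.diff 1
    have hC := entireFamily_cosSol.diff 1
    have hD := differentiable_charFun₁ hq₂ hq₃
    set B₂ : ℕ → ℂ := fun i => circleCoeff c i fun z => cosSol 1 z * charFun₁ q₂ q₃ z with hB₂
    set B₃ : ℕ → ℂ := fun i => circleCoeff c i fun z => z * (sinSol 1 z * charFun₁ q₂ q₃ z) with hB₃
    have e₂ : (fun z => cosSol 1 z * charFun₁ q₂ q₃ z)
        = fun z => (z - c) ^ p * (cosSol 1 z * u z) := by
      funext z; rw [hfac]; ring
    have e₃ : (fun z => z * (sinSol 1 z * charFun₁ q₂ q₃ z))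
        = fun z => (z - c) ^ p * (z * (sinSol 1 z * u z)) := by
      funext z; rw [hfac]; ring
    have hu₂ := hC.fun_mul hu
    have hu₃ := differentiable_fun_id.fun_mul (hS.fun_mul hu)
    have z₂ : ∀ i ≤ p, B₂ i = 0 := fun i hi => by
      simp only [hB₂, e₂]; exact circleCoeff.pow_mul_of_le hu₂ hi
    have z₃ : ∀ i ≤ p, B₃ i = 0 := fun i hi => by
      simp only [hB₃, e₃]; exact circleCoeff.pow_mul_of_le hu₃ hi
    have p₂ : B₂ (p + 1) = cosSol 1 c * u c := by
      simp only [hB₂, e₂]; exact circleCoeff.pow_mul_succ hu₂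
    have p₃ : B₃ (p + 1) = c * (sinSol 1 c * u c) := by
      simp only [hB₃, e₃]; exact circleCoeff.pow_mul_succ hu₃
    have o₂ : cosSol 1 c * charFun₁ q₂ q₃ c = B₂ 1 := (circleCoeff.one (hC.fun_mul hD)).symm
    have o₃ : c * (sinSol 1 c * charFun₁ q₂ q₃ c) = B₃ 1 :=
      (circleCoeff.one (differentiable_fun_id.fun_mul (hS.fun_mul hD))).symm
    have hsum := SolvesInner.sum (Finset.range p) a
      fun i _ => solvesInner_coeffFam hq₂ hq₃ c (i + 1)
    obtain ⟨a₀, e, hw, hb₂, hb₃⟩ := SolvesInner.exists_eq hq₂ hq₃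
      ((hdS.add_mul hsum (-1)).congr_right (f' := fun _ _ => 0) fun j x hx => by
        simp only [ha j x hx]; ring)
    rw [o₂] at hb₂
    rw [o₃] at hb₃
    -- The coefficients of y: the sequence a moved up by one place, with a₀ in front.
    set a' : ℕ → ℂ := fun i => Nat.casesOn i a₀ a with ha'
    have hshift : ∀ g : ℕ → ℂ, a' p * g (p + 1) + ∑ i ∈ Finset.range p, a' i * g (i + 1)
        = a₀ * g 1 + ∑ i ∈ Finset.range p, a i * g (i + 2) := fun g => by
      rw [add_comm, ← Finset.sum_range_succ (fun i => a' i * g (i + 1)), Finset.sum_range_succ',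
        add_comm]
      rfl
    have s₂ := hshift B₂
    have s₃ := hshift B₃
    rw [Finset.sum_eq_zero (fun i hi => by
      rw [z₂ _ (by have := Finset.mem_range.1 hi; omega), mul_zero]), p₂] at s₂
    rw [Finset.sum_eq_zero (fun i hi => by
      rw [z₃ _ (by have := Finset.mem_range.1 hi; omega), mul_zero]), p₃] at s₃
    have t₂ : a' p * (cosSol 1 c * u c) + e * sinSol 1 c = 0 := by
      linear_combination s₂ - hb₂
    have t₃ : a' p * (c * (sinSol 1 c * u c)) - e * cosSol 1 c = 0 := by
      linear_combination s₃ - hb₃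
    have py := cosSol_sq_add_sinSol_sq 1 c
    have hap : a' p = 0 := by
      have : a' p * u c = 0 := by
        linear_combination cosSol 1 c * t₂ + sinSol 1 c * t₃ - a' p * u c * py
      exact (mul_eq_zero.1 this).resolve_right huc
    have he : e = 0 := by
      linear_combination c * sinSol 1 c * t₂ - cosSol 1 c * t₃ - e * py
    subst he
    refine ⟨a', fun j x hx => ?_⟩
    have hj := hshift fun i => coeffFam q₂ q₃ c i j 0 x
    rw [hap, zero_mul, zero_add] at hj
    rw [← hd j, hj]
    obtain ⟨h1, h2, h3⟩ := hw x hx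
    cases j
    · linear_combination h1
    · linear_combination h2
    · linear_combination h3

theorem hasDerivAt_circleCoeff_sinSol (c : ℂ) (i : ℕ) (x : ℝ) :
    HasDerivAt (fun x => circleCoeff c i (sinSol x)) (circleCoeff c i (cosSol x)) x := by
  have hc := circleCoeff.continuous (c := c) (i := i) entireFamily_cosSol
  have e : (fun x => circleCoeff c i (sinSol x))
      = fun x => ∫ t in (0 : ℝ)..x, circleCoeff c i (cosSol t) := by
    funext x
    rw [← circleCoeff.primitive_one entireFamily_cosSol]
    congr 1; funext z
    rw [intervalIntegral.integral_eq_sub_of_hasDerivAt (fun s _ => hasDerivAt_sinSol s z)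
      ((entireFamily_cosSol.continuous_left z).intervalIntegrable _ _)]
    simp
  rw [e]
  exact (hc.integral_hasStrictDerivAt 0 x).hasDerivAt

theorem hasDerivAt_circleCoeff_cosSol (c : ℂ) (i : ℕ) (x : ℝ) :
    HasDerivAt (fun x => circleCoeff c (i + 1) (cosSol x))
      (-(c * circleCoeff c (i + 1) (sinSol x) + circleCoeff c i (sinSol x))) x := by
  have hK : EntireFamily fun t z => z * sinSol t z := EntireFamily.lam.mul entireFamily_sinSol
  have hc := circleCoeff.continuous (c := c) (i := i + 1) hK
  have e : (fun x => circleCoeff c (i + 1) (cosSol x)) = fun x => circleCoeff c (i + 1) (cosSol 0)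
      - ∫ t in (0 : ℝ)..x, circleCoeff c (i + 1) (fun z => z * sinSol t z) := by
    funext x
    rw [← circleCoeff.primitive_one hK, ← circleCoeff.sub (entireFamily_cosSol.diff 0).continuous
      (hK.primitive_one x).continuous]
    congr 1; funext z
    have := intervalIntegral.integral_eq_sub_of_hasDerivAt (a := 0) (b := x)
      (fun s _ => hasDerivAt_cosSol s z)
      (((entireFamily_sinSol.continuous_left z).const_mul (-z)).intervalIntegrable _ _)
    simp only [neg_mul, intervalIntegral.integral_neg] at this
    linear_combination -this
  rw [e]
  refine ((hc.integral_hasStrictDerivAt 0 x).hasDerivAt.const_sub _).congr_deriv ?_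
  rw [circleCoeff.lam_mul (entireFamily_sinSol.diff x).continuous]

/-- The operator −d²/dx² − c lowers the index of each coefficient of S by one and annihilates the
lowest one, so induction removes all terms but the first. That one is a multiple of S(·, c), which
cannot vanish on an interval: its derivative C would vanish too, against C² + cS² = 1. -/
theorem eq_zero_of_sum_circleCoeff_sinSol (c : ℂ) (p : ℕ) (a : ℕ → ℂ)
    (h : ∀ x ∈ Ioo (0 : ℝ) 1, ∑ i ∈ Finset.range p, a i * circleCoeff c (i + 1) (sinSol x) = 0) :
    ∀ i < p, a i = 0 := by
  have hder : ∀ F F' : ℝ → ℂ, (∀ x, HasDerivAt F (F' x) x) → (∀ x ∈ Ioo (0 : ℝ) 1, F x = 0) →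
      ∀ x ∈ Ioo (0 : ℝ) 1, F' x = 0 := by
    intro F F' hF h0 x hx
    refine (hF x).unique ((hasDerivAt_const x (0 : ℂ)).congr_of_eventuallyEq ?_)
    filter_upwards [Ioo_mem_nhds hx.1 hx.2] with y hy using h0 y hy
  induction p generalizing a with
  | zero => intro i hi; omega
  | succ p ih =>
    have h1 := hder _ _ (fun x => HasDerivAt.fun_sum fun i _ =>
      (hasDerivAt_circleCoeff_sinSol c (i + 1) x).const_mul (a i)) h
    have h2 := hder _ _ (fun x => HasDerivAt.fun_sum fun i _ =>
      (hasDerivAt_circleCoeff_cosSol c i x).const_mul (a i)) h1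
    have h3 : ∀ i < p, a (i + 1) = 0 := by
      refine ih (fun i => a (i + 1)) fun x hx => ?_
      have hz : circleCoeff c 0 (sinSol x) = 0 :=
        circleCoeff.zero_of_differentiable (entireFamily_sinSol.diff x)
      have e : ∑ i ∈ Finset.range (p + 1), a i * circleCoeff c i (sinSol x)
          = -∑ i ∈ Finset.range (p + 1),
              a i * -(c * circleCoeff c (i + 1) (sinSol x) + circleCoeff c i (sinSol x))
            - c * ∑ i ∈ Finset.range (p + 1), a i * circleCoeff c (i + 1) (sinSol x) := by
        rw [Finset.mul_sum, ← Finset.sum_neg_distrib, ← Finset.sum_sub_distrib]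
        exact Finset.sum_congr rfl fun i _ => by ring
      rw [h2 x hx, h x hx, Finset.sum_range_succ', hz] at e
      simpa using e
    have h0 : a 0 = 0 := by
      by_contra ha
      have hS : ∀ x ∈ Ioo (0 : ℝ) 1, sinSol x c = 0 := fun x hx => by
        have := h x hx
        rw [Finset.sum_range_succ', Finset.sum_eq_zero (fun i hi => by
          rw [h3 i (Finset.mem_range.1 hi), zero_mul]), zero_add, zero_add,
          circleCoeff.one (entireFamily_sinSol.diff x)] at this
        exact (mul_eq_zero.1 this).resolve_left ha
      have hC := hder _ _ (fun x => hasDerivAt_sinSol x c) hS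
      have hx : (1 / 2 : ℝ) ∈ Ioo (0 : ℝ) 1 := by constructor <;> norm_num
      have := cosSol_sq_add_sinSol_sq (1 / 2) c
      rw [hS _ hx, hC _ hx] at this
      simp at this
    intro i hi
    cases i with
    | zero => exact h0
    | succ i => exact h3 i (by omega)

/-- The first p Taylor coefficients of the distinguished family are a basis of the root subspace;
independence is already visible on the first edge, where the family is S. -/
theorem eigenMultiplicity_one_eq (hq₂ : IsPotential q₂) (hq₃ : IsPotential q₃)
    (h : analyticOrderAt (charFun₁ q₂ q₃) c = p) : eigenMultiplicity 1 q₂ q₃ c = p := by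
  obtain ⟨u, hu, huc, hfac⟩ :=
    (differentiable_charFun₁ hq₂ hq₃).exists_eq_pow_mul_of_analyticOrderAt h
  set v : Fin p → Edge → Icc (0 : ℝ) 1 → ℂ :=
    fun i j x => coeffFam q₂ q₃ c (i + 1) j 0 x with hv
  have hspan : rootSpace 1 q₂ q₃ c = Submodule.span ℂ (range v) := by
    refine le_antisymm (Submodule.span_le.2 ?_) (Submodule.span_mono ?_)
    · rintro _ ⟨m, y, hy, rfl⟩
      obtain ⟨a, ha⟩ := exists_eq_sum_of_isRootFunction hq₂ hq₃ hu huc hfac hy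
      have : (fun j (x : Icc (0 : ℝ) 1) => y j x) = ∑ i : Fin p, a i • v i := by
        funext j x
        rw [ha j x x.2, Finset.sum_range]
        simp [hv, Finset.sum_apply]
      rw [this]
      exact Submodule.sum_mem _ fun i _ =>
        Submodule.smul_mem _ _ (Submodule.subset_span (mem_range_self i))
    · rintro _ ⟨i, rfl⟩
      exact ⟨i + 1, _, isRootFunction_coeffFam hq₂ hq₃ hu hfac i.2, rfl⟩
  have hli : LinearIndependent ℂ v := by
    rw [Fintype.linearIndependent_iff]
    intro g hg i
    have := eq_zero_of_sum_circleCoeff_sinSol c p (fun i => if hi : i < p then g ⟨i, hi⟩ else 0)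
      (fun x hx => by
        have := congrFun (congrFun hg .e1) ⟨x, Ioo_subset_Icc_self hx⟩
        simpa [hv, Finset.sum_apply, Finset.sum_range, coeffFam, solFam_e1] using this) i i.2
    simpa using this
  rw [eigenMultiplicity, hspan, rank_span hli, Cardinal.mk_range_eq v hli.injective]
  simp

theorem mem_spectrumSet_one_iff (hq₂ : IsPotential q₂) (hq₃ : IsPotential q₃)
    (h : analyticOrderAt (charFun₁ q₂ q₃) c = p) : c ∈ spectrumSet 1 q₂ q₃ ↔ p ≠ 0 := by
  obtain ⟨u, hu, huc, hfac⟩ :=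
    (differentiable_charFun₁ hq₂ hq₃).exists_eq_pow_mul_of_analyticOrderAt h
  constructor
  · rintro ⟨y, hy, j, x, hx, hne⟩ rfl
    obtain ⟨a, ha⟩ := exists_eq_sum_of_isRootFunction hq₂ hq₃ hu huc hfac (m := 1)
      ⟨_, fun _ _ _ => rfl, hy⟩
    exact hne (by simpa using ha j x hx)
  · intro hp
    obtain ⟨f, hf, hs⟩ := isRootFunction_coeffFam hq₂ hq₃ hu hfac (Nat.one_le_iff_ne_zero.2 hp)
    obtain ⟨d, hd, hdS⟩ := solvesProblem_one_iff.1 hs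
    refine ⟨_, solvesProblem_one_iff.2 ⟨d, hd, hdS.congr_right hf⟩, .e1, ?_⟩
    by_contra! hcon
    have := eq_zero_of_sum_circleCoeff_sinSol c 1 1 (fun x hx => by
      have := hcon x (Ioo_subset_Icc_self hx)
      simpa [coeffFam, solFam_e1] using this) 0 one_pos
    simp at this

end

/-! ### Zeros of entire functions and Rouché's theorem -/

theorem Differentiable.analyticOrderAt_ne_top {f : ℂ → ℂ} (hf : Differentiable ℂ f) {w : ℂ}
    (hw : f w ≠ 0) (c : ℂ) : analyticOrderAt f c ≠ ⊤ := by
  intro h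
  rw [analyticOrderAt_eq_top] at h
  have hA : AnalyticOnNhd ℂ f univ := fun z _ => hf.analyticAt z
  exact hw (hA.eqOn_zero_of_preconnected_of_eventuallyEq_zero isPreconnected_univ (mem_univ c) h
    (mem_univ w))

theorem Differentiable.finite_zeros {f : ℂ → ℂ} (hf : Differentiable ℂ f) {w : ℂ}
    (hw : f w ≠ 0) {K : Set ℂ} (hK : IsCompact K) : {z ∈ K | f z = 0}.Finite := by
  by_contra hinf
  obtain ⟨x, -, hx⟩ := Set.Infinite.exists_accPt_of_subset_isCompact hinf hK (sep_subset _ _)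
  have hA : AnalyticOnNhd ℂ f univ := fun z _ => hf.analyticAt z
  refine hw (hA.eqOn_zero_of_preconnected_of_frequently_eq_zero isPreconnected_univ (mem_univ x)
    ?_ (mem_univ w))
  exact (accPt_iff_frequently_nhdsNE.1 hx).mono fun z hz => hz.2

theorem differentiable_multiset_prod_sub (s : Multiset ℂ) :
    Differentiable ℂ fun z : ℂ => (s.map fun a => z - a).prod := by
  induction s using Multiset.induction_on with
  | empty => simp
  | cons a s ih => simpa using (differentiable_fun_id.sub_const a).fun_mul ih

theorem analyticOrderAt_multiset_prod_sub (s : Multiset ℂ) (c : ℂ) :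
    analyticOrderAt (fun z : ℂ => (s.map fun a => z - a).prod) c = s.count c := by
  induction s using Multiset.induction_on with
  | empty => simp [analyticOrderAt_eq_zero]
  | cons a s ih =>
    have e : (fun z : ℂ => ((a ::ₘ s).map fun a => z - a).prod)
        = (fun z : ℂ => z - a) * fun z => (s.map fun a => z - a).prod := by
      funext z; simp
    rw [e, analyticOrderAt_mul (by fun_prop)
      ((differentiable_multiset_prod_sub s).analyticAt c), ih]
    by_cases h : c = a
    · subst h
      have : analyticOrderAt (fun z : ℂ => z - c) c = 1 := analyticOrderAt_id_sub_const_self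
      rw [this, Multiset.count_cons_self, Nat.cast_succ, add_comm]
    · have : analyticOrderAt (fun z : ℂ => z - a) c = 0 := analyticOrderAt_id_sub_const_of_ne h
      rw [this, Multiset.count_cons_of_ne h, zero_add]

theorem Differentiable.exists_eq_multiset_prod_mul {f : ℂ → ℂ} (hf : Differentiable ℂ f) {w : ℂ}
    (hw : f w ≠ 0) {K : Set ℂ} (hK : IsCompact K) :
    ∃ (s : Multiset ℂ) (u : ℂ → ℂ), Differentiable ℂ u ∧ (∀ z ∈ K, u z ≠ 0) ∧
      (∀ z ∈ s, z ∈ K ∧ f z = 0) ∧ ∀ z, f z = (s.map fun a => z - a).prod * u z := by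
  -- Induction on a finite set that contains the zeros in K, with f variable: dividing out the full
  -- order at one point removes it from the set.
  have main : ∀ (Z : Finset ℂ) (f : ℂ → ℂ), Differentiable ℂ f → f w ≠ 0 →
      (∀ z ∈ K, f z = 0 → z ∈ Z) → (∀ z ∈ Z, z ∈ K) →
      ∃ (s : Multiset ℂ) (u : ℂ → ℂ), Differentiable ℂ u ∧ (∀ z ∈ K, u z ≠ 0) ∧
      (∀ z ∈ s, z ∈ K ∧ f z = 0) ∧ ∀ z, f z = (s.map fun a => z - a).prod * u z := by
    intro Z
    induction Z using Finset.induction_on with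
    | empty => exact fun f hf _ h0 _ => ⟨0, f, hf, fun z hz h => by simpa using h0 z hz h,
        by simp, by simp⟩
    | insert a Z ha ih =>
      intro f hf hfw h0 hZ
      obtain ⟨p, hp⟩ := ENat.ne_top_iff_exists.1 (hf.analyticOrderAt_ne_top hfw a)
      obtain ⟨g, hg, hga, hfg⟩ := hf.exists_eq_pow_mul_of_analyticOrderAt hp.symm
      obtain ⟨s, u, hu, hu0, hs, hgs⟩ := ih g hg (fun h => hfw (by rw [hfg, h, mul_zero]))
        (fun z hz h => by
          have := h0 z hz (by rw [hfg, h, mul_zero])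
          rcases Finset.mem_insert.1 this with rfl | h1
          · exact absurd h hga
          · exact h1)
        fun z hz => hZ z (Finset.mem_insert_of_mem hz)
      refine ⟨Multiset.replicate p a + s, u, hu, hu0, fun z hz => ?_, fun z => ?_⟩
      · rcases Multiset.mem_add.1 hz with h | h
        · obtain ⟨hp0, rfl⟩ := Multiset.mem_replicate.1 h
          exact ⟨hZ z (Finset.mem_insert_self _ _), by simp [hfg, hp0]⟩
        · exact ⟨(hs z h).1, by rw [hfg, (hs z h).2, mul_zero]⟩
      · rw [hfg, hgs]; simp [mul_assoc]
  have hfin := hf.finite_zeros hw hK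
  exact main hfin.toFinset f hf hw (fun z hz h => hfin.mem_toFinset.2 ⟨hz, h⟩)
    fun z hz => (hfin.mem_toFinset.1 hz).1

theorem continuousOn_logDeriv {f : ℂ → ℂ} (hf : Differentiable ℂ f) {K : Set ℂ}
    (h : ∀ z ∈ K, f z ≠ 0) : ContinuousOn (logDeriv f) K :=
  (hf.contDiff (n := 1)).continuous_deriv_one.continuousOn.div hf.continuous.continuousOn h

/-- Argument principle: each linear factor contributes 1/(z − a) with integral 2πi, and the
zero-free factor has a holomorphic logarithmic derivative. -/
theorem circleIntegral_logDeriv_multiset_prod_mul {c : ℂ} {R : ℝ} (hR : 0 < R) (s : Multiset ℂ)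
    (hs : ∀ z ∈ s, z ∈ Metric.ball c R) {u : ℂ → ℂ} (hu : Differentiable ℂ u)
    (hu0 : ∀ z ∈ Metric.closedBall c R, u z ≠ 0) :
    ∮ z in C(c, R), logDeriv (fun z => (s.map fun a => z - a).prod * u z) z
      = 2 * Real.pi * Complex.I * s.card := by
  induction s using Multiset.induction_on with
  | empty =>
    simp only [Multiset.map_zero, Multiset.prod_zero, one_mul, Multiset.card_zero, Nat.cast_zero,
      mul_zero]
    refine DiffContOnCl.circleIntegral_eq_zero hR.le ⟨?_, ?_⟩
    · have hd : Differentiable ℂ (deriv u) :=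
        (hu.contDiff (n := 2)).differentiable_deriv_two
      exact hd.differentiableOn.div hu.differentiableOn
        fun z hz => hu0 z (Metric.ball_subset_closedBall hz)
    · exact continuousOn_logDeriv hu fun z hz => hu0 z (Metric.closure_ball_subset_closedBall hz)
  | cons a s ih =>
    have ha := hs a (Multiset.mem_cons_self a s)
    have ih := ih fun z hz => hs z (Multiset.mem_cons_of_mem hz)
    set F : ℂ → ℂ := fun z => (s.map fun a => z - a).prod * u z with hF
    have hFd : Differentiable ℂ F := (differentiable_multiset_prod_sub s).fun_mul hu
    have hne : ∀ b ∈ Metric.ball c R, ∀ z ∈ Metric.sphere c R, z - b ≠ 0 := fun b hb z hz h => by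
      rw [sub_eq_zero.1 h] at hz
      exact (ne_of_lt (Metric.mem_ball.1 hb)) (Metric.mem_sphere.1 hz)
    have hF0 : ∀ z ∈ Metric.sphere c R, F z ≠ 0 := fun z hz =>
      mul_ne_zero (Multiset.prod_ne_zero fun h => by
        obtain ⟨b, hb, hb0⟩ := Multiset.mem_map.1 h
        exact hne b (hs b (Multiset.mem_cons_of_mem hb)) z hz hb0)
        (hu0 z (Metric.sphere_subset_closedBall hz))
    have e : (fun z => ((a ::ₘ s).map fun a => z - a).prod * u z) = fun z => (z - a) * F z := by
      funext z; simp [hF, mul_assoc]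
    have e2 : ∀ z ∈ Metric.sphere c R,
        logDeriv (fun z => (z - a) * F z) z = (z - a)⁻¹ + logDeriv F z := fun z hz => by
      rw [logDeriv_mul z (hne a ha z hz) (hF0 z hz) (by fun_prop) (hFd z)]
      simp [logDeriv_apply]
    rw [e, circleIntegral.integral_congr hR.le e2, circleIntegral.integral_add, ih,
      circleIntegral.integral_sub_inv_of_mem_ball ha, Multiset.card_cons]
    · push_cast; ring
    · exact ContinuousOn.circleIntegrable hR.le
        (ContinuousOn.inv₀ (by fun_prop) fun z hz => hne a ha z hz)
    · exact (continuousOn_logDeriv hFd hF0).circleIntegrable hR.le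

/-- **Rouché's theorem** for entire functions; the zeros in the disc are listed in multisets. -/
theorem Differentiable.rouche {f g : ℂ → ℂ} (hf : Differentiable ℂ f) (hg : Differentiable ℂ g)
    {c : ℂ} {R : ℝ} (hR : 0 < R) (h : ∀ z ∈ Metric.sphere c R, ‖f z - g z‖ < ‖g z‖) :
    ∃ s t : Multiset ℂ, s.card = t.card ∧
      (∀ z ∈ s, z ∈ Metric.ball c R) ∧ (∀ z ∈ t, z ∈ Metric.ball c R) ∧
      (∀ z ∈ Metric.ball c R, analyticOrderAt f z = s.count z) ∧
      ∀ z ∈ Metric.ball c R, analyticOrderAt g z = t.count z := by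
  have hg0 : ∀ z ∈ Metric.sphere c R, g z ≠ 0 := fun z hz h0 => by
    have := h z hz
    rw [h0, norm_zero] at this
    exact absurd this (not_lt.2 (norm_nonneg _))
  have hf0 : ∀ z ∈ Metric.sphere c R, f z ≠ 0 := fun z hz h0 => by
    have := h z hz
    rw [h0, zero_sub, norm_neg] at this
    exact lt_irrefl _ this
  have key : ∀ f : ℂ → ℂ, Differentiable ℂ f → (∀ z ∈ Metric.sphere c R, f z ≠ 0) →
      ∃ s : Multiset ℂ, (∀ z ∈ s, z ∈ Metric.ball c R) ∧
        (∀ z ∈ Metric.ball c R, analyticOrderAt f z = s.count z) ∧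
        ∮ z in C(c, R), logDeriv f z = 2 * Real.pi * Complex.I * s.card := by
    intro f hf hf0
    have hmem : circleMap c R 0 ∈ Metric.sphere c R := circleMap_mem_sphere c hR.le 0
    obtain ⟨s, u, hu, hu0, hs, hfs⟩ :=
      hf.exists_eq_multiset_prod_mul (hf0 _ hmem) (isCompact_closedBall c R)
    have hs' : ∀ z ∈ s, z ∈ Metric.ball c R := fun z hz => by
      rw [Metric.mem_ball]
      refine lt_of_le_of_ne (Metric.mem_closedBall.1 (hs z hz).1) fun h => ?_
      exact hf0 z (Metric.mem_sphere.2 h) (hs z hz).2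
    have e : f = fun z => (s.map fun a => z - a).prod * u z := funext hfs
    refine ⟨s, hs', fun z hz => ?_, ?_⟩
    · have e' : f = (fun z => (s.map fun a => z - a).prod) * u := e
      rw [e', analyticOrderAt_mul ((differentiable_multiset_prod_sub s).analyticAt z)
        (hu.analyticAt z), analyticOrderAt_multiset_prod_sub,
        (hu.analyticAt z).analyticOrderAt_eq_zero.2
          (hu0 z (Metric.ball_subset_closedBall hz)), add_zero]
    · rw [e]
      exact circleIntegral_logDeriv_multiset_prod_mul hR s hs' hu hu0
  obtain ⟨s, hs, hsc, hsI⟩ := key f hf hf0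
  obtain ⟨t, ht, htc, htI⟩ := key g hg hg0
  refine ⟨s, t, ?_, hs, ht, hsc, htc⟩
  -- On the circle f/g stays in the disc of radius 1 about 1, so the principal logarithm of f/g is a
  -- primitive of the difference of the logarithmic derivatives.
  have h0 : ∮ z in C(c, R), (logDeriv f z - logDeriv g z) = 0 := by
    refine circleIntegral.integral_eq_zero_of_hasDerivWithinAt (f := fun z =>
      Complex.log (f z / g z)) hR.le fun z hz => ?_
    have hslit : f z / g z ∈ Complex.slitPlane := by
      refine Complex.mem_slitPlane_of_norm_lt_one (z := f z / g z - 1) ?_ |> fun h => by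
        simpa using h
      rw [div_sub_one (hg0 z hz), norm_div, div_lt_one (norm_pos_iff.2 (hg0 z hz))]
      exact h z hz
    refine ((((hf z).hasDerivAt.div (hg z).hasDerivAt (hg0 z hz)).clog hslit).congr_deriv
      ?_).hasDerivWithinAt
    have h1 := hg0 z hz
    have h2 := hf0 z hz
    rw [logDeriv_apply, logDeriv_apply, Pi.div_apply]
    field_simp
  rw [circleIntegral.integral_sub ((continuousOn_logDeriv hf hf0).circleIntegrable hR.le)
    ((continuousOn_logDeriv hg hg0).circleIntegrable hR.le), hsI, htI, sub_eq_zero] at h0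
  have := mul_left_cancel₀ (by simp [Real.pi_ne_zero]) h0
  exact_mod_cast this

/-! ### Exponential bounds for sine and cosine -/

theorem Complex.norm_exp_mul_I_le (z : ℂ) : ‖Complex.exp (z * Complex.I)‖ ≤ Real.exp |z.im| := by
  rw [Complex.norm_exp]
  simpa using neg_le_abs z.im

theorem Complex.norm_cos_le (z : ℂ) : ‖Complex.cos z‖ ≤ Real.exp |z.im| := by
  have h1 := Complex.norm_exp_mul_I_le z
  have h2 := Complex.norm_exp_mul_I_le (-z)
  rw [Complex.neg_im, abs_neg] at h2
  rw [Complex.cos, norm_div, Complex.norm_ofNat, div_le_iff₀ two_pos]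
  exact (norm_add_le _ _).trans (by linarith)

theorem Complex.norm_sin_le (z : ℂ) : ‖Complex.sin z‖ ≤ Real.exp |z.im| := by
  have h1 := Complex.norm_exp_mul_I_le z
  have h2 := Complex.norm_exp_mul_I_le (-z)
  rw [Complex.neg_im, abs_neg] at h2
  rw [Complex.sin, norm_div, Complex.norm_ofNat, div_le_iff₀ two_pos, norm_mul, Complex.norm_I,
    mul_one]
  exact (norm_sub_le _ _).trans (by linarith)

theorem Complex.sq_norm_sin (z : ℂ) :
    ‖Complex.sin z‖ ^ 2 = Real.sin z.re ^ 2 + Real.sinh z.im ^ 2 := by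
  conv_lhs => rw [← Complex.re_add_im z, Complex.sin_add_mul_I]
  rw [← Complex.ofReal_sin, ← Complex.ofReal_cos, ← Complex.ofReal_cosh, ← Complex.ofReal_sinh,
    Complex.sq_norm, Complex.normSq_apply]
  simp only [Complex.add_re, Complex.mul_re, Complex.ofReal_re, Complex.ofReal_im, Complex.I_re,
    Complex.I_im, Complex.add_im, Complex.mul_im]
  have h1 := Real.sin_sq_add_cos_sq z.re
  have h2 := Real.cosh_sq z.im
  linear_combination Real.sin z.re ^ 2 * h2 + Real.sinh z.im ^ 2 * h1

theorem Complex.le_norm_sin {z : ℂ} {r : ℝ} (hr : r ≤ 1)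
    (h : ∀ k : ℤ, r ≤ ‖z - k * Real.pi‖) : r / 5 * Real.exp |z.im| ≤ ‖Complex.sin z‖ := by
  by_cases hr0 : r ≤ 0
  · exact (mul_nonpos_of_nonpos_of_nonneg (by linarith) (Real.exp_nonneg _)).trans (norm_nonneg _)
  push Not at hr0
  have hsinh : |z.im| ≤ |Real.sinh z.im| := by
    rw [Real.abs_sinh]; exact Real.self_le_sinh_iff.2 (abs_nonneg _)
  -- From |sin z|² = sin² x + sinh² y: for |y| ≤ 1, Jordan's inequality gives |sin z| ≥ 3r/5, and
  -- exp|y| ≤ 3. For |y| > 1 the term sinh |y| alone suffices.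
  by_cases hy : |z.im| ≤ 1
  · set k := round (z.re / Real.pi) with hk
    have hpi := Real.pi_pos
    have hx : |z.re - k * Real.pi| ≤ Real.pi / 2 := by
      have := abs_sub_round (z.re / Real.pi)
      have e : z.re - k * Real.pi = (z.re / Real.pi - k) * Real.pi := by field_simp
      rw [e, abs_mul, abs_of_pos hpi]
      nlinarith
    have hs := Real.mul_abs_le_abs_sin hx
    rw [Real.sin_sub_int_mul_pi, abs_mul, abs_zpow, abs_neg, abs_one, one_zpow, one_mul] at hs
    have hpi4 : (3 / 5 : ℝ) ≤ 2 / Real.pi := by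
      rw [div_le_div_iff₀ (by norm_num) hpi]; linarith [Real.pi_lt_d2]
    have hd : r ^ 2 ≤ |z.re - k * Real.pi| ^ 2 + |z.im| ^ 2 := by
      have h1 := pow_le_pow_left₀ hr0.le (h k) 2
      rw [Complex.sq_norm, Complex.normSq_apply] at h1
      simp only [Complex.sub_re, Complex.mul_re, Complex.intCast_re, Complex.ofReal_re,
        Complex.intCast_im, Complex.ofReal_im, mul_zero, sub_zero, Complex.sub_im, Complex.mul_im,
        zero_mul, add_zero] at h1
      rw [sq_abs, sq_abs]; linarith
    have hs' : 3 / 5 * |z.re - k * Real.pi| ≤ |Real.sin z.re| :=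
      (mul_le_mul_of_nonneg_right hpi4 (abs_nonneg _)).trans hs
    have h1 : (3 / 5 * r) ^ 2 ≤ ‖Complex.sin z‖ ^ 2 := by
      rw [Complex.sq_norm_sin, ← sq_abs (Real.sin _), ← sq_abs (Real.sinh _)]
      have h2 := pow_le_pow_left₀ (by positivity) hs' 2
      have h3 := pow_le_pow_left₀ (abs_nonneg _) hsinh 2
      nlinarith [sq_nonneg |z.im|]
    have h4 := (pow_le_pow_iff_left₀ (by positivity) (norm_nonneg _) two_ne_zero).1 h1
    have h5 : Real.exp |z.im| ≤ 3 :=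
      (Real.exp_le_exp.2 hy).trans (Real.exp_one_lt_d9.le.trans (by norm_num))
    nlinarith
  · push Not at hy
    have h1 : |Real.sinh z.im| ≤ ‖Complex.sin z‖ := by
      refine (pow_le_pow_iff_left₀ (abs_nonneg _) (norm_nonneg _) two_ne_zero).1 ?_
      rw [Complex.sq_norm_sin, sq_abs]
      linarith [sq_nonneg (Real.sin z.re)]
    rw [Real.abs_sinh, Real.sinh_eq] at h1
    have h2 := Real.add_one_le_exp |z.im|
    have h3 : Real.exp (-|z.im|) ≤ 1 := Real.exp_le_one_iff.2 (by linarith)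
    nlinarith [Real.exp_pos |z.im|]

/-! ### The number σ and the main part -/

theorem cos_two_mul_sigma : Real.cos (2 * sigma) = -1 / 3 := by
  rw [sigma, mul_div_cancel₀ _ two_ne_zero, Real.cos_arccos] <;> norm_num

theorem pi_div_four_lt_sigma : Real.pi / 4 < sigma := by
  have : Real.arccos 0 < Real.arccos (-1 / 3) :=
    Real.strictAntiOn_arccos (by norm_num) (by norm_num) (by norm_num)
  rw [Real.arccos_zero] at this
  rw [sigma]; linarith

theorem sigma_lt_pi_div_three : sigma < Real.pi / 3 := by
  have h1 : Real.arccos (-1 / 3) < Real.arccos (-1 / 2) :=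
    Real.strictAntiOn_arccos (by norm_num) (by norm_num) (by norm_num)
  have h2 : Real.cos (2 * Real.pi / 3) = -1 / 2 := by
    rw [show 2 * Real.pi / 3 = Real.pi - Real.pi / 3 by ring, Real.cos_pi_sub,
      Real.cos_pi_div_three]; ring
  rw [← h2, Real.arccos_cos (by positivity) (by linarith [Real.pi_pos])] at h1
  rw [sigma]; linarith

theorem sin_sigma_sq : Real.sin sigma ^ 2 = 2 / 3 := by
  have h := cos_two_mul_sigma
  rw [Real.cos_two_mul'] at h
  linarith [Real.sin_sq_add_cos_sq sigma]

/-- The main part of the characteristic function. -/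
noncomputable def mainPart (z : ℂ) : ℂ := Complex.sin z * (3 * Complex.cos z ^ 2 - 1)

/-- Because sin(z − σ) sin(z + σ) = sin² z − sin² σ and sin² σ = 2/3. -/
theorem mainPart_eq (z : ℂ) :
    mainPart z = -3 * (Complex.sin z * Complex.sin (z - sigma) * Complex.sin (z + sigma)) := by
  have h : Complex.sin (sigma : ℂ) ^ 2 = 2 / 3 := by
    rw [← Complex.ofReal_sin, ← Complex.ofReal_pow, sin_sigma_sq]; norm_num
  have h1 := Complex.sin_sq_add_cos_sq (sigma : ℂ)
  have h2 := Complex.sin_sq_add_cos_sq z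
  rw [mainPart, Complex.sin_sub, Complex.sin_add]
  linear_combination 3 * Complex.sin z ^ 3 * h1 - 3 * Complex.sin z
    * (Complex.sin z ^ 2 + Complex.cos z ^ 2) * h + Complex.sin z * h2

/-- The points at distance at least `1 / 4` from all zeros of `mainPart`. -/
def IsFar (z : ℂ) : Prop :=
  ∀ k : ℤ, 1 / 4 ≤ ‖z - k * Real.pi‖ ∧ 1 / 4 ≤ ‖z - sigma - k * Real.pi‖ ∧
    1 / 4 ≤ ‖z + sigma - k * Real.pi‖

/-- Each of the three sines is at least exp|Im z|/20; the prefactor is 3. -/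
theorem IsFar.le_norm_mainPart {z : ℂ} (h : IsFar z) :
    3 / 8000 * Real.exp (3 * |z.im|) ≤ ‖mainPart z‖ := by
  have h1 := Complex.le_norm_sin (by norm_num) fun k => (h k).1
  have h2 := Complex.le_norm_sin (by norm_num) fun k => (h k).2.1
  have h3 := Complex.le_norm_sin (by norm_num) fun k => (h k).2.2
  simp only [Complex.sub_im, Complex.add_im, Complex.ofReal_im, sub_zero, add_zero] at h2 h3
  have e : Real.exp (3 * |z.im|) = Real.exp |z.im| * Real.exp |z.im| * Real.exp |z.im| := by
    rw [← Real.exp_add, ← Real.exp_add]; ring_nf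
  rw [mainPart_eq, norm_mul, norm_mul, norm_mul, norm_neg, Complex.norm_ofNat, e]
  have h12 := mul_le_mul h1 h2 (by positivity) (norm_nonneg _)
  have h123 := mul_le_mul h12 h3 (by positivity) (by positivity)
  linarith

/-! ### Two-term form of the characteristic function -/

/-- The oscillating coefficient built from the potential on the second edge. -/
noncomputable def oscCos (q : ℝ → ℂ) (z : ℂ) : ℂ :=
  ∫ t in (0 : ℝ)..1, q t * Complex.cos (z * (2 * t - 1))

/-- The oscillating coefficient built from the potential on the third edge. -/
noncomputable def oscSin (q : ℝ → ℂ) (z : ℂ) : ℂ :=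
  ∫ t in (0 : ℝ)..1, q t * Complex.sin (z * (2 * t - 1))

/-- The second term of the asymptotics of the characteristic function. -/
noncomputable def subPart (q₂ q₃ : ℝ → ℂ) (z : ℂ) : ℂ :=
  -omega q₂ * Complex.cos z ^ 2 + omega q₃ * Complex.sin z ^ 2
    + (Complex.cos z * oscCos q₂ z + Complex.sin z * oscSin q₃ z)

theorem intervalIntegrable_mul_continuous {q φ : ℝ → ℂ} (hq : Integrable q) (hφ : Continuous φ)
    (a b : ℝ) : IntervalIntegrable (fun t => q t * φ t) volume a b :=
  hq.intervalIntegrable.mul_continuousOn hφ.continuousOn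

/-- An exact identity, not an estimate. The addition formulas for z(2t − 1) = 2zt − z turn the
moments of cos·sin and sin² into the oscillating integrals plus multiples of ω₂ and ω₃. -/
theorem mul_charFun₁_sq {q₂ q₃ : ℝ → ℂ} (hq₂ : Integrable q₂) (hq₃ : Integrable q₃) {z : ℂ}
    (hz : z ≠ 0) : z * charFun₁ q₂ q₃ (z ^ 2) = mainPart z + subPart q₂ q₃ z / (2 * z) := by
  have hS : ∀ x, sinSol x (z ^ 2) = z⁻¹ * Complex.sin (z * x) := fun x => by
    rw [← mul_sinSol_sq, inv_mul_cancel_left₀ hz]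
  have hC := fun x => cosSol_sq x z
  have hP : ∀ q : ℝ → ℂ, csMoment q 1 (z ^ 2)
      = z⁻¹ * ∫ t in (0 : ℝ)..1, q t * (Complex.cos (z * t) * Complex.sin (z * t)) := fun q => by
    rw [csMoment, ← intervalIntegral.integral_const_mul]
    refine intervalIntegral.integral_congr fun t _ => ?_
    simp only [hS, hC]; ring
  have hQ : ∀ q : ℝ → ℂ, ssMoment q 1 (z ^ 2)
      = z⁻¹ ^ 2 * ∫ t in (0 : ℝ)..1, q t * (Complex.sin (z * t) * Complex.sin (z * t)) := fun q => by
    rw [ssMoment, ← intervalIntegral.integral_const_mul]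
    refine intervalIntegral.integral_congr fun t _ => ?_
    simp only [hS]; ring
  have split : ∀ q : ℝ → ℂ, Integrable q → ∀ a b : ℂ,
      a * (∫ t in (0 : ℝ)..1, q t * (Complex.cos (z * t) * Complex.sin (z * t)))
        + b * (∫ t in (0 : ℝ)..1, q t * (Complex.sin (z * t) * Complex.sin (z * t)))
      = ∫ t in (0 : ℝ)..1, q t * (a * (Complex.cos (z * t) * Complex.sin (z * t))
          + b * (Complex.sin (z * t) * Complex.sin (z * t))) := fun q hq a b => by
    rw [← intervalIntegral.integral_const_mul, ← intervalIntegral.integral_const_mul,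
      ← intervalIntegral.integral_add]
    · exact intervalIntegral.integral_congr fun t _ => by ring
    · exact (intervalIntegrable_mul_continuous hq (by fun_prop) _ _).const_mul a
    · exact (intervalIntegrable_mul_continuous hq (by fun_prop) _ _).const_mul b
  have sub : ∀ q : ℝ → ℂ, Integrable q → ∀ (φ : ℝ → ℂ) (a : ℂ), Continuous φ →
      (∫ t in (0 : ℝ)..1, q t * φ t) + a * omega q = ∫ t in (0 : ℝ)..1, q t * (φ t + a) := by
    intro q hq φ a hφ
    rw [omega, ← intervalIntegral.integral_const_mul, ← intervalIntegral.integral_add]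
    · exact intervalIntegral.integral_congr fun t _ => by ring
    · exact intervalIntegrable_mul_continuous hq hφ _ _
    · exact hq.intervalIntegrable.const_mul a
  have trig : ∀ t : ℝ, Complex.cos (z * (2 * t - 1)) = Complex.cos z
      + 2 * (Complex.sin z * (Complex.cos (z * t) * Complex.sin (z * t))
        - Complex.cos z * (Complex.sin (z * t) * Complex.sin (z * t))) ∧
      Complex.sin (z * (2 * t - 1)) = -Complex.sin z
      + 2 * (Complex.cos z * (Complex.cos (z * t) * Complex.sin (z * t))
        + Complex.sin z * (Complex.sin (z * t) * Complex.sin (z * t))) := fun t => by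
    rw [show z * (2 * t - 1) = 2 * (z * t) - z by ring, Complex.cos_sub, Complex.sin_sub,
      Complex.cos_two_mul, Complex.sin_two_mul]
    have h := Complex.sin_sq_add_cos_sq (z * t)
    constructor
    · linear_combination 2 * Complex.cos z * h
    · linear_combination -2 * Complex.sin z * h
  have k₂ : oscCos q₂ z + -Complex.cos z * omega q₂
      = 2 * Complex.sin z * (∫ t in (0 : ℝ)..1, q₂ t * (Complex.cos (z * t) * Complex.sin (z * t)))
        + -2 * Complex.cos z *
          (∫ t in (0 : ℝ)..1, q₂ t * (Complex.sin (z * t) * Complex.sin (z * t))) := by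
    rw [split q₂ hq₂, oscCos, sub q₂ hq₂ _ _ (by fun_prop)]
    refine intervalIntegral.integral_congr fun t _ => ?_
    simp only [(trig t).1]; ring
  have k₃ : oscSin q₃ z + Complex.sin z * omega q₃
      = 2 * Complex.cos z * (∫ t in (0 : ℝ)..1, q₃ t * (Complex.cos (z * t) * Complex.sin (z * t)))
        + 2 * Complex.sin z *
          (∫ t in (0 : ℝ)..1, q₃ t * (Complex.sin (z * t) * Complex.sin (z * t))) := by
    rw [split q₃ hq₃, oscSin, sub q₃ hq₃ _ _ (by fun_prop)]
    refine intervalIntegral.integral_congr fun t _ => ?_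
    simp only [(trig t).2]; ring
  have py := Complex.sin_sq_add_cos_sq z
  rw [charFun₁, farValue, farSlope, edgeSol, edgeDer, hP, hQ, hP, hQ, hS, hC, mainPart, subPart]
  simp only [Complex.ofReal_one, mul_one]
  generalize (∫ t in (0 : ℝ)..1, q₂ t * (Complex.cos (z * t) * Complex.sin (z * t))) = P₂ at *
  generalize (∫ t in (0 : ℝ)..1, q₂ t * (Complex.sin (z * t) * Complex.sin (z * t))) = Q₂ at *
  generalize (∫ t in (0 : ℝ)..1, q₃ t * (Complex.cos (z * t) * Complex.sin (z * t))) = P₃ at *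
  generalize (∫ t in (0 : ℝ)..1, q₃ t * (Complex.sin (z * t) * Complex.sin (z * t))) = Q₃ at *
  field_simp
  linear_combination (-Complex.cos z) * k₂ - Complex.sin z * k₃ - 2 * z * Complex.sin z * py

theorem norm_integral_mul_le {q φ : ℝ → ℂ} (hq : Integrable q) {M : ℝ}
    (hM : ∀ t ∈ Icc (0 : ℝ) 1, ‖φ t‖ ≤ M) :
    ‖∫ t in (0 : ℝ)..1, q t * φ t‖ ≤ (∫ t in (0 : ℝ)..1, ‖q t‖) * M := by
  rw [← intervalIntegral.integral_mul_const]
  refine intervalIntegral.norm_integral_le_of_norm_le zero_le_one (ae_of_all _ fun t ht => ?_)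
    (hq.norm.intervalIntegrable.mul_const M)
  rw [norm_mul]
  exact mul_le_mul_of_nonneg_left (hM t (Ioc_subset_Icc_self ht)) (norm_nonneg _)

theorem abs_im_mul_le (z : ℂ) {t : ℝ} (ht : t ∈ Icc (0 : ℝ) 1) :
    |(z * (2 * t - 1)).im| ≤ |z.im| := by
  have e : (z * (2 * t - 1)).im = z.im * (2 * t - 1) := by
    rw [show (2 * t - 1 : ℂ) = ((2 * t - 1 : ℝ) : ℂ) by push_cast; ring, Complex.im_mul_ofReal]
  rw [e, abs_mul]
  exact mul_le_of_le_one_right (abs_nonneg _) (abs_le.2 ⟨by linarith [ht.1], by linarith [ht.2]⟩)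

theorem norm_oscCos_le {q : ℝ → ℂ} (hq : Integrable q) (z : ℂ) :
    ‖oscCos q z‖ ≤ (∫ t in (0 : ℝ)..1, ‖q t‖) * Real.exp |z.im| :=
  norm_integral_mul_le hq fun _ ht =>
    (Complex.norm_cos_le _).trans (Real.exp_le_exp.2 (abs_im_mul_le z ht))

theorem norm_oscSin_le {q : ℝ → ℂ} (hq : Integrable q) (z : ℂ) :
    ‖oscSin q z‖ ≤ (∫ t in (0 : ℝ)..1, ‖q t‖) * Real.exp |z.im| :=
  norm_integral_mul_le hq fun _ ht =>
    (Complex.norm_sin_le _).trans (Real.exp_le_exp.2 (abs_im_mul_le z ht))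

/-- Every term is a product of two factors of size exp|Im z|, since |2t − 1| ≤ 1 on [0, 1]; this is
one exponential less than the main part. -/
theorem exists_norm_subPart_le {q₂ q₃ : ℝ → ℂ} (hq₂ : Integrable q₂) (hq₃ : Integrable q₃) :
    ∃ M : ℝ, 0 < M ∧ ∀ z, ‖subPart q₂ q₃ z‖ ≤ M * Real.exp (2 * |z.im|) := by
  set N₂ := ∫ t in (0 : ℝ)..1, ‖q₂ t‖ with hN₂
  set N₃ := ∫ t in (0 : ℝ)..1, ‖q₃ t‖ with hN₃
  have hN₂0 : 0 ≤ N₂ := intervalIntegral.integral_nonneg zero_le_one fun _ _ => norm_nonneg _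
  have hN₃0 : 0 ≤ N₃ := intervalIntegral.integral_nonneg zero_le_one fun _ _ => norm_nonneg _
  refine ⟨‖omega q₂‖ + ‖omega q₃‖ + N₂ + N₃ + 1, by positivity, fun z => ?_⟩
  have e : Real.exp (2 * |z.im|) = Real.exp |z.im| * Real.exp |z.im| := by
    rw [← Real.exp_add]; ring_nf
  have hc := Complex.norm_cos_le z
  have hs := Complex.norm_sin_le z
  have hA := norm_oscCos_le hq₂ z
  have hB := norm_oscSin_le hq₃ z
  set X := Real.exp |z.im| with hX
  have hX0 : 0 ≤ X := Real.exp_nonneg _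
  have t1 : ‖-omega q₂ * Complex.cos z ^ 2‖ ≤ ‖omega q₂‖ * (X * X) := by
    rw [norm_mul, norm_neg, norm_pow, sq]; gcongr
  have t2 : ‖omega q₃ * Complex.sin z ^ 2‖ ≤ ‖omega q₃‖ * (X * X) := by
    rw [norm_mul, norm_pow, sq]; gcongr
  have t3 : ‖Complex.cos z * oscCos q₂ z‖ ≤ X * (N₂ * X) := by
    rw [norm_mul]; gcongr
  have t4 : ‖Complex.sin z * oscSin q₃ z‖ ≤ X * (N₃ * X) := by
    rw [norm_mul]; gcongr
  rw [subPart, e]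
  refine (norm_add_le _ _).trans ((add_le_add (norm_add_le _ _) (norm_add_le _ _)).trans ?_)
  nlinarith [mul_nonneg hX0 hX0]

/-! ### Zeros of the main part -/

/-- The real zeros of `mainPart`. -/
def mainZeros : Set ℝ :=
  {x | ∃ k : ℤ, x = k * Real.pi ∨ x = k * Real.pi + sigma ∨ x = k * Real.pi - sigma}

theorem le_abs_int_mul_pi_add {δ c : ℝ} (h1 : c ≤ δ) (h2 : δ ≤ Real.pi - c) (j : ℤ) :
    c ≤ |j * Real.pi + δ| := by
  have hpi := Real.pi_pos
  rcases le_or_gt 0 j with hj | hj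
  · have : (0 : ℝ) ≤ j := by exact_mod_cast hj
    exact le_abs.2 (Or.inl (by nlinarith))
  · have : (j : ℝ) ≤ -1 := by exact_mod_cast Int.le_sub_one_of_lt hj
    exact le_abs.2 (Or.inr (by nlinarith))

/-- Modulo π, differences of zeros are 0, ±σ or ±2σ, and both σ and 2σ lie in [π/6, 5π/6]. As π/6 >
1/2, discs of radius 1/4 about distinct zeros are disjoint. -/
theorem mainZeros_separated {a b : ℝ} (ha : a ∈ mainZeros) (hb : b ∈ mainZeros) :
    a = b ∨ Real.pi / 6 ≤ |a - b| := by
  obtain ⟨k, hk⟩ := ha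
  obtain ⟨l, hl⟩ := hb
  have hpi := Real.pi_pos
  have s1 := pi_div_four_lt_sigma
  have s2 := sigma_lt_pi_div_three
  have hδ : ∀ (j : ℤ) (δ : ℝ), Real.pi / 6 ≤ δ → δ ≤ Real.pi - Real.pi / 6 →
      (a - b = j * Real.pi + δ ∨ a - b = j * Real.pi - δ) → a = b ∨ Real.pi / 6 ≤ |a - b| := by
    intro j δ h1 h2 h
    right
    rcases h with h | h
    · rw [h]; exact le_abs_int_mul_pi_add h1 h2 j
    · have := le_abs_int_mul_pi_add h1 h2 (-j)
      rw [h, ← abs_neg]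
      convert this using 2
      push_cast; ring
  have h0 : a - b = (k - l) * Real.pi → a = b ∨ Real.pi / 6 ≤ |a - b| := fun h => by
    rcases eq_or_ne k l with rfl | hkl
    · left; linarith
    · right
      have : (1 : ℝ) ≤ |((k - l : ℤ) : ℝ)| := by
        rw [← Int.cast_abs]; exact_mod_cast Int.one_le_abs (sub_ne_zero.2 hkl)
      rw [h, abs_mul, abs_of_pos hpi]
      push_cast at this
      nlinarith
  rcases hk with rfl | rfl | rfl <;> rcases hl with rfl | rfl | rfl
  · exact h0 (by ring)
  · exact hδ (k - l) sigma (by linarith) (by linarith) (Or.inr (by push_cast; ring))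
  · exact hδ (k - l) sigma (by linarith) (by linarith) (Or.inl (by push_cast; ring))
  · exact hδ (k - l) sigma (by linarith) (by linarith) (Or.inl (by push_cast; ring))
  · exact h0 (by ring)
  · exact hδ (k - l) (2 * sigma) (by linarith) (by linarith) (Or.inl (by push_cast; ring))
  · exact hδ (k - l) sigma (by linarith) (by linarith) (Or.inr (by push_cast; ring))
  · exact hδ (k - l) (2 * sigma) (by linarith) (by linarith) (Or.inr (by push_cast; ring))
  · exact h0 (by ring)

theorem neg_mem_mainZeros {a : ℝ} (ha : a ∈ mainZeros) : -a ∈ mainZeros := by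
  obtain ⟨k, hk⟩ := ha
  refine ⟨-k, ?_⟩
  push_cast
  rcases hk with rfl | rfl | rfl
  · left; ring
  · right; right; ring
  · right; left; ring

theorem half_lt_pi_div_six : (1 / 2 : ℝ) < Real.pi / 6 := by linarith [Real.pi_gt_three]

theorem isFar_of_forall {z : ℂ} (h : ∀ b ∈ mainZeros, 1 / 4 ≤ ‖z - (b : ℂ)‖) : IsFar z := by
  intro k
  refine ⟨?_, ?_, ?_⟩
  · convert h (k * Real.pi) ⟨k, Or.inl rfl⟩ using 3; push_cast; ring
  · convert h (k * Real.pi + sigma) ⟨k, Or.inr (Or.inl rfl)⟩ using 2; push_cast; ring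
  · convert h (k * Real.pi - sigma) ⟨k, Or.inr (Or.inr rfl)⟩ using 2; push_cast; ring

theorem mainPart_eq_zero_iff {z : ℂ} : mainPart z = 0 ↔ ∃ b ∈ mainZeros, z = (b : ℂ) := by
  rw [mainPart_eq]
  simp only [mul_eq_zero, neg_eq_zero, OfNat.ofNat_ne_zero, false_or, Complex.sin_eq_zero_iff]
  constructor
  · rintro ((⟨k, hk⟩ | ⟨k, hk⟩) | ⟨k, hk⟩)
    · exact ⟨k * Real.pi, ⟨k, Or.inl rfl⟩, by rw [hk]; push_cast; ring⟩
    · exact ⟨k * Real.pi + sigma, ⟨k, Or.inr (Or.inl rfl)⟩, by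
        push_cast; linear_combination hk⟩
    · exact ⟨k * Real.pi - sigma, ⟨k, Or.inr (Or.inr rfl)⟩, by
        push_cast; linear_combination hk⟩
  · rintro ⟨b, ⟨k, rfl | rfl | rfl⟩, rfl⟩
    · exact Or.inl (Or.inl ⟨k, by push_cast; ring⟩)
    · exact Or.inl (Or.inr ⟨k, by push_cast; ring⟩)
    · exact Or.inr ⟨k, by push_cast; ring⟩

theorem differentiable_mainPart : Differentiable ℂ mainPart := by
  unfold mainPart; fun_prop

/-- The derivative equals cos z (9cos² z − 7), while cos² z is 1 or 1/3 at a zero. -/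
theorem analyticOrderAt_mainPart {z : ℂ} (h : mainPart z = 0) : analyticOrderAt mainPart z = 1 := by
  refine (differentiable_mainPart.analyticAt z).analyticOrderAt_eq_one_of_zero_deriv_ne_zero h ?_
  have hd : HasDerivAt mainPart (Complex.cos z * (3 * Complex.cos z ^ 2 - 1)
      + Complex.sin z * (3 * (2 * Complex.cos z * -Complex.sin z))) z := by
    refine ((Complex.hasDerivAt_sin z).mul
      ((((Complex.hasDerivAt_cos z).pow 2).const_mul 3).sub_const 1)).congr_deriv ?_
    simp
  rw [hd.deriv]
  have py := Complex.sin_sq_add_cos_sq z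
  have e : Complex.cos z * (3 * Complex.cos z ^ 2 - 1)
      + Complex.sin z * (3 * (2 * Complex.cos z * -Complex.sin z))
      = Complex.cos z * (9 * Complex.cos z ^ 2 - 7) := by
    linear_combination (-6 * Complex.cos z) * py
  rw [e]
  rcases mul_eq_zero.1 h with h | h
  · have hc : Complex.cos z ^ 2 = 1 := by rw [h] at py; linear_combination py
    refine mul_ne_zero (fun h0 => ?_) ?_
    · rw [h0] at hc; norm_num at hc
    · rw [hc]; norm_num
  · have hc : Complex.cos z ^ 2 = 1 / 3 := by linear_combination h / 3
    refine mul_ne_zero (fun h0 => ?_) ?_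
    · rw [h0] at hc; norm_num at hc
    · rw [hc]; norm_num

/-- Away from 0 the squaring map is locally biholomorphic and the factor z does not vanish. -/
theorem analyticOrderAt_mul_comp_sq {D : ℂ → ℂ} (hD : Differentiable ℂ D) {r : ℂ} (hr : r ≠ 0) :
    analyticOrderAt (fun z => z * D (z ^ 2)) r = analyticOrderAt D (r ^ 2) := by
  have e : (fun z => z * D (z ^ 2)) = (fun z : ℂ => z) * (D ∘ fun z : ℂ => z ^ 2) := rfl
  have hsq : AnalyticAt ℂ (fun z : ℂ => z ^ 2) r := by fun_prop
  rw [e, analyticOrderAt_mul (by fun_prop) (AnalyticAt.comp (hD.analyticAt _) hsq),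
    analyticOrderAt_comp_of_deriv_ne_zero hsq (by simpa using hr),
    analyticOrderAt_eq_zero.2 (Or.inr hr), zero_add]

theorem Differentiable.mul_comp_sq {D : ℂ → ℂ} (hD : Differentiable ℂ D) :
    Differentiable ℂ fun z => z * D (z ^ 2) :=
  differentiable_fun_id.fun_mul (hD.comp (differentiable_fun_id.pow 2))

/-! ### The free problem and the indexing of its eigenvalues -/

/-- The characteristic function of the problem without potentials. -/
noncomputable def freeCharFun (lam : ℂ) : ℂ := sinSol 1 lam * (3 * cosSol 1 lam ^ 2 - 1)

theorem differentiable_freeCharFun : Differentiable ℂ freeCharFun :=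
  (entireFamily_sinSol.diff 1).fun_mul
    ((((entireFamily_cosSol.diff 1).pow 2).const_mul 3).sub_const 1)

theorem mul_freeCharFun_sq (z : ℂ) : z * freeCharFun (z ^ 2) = mainPart z := by
  have h1 := mul_sinSol_sq 1 z
  have h2 := cosSol_sq 1 z
  simp only [Complex.ofReal_one, mul_one] at h1 h2
  rw [freeCharFun, h2, ← mul_assoc, h1, mainPart]

/-- The zero of `mainPart` at 0 comes from the factor z alone; λ = 0 is not a free eigenvalue. -/
theorem freeCharFun_zero : freeCharFun 0 = 2 := by
  rw [freeCharFun, sinSol_zero_right, cosSol_zero_right]; norm_num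

/-- Indices of the eigenvalues: the first subspectrum is indexed by the nonzero integers, the second
one by the natural numbers. -/
abbrev SpecIndex : Type := {n : ℤ // n ≠ 0} ⊕ ℕ

/-- The square roots of the eigenvalues of the problem without potentials. -/
noncomputable def specCenter : SpecIndex → ℝ
  | .inl n => (n : ℤ) * Real.pi + sigma
  -- The member n = 0 of the family πn + σ, which the nonzero integers leave out.
  | .inr 0 => sigma
  | .inr (n + 1) => (n + 1 : ℕ) * Real.pi

theorem specCenter_inr {n : ℕ} (hn : n ≠ 0) : specCenter (.inr n) = n * Real.pi := by
  obtain ⟨m, rfl⟩ := Nat.exists_eq_succ_of_ne_zero hn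
  rfl

/-- The indices whose centers lie in the disc of radius `π (N + 1 / 2)`. -/
def smallIndex (N : ℕ) : Set SpecIndex :=
  {i | Sum.elim (fun n : {n : ℤ // n ≠ 0} => n.1.natAbs) id i ≤ N}

theorem finite_smallIndex (N : ℕ) : (smallIndex N).Finite := by
  have h1 : {n : {n : ℤ // n ≠ 0} | n.1.natAbs ≤ N}.Finite := by
    refine Set.Finite.of_finite_image (f := Subtype.val) ?_ Subtype.val_injective.injOn
    refine (Set.finite_Icc (-N : ℤ) N).subset ?_
    rintro _ ⟨n, hn, rfl⟩
    have : n.1.natAbs ≤ N := hn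
    constructor <;> omega
  refine ((h1.image Sum.inl).union ((Set.finite_Iic N).image Sum.inr)).subset ?_
  rintro (n | n) hn
  · exact Or.inl ⟨n, hn, rfl⟩
  · exact Or.inr ⟨n, hn, rfl⟩

theorem specCenter_mem (i : SpecIndex) : specCenter i ∈ mainZeros := by
  rcases i with n | n
  · exact ⟨n, Or.inr (Or.inl rfl)⟩
  · cases n with
    | zero => exact ⟨0, Or.inr (Or.inl (by simp [specCenter]))⟩
    | succ n => exact ⟨(n + 1 : ℕ), Or.inl (by simp [specCenter])⟩

theorem abs_specCenter_le {N : ℕ} {i : SpecIndex} (h : i ∈ smallIndex N) :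
    |specCenter i| ≤ Real.pi * (N + 1 / 2) - Real.pi / 6 := by
  have hpi := Real.pi_pos
  have s1 := pi_div_four_lt_sigma
  have s2 := sigma_lt_pi_div_three
  rcases i with n | n
  · have hn : n.1.natAbs ≤ N := h
    have h1 : ((n : ℤ) : ℝ) ≤ N := by exact_mod_cast (by omega : (n : ℤ) ≤ N)
    have h2 : -(N : ℝ) ≤ ((n : ℤ) : ℝ) := by exact_mod_cast (by omega : -(N : ℤ) ≤ n)
    simp only [specCenter]
    rw [abs_le]
    constructor <;> nlinarith
  · have hn : n ≤ N := h
    have hn' : (n : ℝ) ≤ N := by exact_mod_cast hn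
    rcases eq_or_ne n 0 with rfl | h0
    · simp only [specCenter]
      rw [abs_le]
      have : (0 : ℝ) ≤ N := Nat.cast_nonneg N
      constructor <;> nlinarith
    · rw [specCenter_inr h0, abs_of_nonneg (by positivity)]
      nlinarith

theorem le_abs_specCenter {N : ℕ} {i : SpecIndex} (h : i ∉ smallIndex N) :
    Real.pi * (N + 1 / 2) + Real.pi / 6 ≤ |specCenter i| := by
  have hpi := Real.pi_pos
  have s1 := pi_div_four_lt_sigma
  have s2 := sigma_lt_pi_div_three
  rcases i with n | n
  · have hn : ¬ n.1.natAbs ≤ N := h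
    simp only [specCenter]
    rcases le_or_gt 0 n.1 with h0 | h0
    · have h1 : (N : ℝ) + 1 ≤ ((n : ℤ) : ℝ) := by exact_mod_cast (by omega : (N : ℤ) + 1 ≤ n)
      exact le_abs.2 (Or.inl (by nlinarith))
    · have h1 : ((n : ℤ) : ℝ) ≤ -(N + 1) := by exact_mod_cast (by omega : (n : ℤ) ≤ -(N + 1))
      exact le_abs.2 (Or.inr (by nlinarith))
  · have hn : ¬ n ≤ N := h
    have hn' : (N : ℝ) + 1 ≤ n := by exact_mod_cast (by omega : N + 1 ≤ n)
    rw [specCenter_inr (by omega)]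
    exact le_abs.2 (Or.inl (by nlinarith))

theorem specCenter_ne_zero (i : SpecIndex) : specCenter i ≠ 0 := by
  have hpi := Real.pi_pos
  have s1 := pi_div_four_lt_sigma
  have s2 := sigma_lt_pi_div_three
  rcases i with n | n
  · have := le_abs_int_mul_pi_add (δ := sigma) (c := Real.pi / 6) (by linarith) (by linarith) n
    intro h
    rw [show ((n : ℤ) : ℝ) * Real.pi + sigma = 0 from h, abs_zero] at this
    linarith
  · rcases eq_or_ne n 0 with rfl | h0
    · simp only [specCenter]; linarith
    · rw [specCenter_inr h0]; positivity

/-- One representative of each pair ±b suffices, since πk − σ = −(π(−k) + σ). -/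
theorem exists_specCenter {b : ℝ} (hb : b ∈ mainZeros) (h0 : b ≠ 0) :
    ∃ i, b = specCenter i ∨ b = -specCenter i := by
  have hplus : ∀ k : ℤ, ∃ i, k * Real.pi + sigma = specCenter i := fun k => by
    rcases eq_or_ne k 0 with rfl | hk
    · exact ⟨.inr 0, by simp [specCenter]⟩
    · exact ⟨.inl ⟨k, hk⟩, rfl⟩
  obtain ⟨k, rfl | rfl | rfl⟩ := hb
  · have hk : k ≠ 0 := by rintro rfl; simp at h0
    refine ⟨.inr k.natAbs, ?_⟩
    rw [specCenter_inr (by omega)]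
    have : ((k.natAbs : ℕ) : ℝ) = |(k : ℝ)| := by rw [Nat.cast_natAbs, Int.cast_abs]
    rw [this]
    rcases abs_choice (k : ℝ) with h | h
    · left; rw [h]
    · right; rw [h]; ring
  · obtain ⟨i, hi⟩ := hplus k
    exact ⟨i, Or.inl hi⟩
  · obtain ⟨i, hi⟩ := hplus (-k)
    exact ⟨i, Or.inr (by rw [← hi]; push_cast; ring)⟩

theorem specCenter_inj {i j : SpecIndex} (h : specCenter i = specCenter j ∨
    specCenter i = -specCenter j) : i = j := by
  have hpi := Real.pi_pos
  have s1 := pi_div_four_lt_sigma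
  have s2 := sigma_lt_pi_div_three
  have hδ : ∀ (j : ℤ) (δ : ℝ), Real.pi / 6 ≤ δ → δ ≤ Real.pi - Real.pi / 6 →
      j * Real.pi + δ ≠ 0 := fun j δ h1 h2 h => by
    have := le_abs_int_mul_pi_add h1 h2 j
    rw [h, abs_zero] at this
    linarith
  -- Returning `.inr 0` to the family kπ + σ leaves two uniform families; their mixed sums and
  -- differences are congruent to ±σ or 2σ modulo π, hence nonzero.
  have hform : ∀ i : SpecIndex, (∃ k : ℤ, specCenter i = k * Real.pi + sigma ∧
      i = if hk : k = 0 then .inr 0 else .inl ⟨k, hk⟩) ∨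
      ∃ n : ℕ, n ≠ 0 ∧ specCenter i = (n : ℤ) * Real.pi ∧ i = .inr n := by
    rintro (n | n)
    · exact Or.inl ⟨n, rfl, by simp [n.2]⟩
    · rcases eq_or_ne n 0 with rfl | h0
      · exact Or.inl ⟨0, by simp [specCenter], by simp⟩
      · exact Or.inr ⟨n, h0, by rw [specCenter_inr h0]; simp, rfl⟩
  rcases hform i with ⟨k, hk, hi⟩ | ⟨k, hk0, hk, hi⟩ <;>
    rcases hform j with ⟨l, hl, hj⟩ | ⟨l, hl0, hl, hj⟩ <;> rw [hk, hl] at h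
  · rcases h with h | h
    · have : (k : ℝ) = l := mul_right_cancel₀ hpi.ne' (by linarith)
      have : k = l := by exact_mod_cast this
      subst this
      rw [hi, hj]
    · exact absurd (by push_cast; linarith)
        (hδ (k + l) (2 * sigma) (by linarith) (by linarith))
  · rcases h with h | h
    · exact absurd (by push_cast at h ⊢; linarith) (hδ (k - l) sigma (by linarith) (by linarith))
    · exact absurd (by push_cast at h ⊢; linarith) (hδ (k + l) sigma (by linarith) (by linarith))
  · rcases h with h | h
    · exact absurd (by push_cast at h ⊢; linarith) (hδ (l - k) sigma (by linarith) (by linarith))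
    · exact absurd (by push_cast at h ⊢; linarith) (hδ (k + l) sigma (by linarith) (by linarith))
  · rcases h with h | h
    · have h1 : ((k : ℤ) : ℝ) = (l : ℤ) := mul_right_cancel₀ hpi.ne' h
      rw [hi, hj]
      congr 1
      exact_mod_cast h1
    · have h1 : ((k : ℤ) : ℝ) = -((l : ℤ) : ℝ) := mul_right_cancel₀ hpi.ne' (by linarith)
      have h2 : (k : ℤ) = -(l : ℤ) := by exact_mod_cast h1
      omega

/-! ### Enumeration and localization of the zeros -/

theorem exists_eq_multiset_map {I : Type*} [DecidableEq I] (F : Finset I) (s : Multiset ℂ)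
    (h : s.card = F.card) : ∃ f : I → ℂ, F.val.map f = s := by
  induction F using Finset.induction_on generalizing s with
  | empty => exact ⟨0, by simpa [eq_comm] using h⟩
  | insert a F ha ih =>
    rw [Finset.card_insert_of_notMem ha] at h
    obtain ⟨b, s', rfl⟩ : ∃ b s', s = b ::ₘ s' := by
      obtain ⟨b, hb⟩ := Multiset.card_pos_iff_exists_mem.1 (by omega : 0 < s.card)
      obtain ⟨s', hs'⟩ := Multiset.exists_cons_of_mem hb
      exact ⟨b, s', hs'⟩
    obtain ⟨f, hf⟩ := ih s' (by simpa using h)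
    refine ⟨Function.update f a b, ?_⟩
    rw [Finset.insert_val_of_notMem ha, Multiset.map_cons, Function.update_self, ← hf]
    congr 1
    refine Multiset.map_congr rfl fun x hx => ?_
    rw [Function.update_of_ne]
    rintro rfl
    exact ha hx

/-- Combine finitely many points listed in a multiset with a family of simple points. -/
theorem exists_enumeration {I : Type*} [DecidableEq I] (m : ℂ → ℕ∞) (F : Finset I) (B : Set ℂ)
    (s : Multiset ℂ) (hs : s.card = F.card) (hsB : ∀ z ∈ s, z ∈ B)
    (hm : ∀ z ∈ B, m z = s.count z) (e₀ : I → ℂ) (hinj : ∀ i ∉ F, ∀ j ∉ F, e₀ i = e₀ j → i = j)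
    (hB : ∀ i ∉ F, e₀ i ∉ B) (hone : ∀ i ∉ F, m (e₀ i) = 1)
    (hsurj : ∀ z ∉ B, m z ≠ 0 → ∃ i ∉ F, e₀ i = z) :
    ∃ e : I → ℂ, (∀ i ∉ F, e i = e₀ i) ∧ ∀ z, {i | e i = z}.encard = m z := by
  obtain ⟨f, hf⟩ := exists_eq_multiset_map F s hs
  have hfB : ∀ i ∈ F, f i ∈ B := fun i hi => hsB _ (hf ▸ Multiset.mem_map_of_mem f hi)
  refine ⟨fun i => if i ∈ F then f i else e₀ i, fun i hi => if_neg hi, fun z => ?_⟩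
  by_cases hz : z ∈ B
  · have e1 : {i | (if i ∈ F then f i else e₀ i) = z} = ((F.filter fun i => z = f i : Finset I) : Set I) := by
      ext i
      simp only [mem_ofPred_eq, Finset.coe_filter]
      by_cases hi : i ∈ F
      · simp [hi, eq_comm]
      · simp only [hi, if_false, false_and, iff_false]
        rintro rfl
        exact hB i hi hz
    rw [e1, Set.encard_coe_eq_coe_finsetCard, hm z hz, ← hf, Multiset.count_map]
    rfl
  · have e1 : {i | (if i ∈ F then f i else e₀ i) = z} = {i | i ∉ F ∧ e₀ i = z} := by
      ext i
      simp only [mem_ofPred_eq]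
      by_cases hi : i ∈ F
      · simp only [hi, if_true, not_true, false_and, iff_false]
        rintro rfl
        exact hz (hfB i hi)
      · simp [hi]
    rw [e1]
    by_cases h0 : m z = 0
    · rw [h0, Set.encard_eq_zero, Set.eq_empty_iff_forall_notMem]
      rintro i ⟨hi, rfl⟩
      rw [hone i hi] at h0
      exact one_ne_zero h0
    · obtain ⟨i, hi, rfl⟩ := hsurj z hz h0
      rw [hone i hi, Set.encard_eq_one]
      refine ⟨i, Set.eq_singleton_iff_unique_mem.2 ⟨⟨hi, rfl⟩, fun j hj => ?_⟩⟩
      exact hinj j hj.1 i hi hj.2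

section

variable {D : ℂ → ℂ}

/-- `z D(z²)` is dominated by `mainPart` far from its zeros, outside of a disc. -/
def NearMainPart (D : ℂ → ℂ) (R₀ : ℝ) : Prop :=
  ∀ z, IsFar z → R₀ ≤ ‖z‖ → ‖z * D (z ^ 2) - mainPart z‖ < ‖mainPart z‖

theorem exists_nearMainPart {q₂ q₃ : ℝ → ℂ} (hq₂ : Integrable q₂) (hq₃ : Integrable q₃) :
    ∃ R₀ : ℝ, NearMainPart (charFun₁ q₂ q₃) R₀ := by
  obtain ⟨M, hM, h⟩ := exists_norm_subPart_le hq₂ hq₃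
  -- For |z| ≥ 2000M the correction is at most exp(3|Im z|)/4000, below the lower bound 3/8000 for
  -- the main part.
  refine ⟨2000 * M, fun z hz hR => ?_⟩
  have hzpos : 0 < ‖z‖ := lt_of_lt_of_le (by positivity) hR
  rw [mul_charFun₁_sq hq₂ hq₃ (norm_pos_iff.1 hzpos), add_sub_cancel_left]
  refine lt_of_lt_of_le ?_ hz.le_norm_mainPart
  rw [norm_div, norm_mul, Complex.norm_ofNat, div_lt_iff₀ (by positivity)]
  have h1 : Real.exp (2 * |z.im|) ≤ Real.exp (3 * |z.im|) :=
    Real.exp_le_exp.2 (by linarith [abs_nonneg z.im])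
  have h2 := (h z).trans (mul_le_mul_of_nonneg_left h1 hM.le)
  have h3 := Real.exp_pos (3 * |z.im|)
  nlinarith [mul_pos hM h3, mul_le_mul_of_nonneg_left hR h3.le]

theorem isFar_of_mem_sphere {a : ℝ} (ha : a ∈ mainZeros) {z : ℂ}
    (hz : z ∈ Metric.sphere (a : ℂ) (1 / 4)) : IsFar z := by
  refine isFar_of_forall fun b hb => ?_
  have hz' : ‖z - a‖ = 1 / 4 := by rw [← dist_eq_norm]; exact hz
  rcases mainZeros_separated ha hb with rfl | h
  · exact hz'.ge
  · have h1 : ‖(a : ℂ) - b‖ ≤ ‖z - b‖ + ‖z - a‖ := by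
      rw [norm_sub_rev z a, add_comm]; exact norm_sub_le_norm_sub_add_norm_sub _ _ _
    rw [← Complex.ofReal_sub, Complex.norm_real, Real.norm_eq_abs] at h1
    linarith [half_lt_pi_div_six]

/-- The moduli of all centers differ from π(N + 1/2) by at least π/6, so these circles pass between
them. -/
theorem isFar_of_norm_eq {N : ℕ} {z : ℂ} (hz : ‖z‖ = Real.pi * (N + 1 / 2)) : IsFar z := by
  refine isFar_of_forall fun b hb => ?_
  have h1 : abs (‖z‖ - |b|) ≤ ‖z - b‖ := by
    have := abs_norm_sub_norm_le z (b : ℂ)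
    rwa [Complex.norm_real, Real.norm_eq_abs] at this
  refine le_trans ?_ h1
  rw [hz]
  have hpi := half_lt_pi_div_six
  rcases eq_or_ne b 0 with rfl | h0
  · rw [abs_zero, sub_zero]
    have : (0 : ℝ) ≤ N := Nat.cast_nonneg N
    exact le_abs.2 (Or.inl (by nlinarith))
  · obtain ⟨i, hi⟩ := exists_specCenter hb h0
    have hb' : |b| = |specCenter i| := by rcases hi with rfl | rfl <;> simp
    rw [hb']
    by_cases h : i ∈ smallIndex N
    · exact le_abs.2 (Or.inl (by linarith [abs_specCenter_le h]))
    · exact le_abs.2 (Or.inr (by linarith [le_abs_specCenter h]))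

/-- Rouché on the disc of radius 1/4, where the main part has just the simple zero a. The condition
|a| ≥ 1/4 keeps r away from 0, so simplicity passes from z to λ = z². -/
theorem exists_simple_zero_near (hD : Differentiable ℂ D) {R₀ : ℝ} (h : NearMainPart D R₀) {a : ℝ}
    (ha : a ∈ mainZeros) (haR : R₀ + 1 / 4 ≤ |a|) (ha1 : 1 / 4 ≤ |a|) :
    ∃ r : ℂ, ‖r - a‖ < 1 / 4 ∧ r * D (r ^ 2) = 0 ∧ analyticOrderAt D (r ^ 2) = 1 ∧
      ∀ z : ℂ, ‖z - a‖ < 1 / 4 → z * D (z ^ 2) = 0 → z = r := by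
  have hH := hD.mul_comp_sq
  obtain ⟨s, t, hst, hs, ht, hsc, htc⟩ := hH.rouche differentiable_mainPart (c := a) (R := 1 / 4)
    (by norm_num) fun z hz => h z (isFar_of_mem_sphere ha hz) (by
      have hz' : ‖z - a‖ = 1 / 4 := by rw [← dist_eq_norm]; exact hz
      have := norm_sub_norm_le (a : ℂ) z
      rw [norm_sub_rev, hz', Complex.norm_real, Real.norm_eq_abs] at this
      linarith)
  have hat : t = {(a : ℂ)} := by
    ext z
    by_cases hz : z ∈ Metric.ball (a : ℂ) (1 / 4)
    · have h1 := htc z hz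
      by_cases hza : z = a
      · subst hza
        rw [analyticOrderAt_mainPart (mainPart_eq_zero_iff.2 ⟨a, ha, rfl⟩)] at h1
        rw [Multiset.count_singleton_self]
        exact_mod_cast h1.symm
      · rw [Multiset.count_singleton, if_neg hza]
        have : mainPart z ≠ 0 := fun h0 => by
          obtain ⟨b, hb, rfl⟩ := mainPart_eq_zero_iff.1 h0
          rcases mainZeros_separated hb ha with rfl | h2
          · exact hza rfl
          · rw [Metric.mem_ball, dist_eq_norm, ← Complex.ofReal_sub, Complex.norm_real,
              Real.norm_eq_abs] at hz
            linarith [half_lt_pi_div_six]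
        rw [analyticOrderAt_eq_zero.2 (Or.inr this)] at h1
        exact_mod_cast h1.symm
    · rw [Multiset.count_eq_zero_of_notMem fun h1 => hz (ht z h1),
        Multiset.count_eq_zero_of_notMem]
      rintro h1
      rw [Multiset.mem_singleton.1 h1] at hz
      exact hz (Metric.mem_ball_self (by norm_num))
  rw [hat, Multiset.card_singleton, Multiset.card_eq_one] at hst
  obtain ⟨r, rfl⟩ := hst
  have hr := hs r (Multiset.mem_singleton_self r)
  have hr' : ‖r - a‖ < 1 / 4 := by rw [← dist_eq_norm]; exact hr
  have hord := hsc r hr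
  rw [Multiset.count_singleton_self] at hord
  have hr0 : r ≠ 0 := by
    rintro rfl
    rw [zero_sub, norm_neg, Complex.norm_real, Real.norm_eq_abs] at hr'
    linarith
  refine ⟨r, hr', ?_, ?_, fun z hz h0 => ?_⟩
  · exact apply_eq_zero_of_analyticOrderAt_ne_zero (f := fun z => z * D (z ^ 2)) (by simp [hord])
  · rw [← analyticOrderAt_mul_comp_sq hD hr0, hord]; rfl
  · have h1 := hsc z (by rw [Metric.mem_ball, dist_eq_norm]; exact hz)
    by_contra hne
    rw [Multiset.count_singleton, if_neg hne] at h1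
    exact (hH.analyticAt z).analyticOrderAt_eq_zero.1 (by simpa using h1) h0

/-- Rouché is applied in the λ-plane, after dividing the inequality by |z|: this avoids the spurious
zero z = 0 and the double count of ±z. The free eigenvalues in the disc are simple and correspond to
`smallIndex N`. -/
theorem exists_zeros_in_disc (hD : Differentiable ℂ D) {R₀ : ℝ} (h : NearMainPart D R₀) {N : ℕ}
    (hN : R₀ ≤ Real.pi * (N + 1 / 2)) :
    ∃ s : Multiset ℂ, s.card = (finite_smallIndex N).toFinset.card ∧
      (∀ z ∈ s, ‖z‖ < (Real.pi * (N + 1 / 2)) ^ 2) ∧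
      ∀ z : ℂ, ‖z‖ < (Real.pi * (N + 1 / 2)) ^ 2 → analyticOrderAt D z = s.count z := by
  have hpi := Real.pi_pos
  set R : ℝ := Real.pi * (N + 1 / 2) with hR
  have hRpos : 0 < R := by positivity
  have hball : ∀ z : ℂ, z ∈ Metric.ball (0 : ℂ) (R ^ 2) ↔ ‖z‖ < R ^ 2 := fun z => by simp
  obtain ⟨s, t, hst, hs, ht, hsc, htc⟩ := hD.rouche differentiable_freeCharFun (c := 0)
    (R := R ^ 2) (by positivity) fun lam hlam => by
      obtain ⟨z, rfl⟩ := exists_eq_sq lam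
      have hz : ‖z‖ = R := by
        rw [mem_sphere_zero_iff_norm, norm_pow] at hlam
        exact (pow_left_inj₀ (norm_nonneg _) hRpos.le two_ne_zero).1 hlam
      have h1 := h z (isFar_of_norm_eq hz) (hz ▸ hN)
      rw [← mul_freeCharFun_sq, ← mul_sub, norm_mul, norm_mul] at h1
      exact lt_of_mul_lt_mul_left h1 (norm_nonneg _)
  refine ⟨s, ?_, fun z hz => (hball z).1 (hs z hz), fun z hz => hsc z ((hball z).2 hz)⟩
  have hfree : ∀ lam : ℂ, freeCharFun lam = 0 ↔ ∃ i, lam = (specCenter i : ℂ) ^ 2 := by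
    intro lam
    constructor
    · intro h0
      obtain ⟨z, rfl⟩ := exists_eq_sq lam
      have hz0 : z ≠ 0 := by
        rintro rfl
        rw [zero_pow two_ne_zero, freeCharFun_zero] at h0
        exact two_ne_zero h0
      obtain ⟨b, hb, rfl⟩ := mainPart_eq_zero_iff.1
        (by rw [← mul_freeCharFun_sq, h0, mul_zero] : mainPart z = 0)
      obtain ⟨i, rfl | rfl⟩ := exists_specCenter hb (by simpa using hz0)
      · exact ⟨i, rfl⟩
      · exact ⟨i, by simp⟩
    · rintro ⟨i, rfl⟩
      have h1 := mul_freeCharFun_sq (specCenter i)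
      rw [mainPart_eq_zero_iff.2 ⟨_, specCenter_mem i, rfl⟩] at h1
      exact (mul_eq_zero.1 h1).resolve_left (by simpa using specCenter_ne_zero i)
  have hsimple : ∀ i, analyticOrderAt freeCharFun ((specCenter i : ℂ) ^ 2) = 1 := fun i => by
    rw [← analyticOrderAt_mul_comp_sq differentiable_freeCharFun
      (by simpa using specCenter_ne_zero i : (specCenter i : ℂ) ≠ 0)]
    simp only [mul_freeCharFun_sq]
    exact analyticOrderAt_mainPart (mainPart_eq_zero_iff.2 ⟨_, specCenter_mem i, rfl⟩)
  have hsmall : ∀ i, ‖(specCenter i : ℂ) ^ 2‖ < R ^ 2 ↔ i ∈ smallIndex N := fun i => by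
    rw [norm_pow, Complex.norm_real, Real.norm_eq_abs,
      pow_lt_pow_iff_left₀ (abs_nonneg _) hRpos.le two_ne_zero]
    refine ⟨fun h1 => ?_, fun h1 => by linarith [abs_specCenter_le h1]⟩
    by_contra h2
    linarith [le_abs_specCenter h2]
  have hinj : Injective fun i => (specCenter i : ℂ) ^ 2 := fun i j hij => by
    refine specCenter_inj ?_
    have hij' : (specCenter i : ℂ) ^ 2 = (specCenter j : ℂ) ^ 2 := hij
    have : specCenter i ^ 2 = specCenter j ^ 2 := by exact_mod_cast hij'
    exact sq_eq_sq_iff_eq_or_eq_neg.1 this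
  have htT : t = (finite_smallIndex N).toFinset.val.map fun i => (specCenter i : ℂ) ^ 2 := by
    have hnd : ((finite_smallIndex N).toFinset.val.map fun i => (specCenter i : ℂ) ^ 2).Nodup :=
      (Finset.nodup _).map hinj
    ext z
    by_cases hz : z ∈ (finite_smallIndex N).toFinset.val.map fun i => (specCenter i : ℂ) ^ 2
    · rw [Multiset.count_eq_one_of_mem hnd hz]
      obtain ⟨i, hi, rfl⟩ := Multiset.mem_map.1 hz
      have hi' := (hsmall i).2 ((finite_smallIndex N).mem_toFinset.1 hi)
      have := htc _ ((hball _).2 hi')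
      rw [hsimple] at this
      exact_mod_cast this.symm
    · rw [Multiset.count_eq_zero_of_notMem hz, Multiset.count_eq_zero]
      intro hzt
      have hzb := ht z hzt
      have h1 := htc z hzb
      have h2 : freeCharFun z = 0 := by
        refine apply_eq_zero_of_analyticOrderAt_ne_zero ?_
        rw [h1]
        exact_mod_cast (Multiset.count_pos.2 hzt).ne'
      obtain ⟨i, rfl⟩ := (hfree z).1 h2
      exact hz (Multiset.mem_map_of_mem _
        ((finite_smallIndex N).mem_toFinset.2 ((hsmall i).1 ((hball _).1 hzb))))
  rw [hst, htT, Multiset.card_map]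
  rfl

/-- The zeros of `D` with their multiplicities, indexed as the zeros of the free problem. -/
theorem exists_spectral_enumeration (hD : Differentiable ℂ D) {R₀ : ℝ} (h : NearMainPart D R₀) :
    ∃ (N : ℕ) (e r : SpecIndex → ℂ), (∀ z, {i | e i = z}.encard = analyticOrderAt D z) ∧
      ∀ i ∉ smallIndex N, e i = r i ^ 2 ∧ ‖r i - specCenter i‖ < 1 / 4 ∧
        r i * D (r i ^ 2) = 0 := by
  have hpi := half_lt_pi_div_six
  obtain ⟨N, hN⟩ := exists_nat_ge R₀
  have hNR : R₀ ≤ Real.pi * (N + 1 / 2) := by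
    have : (0 : ℝ) ≤ N := Nat.cast_nonneg N
    nlinarith
  set R : ℝ := Real.pi * (N + 1 / 2) with hR
  have hRpos : 1 / 2 < R := by
    have : (0 : ℝ) ≤ N := Nat.cast_nonneg N
    nlinarith
  obtain ⟨s, hs, hsB, hsc⟩ := exists_zeros_in_disc hD h hNR
  have hex : ∀ i, ∃ r : ℂ, i ∉ smallIndex N → ‖r - specCenter i‖ < 1 / 4 ∧ r * D (r ^ 2) = 0 ∧
      analyticOrderAt D (r ^ 2) = 1 ∧
      ∀ z : ℂ, ‖z - specCenter i‖ < 1 / 4 → z * D (z ^ 2) = 0 → z = r := fun i => by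
    by_cases hi : i ∈ smallIndex N
    · exact ⟨0, fun h1 => absurd hi h1⟩
    · have h1 := le_abs_specCenter hi
      obtain ⟨r, hr⟩ := exists_simple_zero_near hD h (specCenter_mem i) (by linarith)
        (by linarith)
      exact ⟨r, fun _ => hr⟩
  choose r hr using hex
  have hmem : ∀ i, i ∉ (finite_smallIndex N).toFinset ↔ i ∉ smallIndex N := fun i => by simp
  have hrR : ∀ i ∉ smallIndex N, R ≤ ‖r i‖ := fun i hi => by
    have h1 := norm_sub_norm_le (specCenter i : ℂ) (r i)
    rw [norm_sub_rev, Complex.norm_real, Real.norm_eq_abs] at h1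
    linarith [(hr i hi).1, le_abs_specCenter hi]
  -- If rᵢ = ±rⱼ, the centers agree up to that sign within 1/2 < π/6, so they coincide up to sign.
  have hinj : ∀ i ∉ (finite_smallIndex N).toFinset, ∀ j ∉ (finite_smallIndex N).toFinset,
      r i ^ 2 = r j ^ 2 → i = j := by
    intro i hi j hj hij
    rw [hmem] at hi hj
    have hri := (hr i hi).1
    have hrj := (hr j hj).1
    refine specCenter_inj ?_
    rcases sq_eq_sq_iff_eq_or_eq_neg.1 hij with h1 | h1
    · left
      refine (mainZeros_separated (specCenter_mem i) (specCenter_mem j)).resolve_right fun h2 => ?_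
      have h3 : ‖((specCenter i - specCenter j : ℝ) : ℂ)‖ ≤ 1 / 2 := by
        have : ((specCenter i - specCenter j : ℝ) : ℂ)
            = (r j - specCenter j) - (r i - specCenter i) := by push_cast; rw [h1]; ring
        rw [this]
        exact (norm_sub_le _ _).trans (by linarith)
      rw [Complex.norm_real, Real.norm_eq_abs] at h3
      linarith
    · right
      refine (mainZeros_separated (specCenter_mem i)
        (neg_mem_mainZeros (specCenter_mem j))).resolve_right fun h2 => ?_
      have h3 : ‖((specCenter i - -specCenter j : ℝ) : ℂ)‖ ≤ 1 / 2 := by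
        have : ((specCenter i - -specCenter j : ℝ) : ℂ)
            = -((r j - specCenter j) + (r i - specCenter i)) := by push_cast; rw [h1]; ring
        rw [this, norm_neg]
        exact (norm_add_le _ _).trans (by linarith)
      rw [Complex.norm_real, Real.norm_eq_abs] at h3
      linarith
  have hout : ∀ i ∉ (finite_smallIndex N).toFinset, r i ^ 2 ∉ {z : ℂ | ‖z‖ < R ^ 2} := by
    intro i hi
    rw [hmem] at hi
    simp only [mem_ofPred_eq, norm_pow, not_lt]
    exact pow_le_pow_left₀ (by linarith) (hrR i hi) 2
  have hone : ∀ i ∉ (finite_smallIndex N).toFinset, analyticOrderAt D (r i ^ 2) = 1 := by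
    intro i hi
    exact (hr i ((hmem i).1 hi)).2.2.1
  -- At a zero outside the disc the strict domination fails, so z is within 1/4 of a zero ±center of
  -- the main part; replacing z by −z fixes the sign without changing λ.
  have hsurj : ∀ z ∉ {z : ℂ | ‖z‖ < R ^ 2}, analyticOrderAt D z ≠ 0 →
      ∃ i ∉ (finite_smallIndex N).toFinset, r i ^ 2 = z := by
    intro lam hlam h0
    simp only [mem_ofPred_eq, not_lt] at hlam
    have hDz := apply_eq_zero_of_analyticOrderAt_ne_zero h0
    obtain ⟨z, rfl⟩ := exists_eq_sq lam
    have hzR : R ≤ ‖z‖ := by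
      rw [norm_pow] at hlam
      exact (pow_le_pow_iff_left₀ (by linarith) (norm_nonneg _) two_ne_zero).1 hlam
    have hnf : ¬ IsFar z := fun hf => by
      have := h z hf (hNR.trans hzR)
      rw [hDz, mul_zero, zero_sub, norm_neg] at this
      exact lt_irrefl _ this
    obtain ⟨b, hb, hbz⟩ : ∃ b ∈ mainZeros, ‖z - (b : ℂ)‖ < 1 / 4 := by
      by_contra! hcon
      exact hnf (isFar_of_forall hcon)
    have hbR : R - 1 / 4 < |b| := by
      have := norm_sub_norm_le z (b : ℂ)
      rw [Complex.norm_real, Real.norm_eq_abs] at this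
      linarith
    obtain ⟨i, hi⟩ := exists_specCenter hb (fun h1 => by rw [h1, abs_zero] at hbR; linarith)
    have hi' : i ∉ smallIndex N := fun h1 => by
      have h2 := abs_specCenter_le h1
      have h3 : |b| = |specCenter i| := by rcases hi with rfl | rfl <;> simp
      linarith
    refine ⟨i, (hmem i).2 hi', ?_⟩
    rcases hi with rfl | rfl
    · rw [← (hr i hi').2.2.2 z hbz (by rw [hDz, mul_zero])]
    · rw [← (hr i hi').2.2.2 (-z) ?_ (by rw [neg_sq, hDz, mul_zero]), neg_sq]
      rw [← norm_neg]
      have : -(-z - (specCenter i : ℂ)) = z - ((-specCenter i : ℝ) : ℂ) := by push_cast; ring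
      rwa [this]
  obtain ⟨e, he, hcount⟩ := exists_enumeration (fun z => analyticOrderAt D z)
    (finite_smallIndex N).toFinset {z : ℂ | ‖z‖ < R ^ 2} s hs hsB hsc (fun i => r i ^ 2)
    hinj hout hone hsurj
  exact ⟨N, e, r, hcount, fun i hi => ⟨he i ((hmem i).2 hi), (hr i hi).1, (hr i hi).2.1⟩⟩

end

/-! ### Asymptotics of the zeros -/

theorem Complex.sin_add_int_mul_pi (z : ℂ) (n : ℤ) :
    Complex.sin (z + n * Real.pi) = (-1) ^ n * Complex.sin z :=
  n.cast_negOnePow ℂ ▸ Complex.sin_antiperiodic.add_int_mul_eq n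

theorem Complex.cos_add_int_mul_pi (z : ℂ) (n : ℤ) :
    Complex.cos (z + n * Real.pi) = (-1) ^ n * Complex.cos z :=
  n.cast_negOnePow ℂ ▸ Complex.cos_antiperiodic.add_int_mul_eq n

theorem mainPart_add_int_mul_pi (z : ℂ) (n : ℤ) :
    mainPart (z + n * Real.pi) = (-1) ^ n * mainPart z := by
  have h : ((-1 : ℂ) ^ n) ^ 2 = 1 := by rw [← zpow_natCast, zpow_comm, zpow_natCast]; simp
  rw [mainPart, mainPart, Complex.sin_add_int_mul_pi, Complex.cos_add_int_mul_pi, mul_pow, h]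
  ring

/-- Linearization of the main part at one of its zeros. -/
theorem exists_linear_bounds_mainPart {θ : ℝ} (hθ : mainPart θ = 0) {g : ℂ}
    (hg : HasDerivAt mainPart g θ) (hg0 : g ≠ 0) :
    ∃ C : ℝ, 0 ≤ C ∧ ∀ z : ℂ, ‖z - θ‖ ≤ 1 / 4 →
      ‖z - θ‖ ≤ C * ‖mainPart z‖ ∧ ‖mainPart z - g * (z - θ)‖ ≤ C * ‖z - θ‖ ^ 2 := by
  -- The quotient F/(z − θ). Its inverse controls z − θ by F; its own divided difference controls
  -- the quadratic error.
  set h := dslope mainPart (θ : ℂ) with hh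
  have hd : Differentiable ℂ h := by
    rw [← differentiableOn_univ, hh, Complex.differentiableOn_dslope univ_mem,
      differentiableOn_univ]
    exact differentiable_mainPart
  have hd2 : Differentiable ℂ (dslope h (θ : ℂ)) := by
    rw [← differentiableOn_univ, Complex.differentiableOn_dslope univ_mem, differentiableOn_univ]
    exact hd
  have hhθ : h θ = g := by rw [hh, dslope_same, hg.deriv]
  have hfac : ∀ z, mainPart z = (z - θ) * h z := fun z => by
    have := sub_smul_dslope mainPart (θ : ℂ) z
    rw [hθ, sub_zero, smul_eq_mul] at this
    exact this.symm
  have hfac2 : ∀ z, h z - g = (z - θ) * dslope h (θ : ℂ) z := fun z => by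
    have := sub_smul_dslope h (θ : ℂ) z
    rw [hhθ, smul_eq_mul] at this
    exact this.symm
  -- Another zero in this disc would be closer to θ than π/6.
  have hne : ∀ z ∈ Metric.closedBall (θ : ℂ) (1 / 4), h z ≠ 0 := fun z hz h0 => by
    rw [mem_closedBall_iff_norm] at hz
    by_cases hzθ : z = θ
    · rw [hzθ, hhθ] at h0; exact hg0 h0
    obtain ⟨b, hb, rfl⟩ := mainPart_eq_zero_iff.1 (by rw [hfac, h0, mul_zero] : mainPart z = 0)
    obtain ⟨a, ha, hab⟩ := mainPart_eq_zero_iff.1 hθ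
    obtain rfl : θ = a := Complex.ofReal_injective hab
    rw [← Complex.ofReal_sub, Complex.norm_real, Real.norm_eq_abs] at hz
    rcases mainZeros_separated hb ha with rfl | h1
    · exact hzθ rfl
    · linarith [half_lt_pi_div_six]
  obtain ⟨C₁, hC₁⟩ := (isCompact_closedBall (θ : ℂ) (1 / 4)).exists_bound_of_continuousOn
    (hd.continuous.continuousOn.inv₀ hne)
  obtain ⟨C₂, hC₂⟩ := (isCompact_closedBall (θ : ℂ) (1 / 4)).exists_bound_of_continuousOn
    hd2.continuous.continuousOn
  refine ⟨max 0 (max C₁ C₂), le_max_left _ _, fun z hz => ?_⟩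
  have hz' : z ∈ Metric.closedBall (θ : ℂ) (1 / 4) := mem_closedBall_iff_norm.2 hz
  constructor
  · have e : z - θ = (h z)⁻¹ * mainPart z := by
      rw [hfac]; field_simp [hne z hz']
    conv_lhs => rw [e, norm_mul]
    exact mul_le_mul_of_nonneg_right ((hC₁ z hz').trans (by simp)) (norm_nonneg _)
  · have e : mainPart z - g * (z - θ) = dslope h (θ : ℂ) z * (z - θ) ^ 2 := by
      rw [hfac]; linear_combination (z - θ) * hfac2 z
    rw [e, norm_mul, norm_pow]
    exact mul_le_mul_of_nonneg_right ((hC₂ z hz').trans (by simp)) (by positivity)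

/-- Cauchy's estimate on circles of radius 1/4 inside the strip |Im z| ≤ 1/2, where `subPart` is
bounded. Holomorphy off 0 is read from the identity with `charFun₁`; |a| ≥ 1 keeps all the discs off
0. -/
theorem exists_lipschitz_subPart {q₂ q₃ : ℝ → ℂ} (hq₂ : IsPotential q₂) (hq₃ : IsPotential q₃) :
    ∃ L : ℝ, 0 ≤ L ∧ ∀ a : ℝ, 1 ≤ |a| → ∀ z : ℂ, ‖z - a‖ ≤ 1 / 4 →
      ‖subPart q₂ q₃ z‖ ≤ L ∧ ‖subPart q₂ q₃ z - subPart q₂ q₃ a‖ ≤ L * ‖z - a‖ := by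
  obtain ⟨M, hM, hS⟩ := exists_norm_subPart_le hq₂.integrable hq₃.integrable
  have hdiff : DifferentiableOn ℂ (subPart q₂ q₃) {0}ᶜ := by
    have h1 : DifferentiableOn ℂ
        (fun z => 2 * z * (z * charFun₁ q₂ q₃ (z ^ 2) - mainPart z)) {0}ᶜ :=
      (((differentiable_const _).mul differentiable_id).mul
        ((differentiable_charFun₁ hq₂ hq₃).mul_comp_sq.sub differentiable_mainPart)).differentiableOn
    refine h1.congr fun z hz => ?_
    rw [mul_charFun₁_sq hq₂.integrable hq₃.integrable hz]
    field_simp [show z ≠ 0 from hz]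
    ring
  have hstrip : ∀ (a : ℝ) (z : ℂ), ‖z - a‖ ≤ 1 / 2 → ‖subPart q₂ q₃ z‖ ≤ M * Real.exp 1 := by
    intro a z hz
    refine (hS z).trans (mul_le_mul_of_nonneg_left (Real.exp_le_exp.2 ?_) hM.le)
    have := (Complex.abs_im_le_norm (z - a)).trans hz
    rw [Complex.sub_im, Complex.ofReal_im, sub_zero] at this
    linarith
  have hpos : 0 ≤ M * Real.exp 1 := by positivity
  refine ⟨4 * (M * Real.exp 1), by positivity, fun a ha z hz => ⟨?_, ?_⟩⟩
  · exact (hstrip a z (by linarith)).trans (by linarith)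
  have hne : ∀ w : ℂ, ‖w - a‖ ≤ 1 / 2 → w ∈ ({0}ᶜ : Set ℂ) := fun w hw h0 => by
    rw [mem_singleton_iff] at h0
    rw [h0, zero_sub, norm_neg, Complex.norm_real, Real.norm_eq_abs] at hw
    linarith
  refine (convex_closedBall (a : ℂ) (1 / 4)).norm_image_sub_le_of_norm_deriv_le
    (fun w hw => ?_) (fun w hw => ?_) (by simp) (mem_closedBall_iff_norm.2 hz)
  · rw [mem_closedBall_iff_norm] at hw
    exact hdiff.differentiableAt (isOpen_compl_singleton.mem_nhds (hne w (by linarith)))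
  · rw [mem_closedBall_iff_norm] at hw
    have hball : ∀ u ∈ Metric.closedBall w (1 / 4), ‖u - a‖ ≤ 1 / 2 := fun u hu => by
      rw [mem_closedBall_iff_norm] at hu
      calc ‖u - a‖ = ‖(u - w) + (w - a)‖ := by ring_nf
        _ ≤ _ := norm_add_le _ _
        _ ≤ 1 / 2 := by linarith
    have := Complex.norm_deriv_le_of_forall_mem_sphere_norm_le (c := w) (R := 1 / 4)
      (f := subPart q₂ q₃) (C := M * Real.exp 1) (by norm_num) ?_
      (fun u hu => hstrip a u (hball u (Metric.sphere_subset_closedBall hu)))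
    · linarith
    · refine (hdiff.mono fun u hu => hne u (hball u ?_)).diffContOnCl
      rwa [closure_ball _ (by norm_num : (1 / 4 : ℝ) ≠ 0)] at hu

theorem summable_sq_integral_mul_exp {f : ℝ → ℂ} (hf : MemLp f 2 (volume.restrict (Ioo 0 1))) :
    Summable fun n : ℤ =>
      ‖∫ t in (0 : ℝ)..1, f t * Complex.exp (-(2 * Real.pi * n * t * Complex.I))‖ ^ 2 := by
  have hf' : MemLp f 2 (volume.restrict (Ioc 0 1)) := by
    rwa [← Measure.restrict_congr_set Ioo_ae_eq_Ioc]
  refine (hasSum_sq_fourierCoeffOn zero_lt_one hf').summable.congr fun n => ?_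
  rw [fourierCoeffOn_eq_integral]
  simp only [sub_zero, one_div, inv_one, one_smul]
  congr 2
  refine intervalIntegral.integral_congr fun t _ => ?_
  simp only [fourier_coe_apply, smul_eq_mul]
  rw [mul_comm]
  congr 2
  push_cast; ring

theorem exp_int_mul_pi_mul (n : ℤ) (t : ℝ) :
    Complex.exp (n * Real.pi * (2 * t - 1) * Complex.I)
      = (-1) ^ n * Complex.exp (-(2 * Real.pi * (-n : ℤ) * t * Complex.I)) := by
  have : Complex.exp (-(n * (Real.pi * Complex.I))) = (-1) ^ n := by
    rw [← mul_neg, Complex.exp_int_mul, Complex.exp_neg, Complex.exp_pi_mul_I]; norm_num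
  rw [← this, ← Complex.exp_add]
  congr 1
  push_cast; ring

/-- By Euler's formulas, both integrals at πn + θ are combinations of Fourier coefficients, with
indices −n and n, of q·exp(±iθ(2t − 1)). These functions are in L₂ with q, and Parseval applies. -/
theorem exists_summable_osc {q : ℝ → ℂ} (hq : IsPotential q) (θ : ℝ) :
    ∃ K : ℤ → ℝ, Summable (fun n => K n ^ 2) ∧ ∀ n : ℤ, ‖oscCos q (n * Real.pi + θ)‖ ≤ K n ∧
      ‖oscSin q (n * Real.pi + θ)‖ ≤ K n := by
  have hmem : ∀ s : ℝ, MemLp (fun t : ℝ => q t * Complex.exp (s * (2 * t - 1) * Complex.I)) 2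
      (volume.restrict (Ioo 0 1)) := fun s => by
    refine hq.memLp.of_le (hq.memLp.aestronglyMeasurable.mul
      (Continuous.aestronglyMeasurable (by fun_prop))) (ae_of_all _ fun t => ?_)
    rw [norm_mul, show (s * (2 * t - 1) * Complex.I : ℂ)
      = ((s * (2 * t - 1) : ℝ) : ℂ) * Complex.I by push_cast; ring,
      Complex.norm_exp_ofReal_mul_I, mul_one]
  set F : ℝ → ℤ → ℂ := fun s n => ∫ t in (0 : ℝ)..1,
    q t * Complex.exp (s * (2 * t - 1) * Complex.I)
      * Complex.exp (-(2 * Real.pi * n * t * Complex.I)) with hF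
  have hsum : ∀ s, Summable fun n => ‖F s n‖ ^ 2 := fun s => summable_sq_integral_mul_exp (hmem s)
  have hF' : ∀ (s : ℝ) (n : ℤ), ∫ t in (0 : ℝ)..1,
      q t * Complex.exp ((n * Real.pi + s) * (2 * t - 1) * Complex.I) = (-1) ^ n * F s (-n) := by
    intro s n
    rw [hF, ← intervalIntegral.integral_const_mul]
    refine intervalIntegral.integral_congr fun t _ => ?_
    rw [show ((n * Real.pi + s) * (2 * t - 1) * Complex.I : ℂ)
      = s * (2 * t - 1) * Complex.I + n * Real.pi * (2 * t - 1) * Complex.I by ring,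
      Complex.exp_add, exp_int_mul_pi_mul]
    ring
  have hint : ∀ w : ℂ, IntervalIntegrable
      (fun t : ℝ => q t * Complex.exp (w * (2 * t - 1) * Complex.I)) volume 0 1 := fun w =>
    intervalIntegrable_mul_continuous hq.integrable (by fun_prop) _ _
  have hplus : ∀ n : ℤ, ∫ t in (0 : ℝ)..1,
      q t * Complex.exp ((n * Real.pi + θ : ℂ) * (2 * t - 1) * Complex.I)
        = (-1) ^ n * F θ (-n) := hF' θ
  have hminus : ∀ n : ℤ, ∫ t in (0 : ℝ)..1,
      q t * Complex.exp (-(n * Real.pi + θ : ℂ) * (2 * t - 1) * Complex.I)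
        = (-1) ^ n * F (-θ) n := fun n => by
    have := hF' (-θ) (-n)
    rw [neg_neg, zpow_neg, ← inv_zpow, inv_neg, inv_one] at this
    rw [← this]
    refine intervalIntegral.integral_congr fun t _ => ?_
    push_cast; congr 3; ring
  have hnorm : ∀ (n : ℤ) (w : ℂ), ‖(-1 : ℂ) ^ n * w‖ = ‖w‖ := fun n w => by simp
  refine ⟨fun n => ‖F θ (-n)‖ + ‖F (-θ) n‖, ?_, fun n => ?_⟩
  · refine Summable.of_nonneg_of_le (fun n => by positivity) (fun n => ?_)
      ((((hsum θ).comp_injective neg_injective).mul_left 2).add ((hsum (-θ)).mul_left 2))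
    simp only [comp_apply]
    nlinarith [sq_nonneg (‖F θ (-n)‖ - ‖F (-θ) n‖)]
  · have ec : oscCos q (n * Real.pi + θ)
        = 2⁻¹ * ((-1) ^ n * F θ (-n)) + 2⁻¹ * ((-1) ^ n * F (-θ) n) := by
      rw [← hplus, ← hminus, ← mul_add, ← intervalIntegral.integral_add (hint _) (hint _),
        ← intervalIntegral.integral_const_mul]
      refine intervalIntegral.integral_congr fun t _ => ?_
      simp only [Complex.cos, neg_mul]
      ring
    have es : oscSin q (n * Real.pi + θ)
        = (2⁻¹ * Complex.I) * ((-1) ^ n * F (-θ) n)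
          - (2⁻¹ * Complex.I) * ((-1) ^ n * F θ (-n)) := by
      rw [← hplus, ← hminus, ← mul_sub, ← intervalIntegral.integral_sub (hint _) (hint _),
        ← intervalIntegral.integral_const_mul]
      refine intervalIntegral.integral_congr fun t _ => ?_
      simp only [Complex.sin, neg_mul]
      ring
    have h1 := norm_nonneg (F θ (-n))
    have h2 := norm_nonneg (F (-θ) n)
    constructor
    · rw [ec]
      refine (norm_add_le _ _).trans ?_
      rw [norm_mul _ ((-1) ^ n * _), norm_mul _ ((-1) ^ n * _), hnorm, hnorm, norm_inv,
        Complex.norm_ofNat]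
      linarith
    · rw [es]
      refine (norm_sub_le _ _).trans ?_
      rw [norm_mul _ ((-1) ^ n * _), norm_mul _ ((-1) ^ n * _), hnorm, hnorm, norm_mul, norm_inv,
        Complex.norm_ofNat, Complex.norm_I]
      linarith

theorem subPart_int_mul_pi_add (q₂ q₃ : ℝ → ℂ) (θ : ℝ) (n : ℤ) :
    subPart q₂ q₃ (n * Real.pi + θ)
      = -omega q₂ * Complex.cos θ ^ 2 + omega q₃ * Complex.sin θ ^ 2
        + (-1) ^ n * (Complex.cos θ * oscCos q₂ (n * Real.pi + θ)
          + Complex.sin θ * oscSin q₃ (n * Real.pi + θ)) := by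
  have h : ((-1 : ℂ) ^ n) ^ 2 = 1 := by rw [← zpow_natCast, zpow_comm, zpow_natCast]; simp
  have hc : Complex.cos (n * Real.pi + θ) = (-1) ^ n * Complex.cos θ := by
    rw [add_comm, Complex.cos_add_int_mul_pi]
  have hs : Complex.sin (n * Real.pi + θ) = (-1) ^ n * Complex.sin θ := by
    rw [add_comm, Complex.sin_add_int_mul_pi]
  rw [subPart, hc, hs]
  linear_combination (-omega q₂ * Complex.cos θ ^ 2 + omega q₃ * Complex.sin θ ^ 2) * h

/-- Asymptotics of the zeros `r ≈ π n + θ`, where `θ` is a simple zero of the main part. -/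
theorem exists_summable_remainder {q₂ q₃ : ℝ → ℂ} (hq₂ : IsPotential q₂) (hq₃ : IsPotential q₃)
    {θ : ℝ} (hθ0 : 0 ≤ θ) (hθ1 : θ < Real.pi / 3) (hθ : mainPart θ = 0) {g : ℂ}
    (hg : HasDerivAt mainPart g θ) (hg0 : g ≠ 0) :
    ∃ K : ℤ → ℝ, Summable (fun n => K n ^ 2) ∧ ∀ n : ℤ, n ≠ 0 → ∀ r : ℂ,
      ‖r - (n * Real.pi + θ : ℝ)‖ < 1 / 4 → r * charFun₁ q₂ q₃ (r ^ 2) = 0 →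
      ‖n * (r - n * Real.pi - θ) - (-1) ^ n *
        (-(-omega q₂ * Complex.cos θ ^ 2 + omega q₃ * Complex.sin θ ^ 2)
          / (2 * Real.pi * g))‖ ≤ K n := by
  obtain ⟨C, hC, hlin⟩ := exists_linear_bounds_mainPart hθ hg hg0
  obtain ⟨L, hL, hlip⟩ := exists_lipschitz_subPart hq₂ hq₃
  obtain ⟨K₂, hK₂, hA⟩ := exists_summable_osc hq₂ θ
  obtain ⟨K₃, hK₃, hB⟩ := exists_summable_osc hq₃ θ
  set e₀ := -omega q₂ * Complex.cos θ ^ 2 + omega q₃ * Complex.sin θ ^ 2 with he₀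
  -- The constants of the three O(1/n) errors estimated in `b1`, `b3` and `b4`.
  set D := L * (C * L) + 2 * L + C * (C * L) ^ 2 with hD
  have hpi := Real.pi_gt_three
  have hpi4 := Real.pi_lt_d2
  have hpi0 : (Real.pi : ℂ) ≠ 0 := by exact_mod_cast Real.pi_ne_zero
  refine ⟨fun n => ‖g‖⁻¹ * (D * |(n : ℝ)|⁻¹ + K₂ n + K₃ n), ?_, fun n hn r hr h0 => ?_⟩
  · have h1 := ((Real.summable_one_div_int_pow (p := 2)).2 one_lt_two).mul_left (3 * D ^ 2)
    have h2 := ((h1.add (hK₂.mul_left 3)).add (hK₃.mul_left 3)).mul_left (‖g‖⁻¹ ^ 2)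
    refine h2.of_nonneg_of_le (fun n => by positivity) fun n => ?_
    rw [mul_pow]
    refine mul_le_mul_of_nonneg_left ?_ (by positivity)
    have e : 3 * D ^ 2 * (1 / (n : ℝ) ^ 2) = 3 * (D * |(n : ℝ)|⁻¹) ^ 2 := by
      rw [mul_pow, inv_pow, sq_abs]; ring
    rw [e]
    generalize D * |(n : ℝ)|⁻¹ = x
    nlinarith [sq_nonneg (x - K₂ n), sq_nonneg (x - K₃ n), sq_nonneg (K₂ n - K₃ n)]
  set a : ℝ := n * Real.pi + θ with ha
  set δ := r - (a : ℂ) with hδ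
  set w := r - n * Real.pi with hw
  set m : ℝ := |(n : ℝ)| with hm
  have hm1 : 1 ≤ m := by
    rw [hm, ← Int.cast_abs]; exact_mod_cast Int.one_le_abs hn
  have hm0 : 0 < m := by linarith
  have haN : m + 1 / 4 ≤ |a| := by
    have h1 : |(n : ℝ) * Real.pi| ≤ |a| + |θ| := by
      have := abs_sub a θ
      rwa [ha, add_sub_cancel_right, ← ha] at this
    rw [abs_mul, abs_of_pos Real.pi_pos, abs_of_nonneg hθ0] at h1
    nlinarith
  have hrN : m ≤ ‖r‖ := by
    have h1 : ‖(a : ℂ)‖ ≤ ‖r‖ + ‖δ‖ := by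
      have := norm_sub_le r δ
      rwa [hδ, sub_sub_cancel, ← hδ] at this
    rw [Complex.norm_real, Real.norm_eq_abs] at h1
    linarith
  have hr0 : r ≠ 0 := norm_pos_iff.1 (by linarith)
  have hwδ : w - θ = δ := by rw [hw, hδ, ha]; push_cast; ring
  have hwN : ‖w‖ ≤ 2 := by
    have h1 := norm_add_le δ θ
    rw [← hwδ, sub_add_cancel, hwδ, Complex.norm_real, Real.norm_eq_abs, abs_of_nonneg hθ0] at h1
    linarith
  set ε : ℂ := (-1) ^ n with hε
  have hε2 : ε * ε = 1 := by rw [hε, ← mul_zpow]; simp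
  have hεn : ‖ε‖ = 1 := by simp [hε]
  obtain ⟨hSL, hSδ⟩ := hlip a (by linarith) r hr.le
  set S := subPart q₂ q₃ r with hS
  set Sa := subPart q₂ q₃ a with hSa
  -- The equation for r, moved to a neighbourhood of θ by quasi-periodicity of the main part.
  have hmain : mainPart w = -(ε * S / (2 * r)) := by
    have h1 : mainPart r = ε * mainPart w := by
      rw [← mainPart_add_int_mul_pi, hw, sub_add_cancel]
    have h2 := mul_charFun₁_sq hq₂.integrable hq₃.integrable hr0
    rw [h0, h1, ← hS] at h2
    have : mainPart w = ε * (ε * mainPart w) := by rw [← mul_assoc, hε2, one_mul]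
    rw [this, eq_neg_of_add_eq_zero_left h2.symm]
    ring
  obtain ⟨hl1, hl2⟩ := hlin w (by rw [hwδ]; exact hr.le)
  rw [hwδ] at hl1 hl2
  set E := mainPart w - g * δ with hE
  have hδN : ‖δ‖ ≤ C * L * m⁻¹ := by
    refine hl1.trans ?_
    rw [mul_assoc]
    refine mul_le_mul_of_nonneg_left ?_ hC
    rw [hmain, norm_neg, norm_div, norm_mul, hεn, one_mul, norm_mul, Complex.norm_ofNat,
      div_le_iff₀ (by positivity)]
    have : L = L * m⁻¹ * m := by field_simp
    calc ‖S‖ ≤ L * m⁻¹ * m := hSL.trans this.le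
      _ ≤ L * m⁻¹ * (2 * ‖r‖) := mul_le_mul_of_nonneg_left (by linarith) (by positivity)
  have hEN : m * ‖E‖ ≤ C * (C * L) ^ 2 * m⁻¹ := by
    calc m * ‖E‖ ≤ m * (C * (C * L * m⁻¹) ^ 2) := by gcongr; exact hl2.trans (by gcongr)
      _ = C * (C * L) ^ 2 * m⁻¹ := by field_simp
  have hSae : ‖Sa - e₀‖ ≤ K₂ n + K₃ n := by
    have e : Sa - e₀ = ε * (Complex.cos θ * oscCos q₂ (n * Real.pi + θ)
          + Complex.sin θ * oscSin q₃ (n * Real.pi + θ)) := by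
      have : (a : ℂ) = n * Real.pi + θ := by rw [ha]; push_cast; ring
      rw [hSa, this, subPart_int_mul_pi_add, ← he₀, add_sub_cancel_left]
    rw [e, norm_mul, hεn, one_mul]
    refine (norm_add_le _ _).trans (add_le_add ?_ ?_)
    · rw [norm_mul, ← Complex.ofReal_cos, Complex.norm_real]
      exact (mul_le_of_le_one_left (norm_nonneg _) (Real.abs_cos_le_one θ)).trans (hA n).1
    · rw [norm_mul, ← Complex.ofReal_sin, Complex.norm_real]
      exact (mul_le_of_le_one_left (norm_nonneg _) (Real.abs_sin_le_one θ)).trans (hB n).2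
  -- Since πn = r − w, one has n/r = (1 − w/r)/π, which splits the error exactly: variation of G
  -- over δ, its oscillating part (square summable), the defect of n/r, and the quadratic error of
  -- linearization.
  have hid : g * (n * (w - θ) - ε * (-e₀ / (2 * Real.pi * g)))
      = -(ε * (2 * Real.pi : ℂ)⁻¹) * (S - Sa) + -(ε * (2 * Real.pi : ℂ)⁻¹) * (Sa - e₀)
        + (ε * (2 * Real.pi : ℂ)⁻¹) * (S * (w / r)) + -(n * E) := by
    have h1 : (n : ℂ) * Real.pi = r - w := by rw [hw]; ring
    have h2 : g * δ = -(ε * S / (2 * r)) - E := by rw [hE, hmain]; ring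
    rw [hwδ]
    have h3 : (n : ℂ) = (r - w) * (Real.pi : ℂ)⁻¹ := by rw [← h1]; field_simp
    have h4 : g * (n * δ - ε * (-e₀ / (2 * Real.pi * g)))
      = n * (g * δ) + ε * e₀ * (2 * Real.pi : ℂ)⁻¹ := by field_simp; ring
    rw [h4, h2, mul_sub]
    have h5 : (n : ℂ) * -(ε * S / (2 * r))
        = -(ε * (2 * Real.pi : ℂ)⁻¹) * S + (ε * (2 * Real.pi : ℂ)⁻¹) * (S * (w / r)) := by
      rw [h3]; field_simp; ring
    rw [h5]; ring
  have hpn : ‖ε * (2 * Real.pi : ℂ)⁻¹‖ ≤ 1 := by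
    rw [norm_mul, hεn, one_mul, norm_inv, norm_mul, Complex.norm_ofNat, Complex.norm_real,
      Real.norm_eq_abs, abs_of_pos Real.pi_pos]
    exact inv_le_one_of_one_le₀ (by linarith)
  change _ ≤ ‖g‖⁻¹ * (D * m⁻¹ + K₂ n + K₃ n)
  rw [inv_mul_eq_div, le_div_iff₀ (norm_pos_iff.2 hg0), mul_comm, ← norm_mul, hid]
  have b1 : ‖-(ε * (2 * Real.pi : ℂ)⁻¹) * (S - Sa)‖ ≤ L * (C * L) * m⁻¹ := by
    rw [norm_mul, norm_neg]
    refine (mul_le_of_le_one_left (norm_nonneg _) hpn).trans (hSδ.trans ?_)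
    rw [mul_assoc]
    exact mul_le_mul_of_nonneg_left hδN hL
  have b2 : ‖-(ε * (2 * Real.pi : ℂ)⁻¹) * (Sa - e₀)‖ ≤ K₂ n + K₃ n := by
    rw [norm_mul, norm_neg]
    exact (mul_le_of_le_one_left (norm_nonneg _) hpn).trans hSae
  have b3 : ‖(ε * (2 * Real.pi : ℂ)⁻¹) * (S * (w / r))‖ ≤ 2 * L * m⁻¹ := by
    rw [norm_mul]
    refine (mul_le_of_le_one_left (norm_nonneg _) hpn).trans ?_
    rw [norm_mul, norm_div, div_eq_mul_inv]
    calc ‖S‖ * (‖w‖ * ‖r‖⁻¹) ≤ L * (2 * m⁻¹) := by gcongr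
      _ = _ := by ring
  have b4 : ‖-(n * E : ℂ)‖ ≤ C * (C * L) ^ 2 * m⁻¹ := by
    rw [norm_neg, norm_mul, Complex.norm_intCast]; exact hEN
  refine (norm_add_le _ _).trans ?_
  refine (add_le_add (norm_add₃_le) b4).trans ?_
  rw [hD]
  linarith

/-! ### The spectrum for k = 1 -/

/-- The set `S` is the union of two sequences, which count its points with the multiplicity `m` and
have the asymptotics with the coefficients `γ` and `ω / 4`. -/
def HasSpectralAsymptotics (S : Set ℂ) (m : ℂ → ℕ∞) (γ ω : ℂ) : Prop :=
  ∃ (μ η κ : ℤ → ℂ) (ξ ζ κ' : ℕ → ℂ),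
    S = μ '' {n | n ≠ 0} ∪ range ξ ∧
    (∀ lam : ℂ, m lam = {n : ℤ | n ≠ 0 ∧ μ n = lam}.encard + {n : ℕ | ξ n = lam}.encard) ∧
    Memℓp κ 2 ∧
    (∀ n : ℤ, n ≠ 0 → μ n = η n ^ 2 ∧
      η n = (Real.pi : ℂ) * n + (sigma : ℂ) + (-1) ^ n * (γ / ((Real.pi : ℂ) * n)) + κ n / n) ∧
    Memℓp κ' 2 ∧
    (∀ n : ℕ, ξ n = ζ n ^ 2) ∧
    (∀ n : ℕ, n ≠ 0 →
      ζ n = (Real.pi : ℂ) * n + (-1) ^ n * (ω / (4 * (Real.pi : ℂ) * n)) + κ' n / n)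

theorem memℓp_two_of_norm_le {ι : Type*} {κ : ι → ℂ} {K : ι → ℝ}
    (hK : Summable fun i => K i ^ 2) {F : Set ι} (hF : F.Finite) (h : ∀ i ∉ F, ‖κ i‖ ≤ K i) :
    Memℓp κ 2 := by
  refine memℓp_gen (hK.of_norm_bounded_eventually ?_)
  filter_upwards [hF.compl_mem_cofinite] with i hi
  rw [ENNReal.toReal_ofNat, Real.rpow_ofNat, norm_pow, norm_norm]
  exact pow_le_pow_left₀ (norm_nonneg _) (h i hi) 2

theorem encard_sum_preimage {α β : Type*} (f : α ⊕ β → ℂ) (z : ℂ) :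
    {i | f i = z}.encard = {a | f (.inl a) = z}.encard + {b | f (.inr b) = z}.encard := by
  have h : {i | f i = z} = Sum.inl '' {a | f (.inl a) = z} ∪ Sum.inr '' {b | f (.inr b) = z} := by
    ext (a | b) <;> simp
  rw [h, encard_union_eq, Sum.inl_injective.encard_image, Sum.inr_injective.encard_image]
  rw [Set.disjoint_left]
  rintro _ ⟨a, -, rfl⟩ ⟨b, -, h⟩
  cases h

theorem mainPart_zero : mainPart (0 : ℝ) = 0 := by simp [mainPart]

theorem mainPart_sigma : mainPart sigma = 0 := by simp [mainPart_eq]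

theorem hasDerivAt_mainPart (z : ℂ) :
    HasDerivAt mainPart (Complex.cos z * (3 * Complex.cos z ^ 2 - 1)
      - 6 * Complex.sin z ^ 2 * Complex.cos z) z := by
  have h := (Complex.hasDerivAt_sin z).mul
    ((((Complex.hasDerivAt_cos z).pow 2).const_mul 3).sub_const 1)
  refine h.congr_deriv ?_
  simp only [Pi.pow_apply]
  push_cast; ring

theorem cos_sigma : Real.cos sigma = Real.sqrt 3 / 3 := by
  have h1 : Real.cos sigma ^ 2 = 1 / 3 := by
    linarith [Real.sin_sq_add_cos_sq sigma, sin_sigma_sq]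
  have h2 : 0 < Real.cos sigma := Real.cos_pos_of_mem_Ioo
    ⟨by linarith [pi_div_four_lt_sigma, Real.pi_pos], by
      linarith [sigma_lt_pi_div_three, Real.pi_pos]⟩
  refine (pow_left_inj₀ h2.le (by positivity) two_ne_zero).1 ?_
  rw [h1, div_pow, Real.sq_sqrt (by norm_num)]; norm_num

/-- Δ is not identically zero: strict domination by the main part on a large circle would fail at a
zero of Δ. -/
theorem analyticOrderAt_charFun₁_ne_top {q₂ q₃ : ℝ → ℂ} (hq₂ : IsPotential q₂)
    (hq₃ : IsPotential q₃) (c : ℂ) : analyticOrderAt (charFun₁ q₂ q₃) c ≠ ⊤ := by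
  obtain ⟨R₀, h⟩ := exists_nearMainPart hq₂.integrable hq₃.integrable
  obtain ⟨N, hN⟩ := exists_nat_ge R₀
  have hN0 : (0 : ℝ) ≤ N := Nat.cast_nonneg N
  set z : ℂ := ((Real.pi * (N + 1 / 2) : ℝ) : ℂ) with hz
  have hzn : ‖z‖ = Real.pi * (N + 1 / 2) := by
    rw [hz, Complex.norm_real, Real.norm_eq_abs, abs_of_nonneg (by positivity)]
  have h1 := h z (isFar_of_norm_eq hzn) (by rw [hzn]; nlinarith [Real.pi_gt_three])
  refine (differentiable_charFun₁ hq₂ hq₃).analyticOrderAt_ne_top (w := z ^ 2) (fun h0 => ?_) c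
  rw [h0, mul_zero, zero_sub, norm_neg] at h1
  exact lt_irrefl _ h1

theorem hasSpectralAsymptotics_one {q₂ q₃ : ℝ → ℂ} (hq₂ : IsPotential q₂)
    (hq₃ : IsPotential q₃) :
    HasSpectralAsymptotics (spectrumSet 1 q₂ q₃) (eigenMultiplicity 1 q₂ q₃)
      (gammaCoeff 1 q₂ q₃) (omega q₂) := by
  have hpi0 : (Real.pi : ℂ) ≠ 0 := by exact_mod_cast Real.pi_ne_zero
  obtain ⟨R₀, hnear⟩ := exists_nearMainPart hq₂.integrable hq₃.integrable
  obtain ⟨N, e, r, hcount, hlarge⟩ :=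
    exists_spectral_enumeration (differentiable_charFun₁ hq₂ hq₃) hnear
  -- For the finitely many small indices any square root serves, as they do not affect membership in
  -- ℓ₂.
  have hroot : ∀ i, ∃ ρ : ℂ, e i = ρ ^ 2 ∧ (i ∉ smallIndex N → ρ = r i) := fun i => by
    by_cases hi : i ∈ smallIndex N
    · obtain ⟨ρ, hρ⟩ := exists_eq_sq (e i)
      exact ⟨ρ, hρ, fun h => absurd hi h⟩
    · exact ⟨r i, (hlarge i hi).1, fun _ => rfl⟩
  choose ρ hρ hρr using hroot
  have hmult : ∀ lam, eigenMultiplicity 1 q₂ q₃ lam = {i | e i = lam}.encard := fun lam => by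
    obtain ⟨p, hp⟩ := ENat.ne_top_iff_exists.1 (analyticOrderAt_charFun₁_ne_top hq₂ hq₃ lam)
    rw [hcount, ← hp, eigenMultiplicity_one_eq hq₂ hq₃ hp.symm]
  have hspec : spectrumSet 1 q₂ q₃ = range e := by
    ext lam
    obtain ⟨p, hp⟩ := ENat.ne_top_iff_exists.1 (analyticOrderAt_charFun₁_ne_top hq₂ hq₃ lam)
    rw [mem_spectrumSet_one_iff hq₂ hq₃ hp.symm]
    have h1 := hcount lam
    rw [← hp] at h1
    have h2 : p ≠ 0 ↔ {i | e i = lam}.Nonempty := by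
      rw [← encard_ne_zero, h1]; simp
    exact h2
  obtain ⟨K, hK, hKr⟩ := exists_summable_remainder hq₂ hq₃
    (by linarith [pi_div_four_lt_sigma, Real.pi_pos]) sigma_lt_pi_div_three mainPart_sigma
    (g := -4 * Real.cos sigma) (by
      refine (hasDerivAt_mainPart sigma).congr_deriv ?_
      have h1 : (Complex.sin sigma) ^ 2 = 2 / 3 := by
        rw [← Complex.ofReal_sin, ← Complex.ofReal_pow, sin_sigma_sq]; norm_num
      have h2 := Complex.sin_sq_add_cos_sq sigma
      push_cast
      linear_combination 3 * Complex.cos sigma * h2 - 9 * Complex.cos sigma * h1)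
    (by
      rw [cos_sigma]
      have : (Real.sqrt 3 : ℂ) ≠ 0 := by
        exact_mod_cast (Real.sqrt_pos.2 (by norm_num : (0 : ℝ) < 3)).ne'
      push_cast
      simp [this])
  obtain ⟨K', hK', hKr'⟩ := exists_summable_remainder hq₂ hq₃ le_rfl
    (by linarith [Real.pi_pos]) mainPart_zero (g := 2) (by
      refine (hasDerivAt_mainPart _).congr_deriv ?_
      simp; norm_num) two_ne_zero
  set γ := gammaCoeff 1 q₂ q₃ with hγ
  -- Here cos² σ = 1/3, sin² σ = 2/3 and F′(σ) = −4cos σ = −4√3/3.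
  have hγc : -(-omega q₂ * Complex.cos sigma ^ 2 + omega q₃ * Complex.sin sigma ^ 2)
      / (2 * Real.pi * (-4 * Real.cos sigma)) = γ / Real.pi := by
    have h3 : (Real.sqrt 3 : ℂ) ≠ 0 := by
      exact_mod_cast (Real.sqrt_pos.2 (by norm_num : (0 : ℝ) < 3)).ne'
    have h4 : (Real.sqrt 3 : ℂ) ^ 2 = 3 := by
      rw [← Complex.ofReal_pow, Real.sq_sqrt (by norm_num)]; norm_num
    have h1 : (Complex.sin sigma) ^ 2 = 2 / 3 := by
      rw [← Complex.ofReal_sin, ← Complex.ofReal_pow, sin_sigma_sq]; norm_num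
    have h2 : (Complex.cos sigma) ^ 2 = 1 / 3 := by
      linear_combination Complex.sin_sq_add_cos_sq sigma - h1
    rw [h1, h2, cos_sigma, hγ, gammaCoeff]
    push_cast
    field_simp
    rw [h4]
    ring
  classical
  let ι : ℤ → SpecIndex := fun n => if h : n ≠ 0 then .inl ⟨n, h⟩ else .inr 0
  have hι : ∀ n (h : n ≠ 0), ι n = .inl ⟨n, h⟩ := fun n h => dif_pos h
  -- The remainders are defined by solving the asymptotic formulas for them; the formulas then hold
  -- identically, and the content is that the remainders lie in ℓ₂.
  refine ⟨fun n => e (ι n), fun n => ρ (ι n),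
    fun n => n * (ρ (ι n) - n * Real.pi - sigma) - (-1) ^ n * (γ / Real.pi),
    fun n => e (.inr n), fun n => ρ (.inr n),
    fun n => n * (ρ (.inr n) - n * Real.pi) - (-1) ^ n * (omega q₂ / (4 * Real.pi)),
    ?_, fun lam => ?_, ?_, fun n hn => ⟨hρ _, ?_⟩, ?_, fun n => hρ _, fun n hn => ?_⟩
  · rw [hspec]
    ext lam
    constructor
    · rintro ⟨n | n, rfl⟩
      · exact Or.inl ⟨n, n.2, by simp only [hι n n.2]⟩
      · exact Or.inr ⟨n, rfl⟩
    · rintro (⟨n, -, rfl⟩ | ⟨n, rfl⟩)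
      · exact ⟨_, rfl⟩
      · exact ⟨_, rfl⟩
  · rw [hmult, encard_sum_preimage]
    congr 1
    have : {n : ℤ | n ≠ 0 ∧ e (ι n) = lam}
        = Subtype.val '' {a : {n : ℤ // n ≠ 0} | e (.inl a) = lam} := by
      ext n
      constructor
      · rintro ⟨h, h1⟩
        exact ⟨⟨n, h⟩, by rw [hι n h] at h1; exact h1, rfl⟩
      · rintro ⟨a, h1, rfl⟩
        exact ⟨a.2, by rw [hι a a.2]; exact h1⟩
    rw [this, Subtype.val_injective.encard_image]
  · refine memℓp_two_of_norm_le hK (finite_Icc (-(N : ℤ)) N) fun n hn => ?_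
    have hn0 : n ≠ 0 := by rintro rfl; exact hn ⟨by simp, by simp⟩
    have hs : ι n ∉ smallIndex N := fun h => by
      rw [hι n hn0] at h
      have h' : n.natAbs ≤ N := h
      exact hn ⟨by omega, by omega⟩
    have h1 := hlarge _ hs
    rw [hρr _ hs, ← hγc]
    refine hKr n hn0 _ ?_ h1.2.2
    have h2 := h1.2.1
    rw [hι n hn0] at h2 ⊢
    exact h2
  · have hn' : (n : ℂ) ≠ 0 := by exact_mod_cast hn
    simp only
    field_simp
    ring
  · refine memℓp_two_of_norm_le (hK'.comp_injective Nat.cast_injective) (finite_Iic N)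
      fun n hn => ?_
    have hs : (.inr n : SpecIndex) ∉ smallIndex N := fun h => hn h
    have hn0 : n ≠ 0 := by rintro rfl; exact hn (Nat.zero_le N)
    have h1 := hlarge _ hs
    have h2 := hKr' n (by exact_mod_cast hn0) (r (.inr n)) (by
      have := h1.2.1
      rw [specCenter_inr hn0] at this
      simpa using this) h1.2.2
    rw [hρr _ hs]
    convert h2 using 2
    simp only [Complex.ofReal_zero, Complex.cos_zero, Complex.sin_zero, Int.cast_natCast,
      zpow_natCast]
    congr 1
    · ring
    · congr 1; field_simp; ring
  · have hn' : (n : ℂ) ≠ 0 := by exact_mod_cast hn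
    simp only
    field_simp
    ring

/-! ### The case k = 2 by symmetry of the outgoing edges -/

/-- The bijection of the edges that interchanges the two outgoing ones. -/
def Edge.swap : Edge ≃ Edge where
  toFun | .e1 => .e1 | .e2 => .e3 | .e3 => .e2
  invFun | .e1 => .e1 | .e2 => .e3 | .e3 => .e2
  left_inv := by rintro (_ | _ | _) <;> rfl
  right_inv := by rintro (_ | _ | _) <;> rfl

/-- The orders k − 1 and 2 − k of the far conditions are exchanged under k ↦ 3 − k. -/
theorem SolvesProblem.swap {k : ℕ} (hk : k = 1 ∨ k = 2) {q₂ q₃ : ℝ → ℂ} {lam : ℂ}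
    {y f : Edge → ℝ → ℂ} (h : SolvesProblem k q₂ q₃ lam y f) :
    SolvesProblem (3 - k) q₃ q₂ lam (y ∘ Edge.swap) (f ∘ Edge.swap) := by
  obtain ⟨d, h0, hW, heq, ⟨hv1, hv2, hv3⟩, hb1, hb2, hb3⟩ := h
  refine ⟨d ∘ Edge.swap, fun j => h0 _, fun j => hW _, ?_, ⟨hv1.trans hv2, hv2.symm, ?_⟩,
    hb1, ?_, ?_⟩
  · filter_upwards [heq] with x hx
    exact ⟨hx.1, hx.2.2, hx.2.1⟩
  · exact hv3.trans (add_comm _ _)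
  · rcases hk with rfl | rfl <;> exact hb3
  · rcases hk with rfl | rfl <;> exact hb2

theorem Edge.comp_swap_comp_swap {α : Type*} (y : Edge → α) :
    (y ∘ Edge.swap) ∘ Edge.swap = y := by
  funext j
  rcases j with _ | _ | _ <;> rfl

theorem solvesProblem_two_iff {q₂ q₃ : ℝ → ℂ} {lam : ℂ} {y f : Edge → ℝ → ℂ} :
    SolvesProblem 2 q₂ q₃ lam y f ↔
      SolvesProblem 1 q₃ q₂ lam (y ∘ Edge.swap) (f ∘ Edge.swap) := by
  refine ⟨fun h => h.swap (Or.inr rfl), fun h => ?_⟩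
  have := h.swap (Or.inl rfl)
  rwa [Edge.comp_swap_comp_swap, Edge.comp_swap_comp_swap] at this

theorem isRootFunction_two_iff {q₂ q₃ : ℝ → ℂ} {lam : ℂ} {m : ℕ} {y : Edge → ℝ → ℂ} :
    IsRootFunction 2 q₂ q₃ lam m y ↔ IsRootFunction 1 q₃ q₂ lam m (y ∘ Edge.swap) := by
  induction m generalizing y with
  | zero => exact ⟨fun h j => h _, fun h j => by simpa using h (Edge.swap.symm j)⟩
  | succ m ih =>
    constructor
    · rintro ⟨f, hf, hy⟩
      exact ⟨f ∘ Edge.swap, ih.1 hf, solvesProblem_two_iff.1 hy⟩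
    · rintro ⟨f, hf, hy⟩
      refine ⟨f ∘ Edge.swap, ih.2 ?_, solvesProblem_two_iff.2 ?_⟩
      · rwa [Edge.comp_swap_comp_swap]
      · rwa [Edge.comp_swap_comp_swap f]

theorem spectrumSet_two (q₂ q₃ : ℝ → ℂ) : spectrumSet 2 q₂ q₃ = spectrumSet 1 q₃ q₂ := by
  ext lam
  constructor
  · rintro ⟨y, hy, j, x, hx, hne⟩
    exact ⟨y ∘ Edge.swap, solvesProblem_two_iff.1 hy, Edge.swap.symm j, x, hx, by simpa using hne⟩
  · rintro ⟨y, hy, j, x, hx, hne⟩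
    refine ⟨y ∘ Edge.swap, solvesProblem_two_iff.2 ?_, Edge.swap.symm j, x, hx, by simpa using hne⟩
    rwa [Edge.comp_swap_comp_swap]

theorem eigenMultiplicity_two (q₂ q₃ : ℝ → ℂ) :
    eigenMultiplicity 2 q₂ q₃ = eigenMultiplicity 1 q₃ q₂ := by
  funext lam
  have h : rootSpace 1 q₃ q₂ lam
      = (rootSpace 2 q₂ q₃ lam).map
        (LinearEquiv.funCongrLeft ℂ (Icc (0 : ℝ) 1 → ℂ) Edge.swap).toLinearMap := by
    rw [rootSpace, rootSpace, Submodule.map_span]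
    congr 1
    ext v
    constructor
    · rintro ⟨m, y, hy, rfl⟩
      refine ⟨_, ⟨m, y ∘ Edge.swap, isRootFunction_two_iff.2 ?_, rfl⟩, ?_⟩
      · rwa [Edge.comp_swap_comp_swap]
      · funext j x
        rcases j with _ | _ | _ <;> rfl
    · rintro ⟨_, ⟨m, y, hy, rfl⟩, rfl⟩
      exact ⟨m, y ∘ Edge.swap, isRootFunction_two_iff.1 hy, rfl⟩
  rw [eigenMultiplicity, eigenMultiplicity, h, LinearEquiv.rank_map_eq]

theorem gammaCoeff_two (q₂ q₃ : ℝ → ℂ) : gammaCoeff 2 q₂ q₃ = gammaCoeff 1 q₃ q₂ := by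
  rw [gammaCoeff, gammaCoeff]; ring

/-! ### Changing the potentials on null sets and outside the interval -/

theorem solvesProblem_congr {k : ℕ} {q₂ q₃ p₂ p₃ : ℝ → ℂ}
    (h₂ : q₂ =ᵐ[volume.restrict (Ioo (0 : ℝ) 1)] p₂)
    (h₃ : q₃ =ᵐ[volume.restrict (Ioo (0 : ℝ) 1)] p₃) :
    SolvesProblem k q₂ q₃ = SolvesProblem k p₂ p₃ := by
  funext lam y f
  rw [SolvesProblem, SolvesProblem]
  refine propext (exists_congr fun d => and_congr_right fun _ => and_congr_right fun _ =>
    and_congr_left fun _ => eventually_congr ?_)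
  filter_upwards [h₂, h₃] with x hx₂ hx₃
  rw [hx₂, hx₃]

theorem spectrumSet_congr {k : ℕ} {q₂ q₃ p₂ p₃ : ℝ → ℂ}
    (h₂ : q₂ =ᵐ[volume.restrict (Ioo (0 : ℝ) 1)] p₂)
    (h₃ : q₃ =ᵐ[volume.restrict (Ioo (0 : ℝ) 1)] p₃) :
    spectrumSet k q₂ q₃ = spectrumSet k p₂ p₃ := by
  simp only [spectrumSet, solvesProblem_congr h₂ h₃]

theorem eigenMultiplicity_congr {k : ℕ} {q₂ q₃ p₂ p₃ : ℝ → ℂ}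
    (h₂ : q₂ =ᵐ[volume.restrict (Ioo (0 : ℝ) 1)] p₂)
    (h₃ : q₃ =ᵐ[volume.restrict (Ioo (0 : ℝ) 1)] p₃) :
    eigenMultiplicity k q₂ q₃ = eigenMultiplicity k p₂ p₃ := by
  funext lam
  have h : IsRootFunction k q₂ q₃ lam = IsRootFunction k p₂ p₃ lam := by
    funext m
    induction m with
    | zero => rfl
    | succ m ih =>
      funext y
      simp only [IsRootFunction, ih, solvesProblem_congr h₂ h₃]
  rw [eigenMultiplicity, eigenMultiplicity, rootSpace, rootSpace, h]

theorem omega_congr {q p : ℝ → ℂ} (h : q =ᵐ[volume.restrict (Ioo (0 : ℝ) 1)] p) :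
    omega q = omega p := by
  rw [omega, omega, intervalIntegral.integral_of_le zero_le_one,
    intervalIntegral.integral_of_le zero_le_one, ← Measure.restrict_congr_set Ioo_ae_eq_Ioc]
  exact integral_congr_ae h

theorem indicator_ae_eq (q : ℝ → ℂ) :
    q =ᵐ[volume.restrict (Ioo (0 : ℝ) 1)] (Ioo (0 : ℝ) 1).indicator q := by
  filter_upwards [ae_restrict_mem measurableSet_Ioo] with x hx
  rw [indicator_of_mem hx]

theorem isPotential_indicator {q : ℝ → ℂ} (hq : MemLp q 2 (volume.restrict (Ioo (0 : ℝ) 1))) :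
    IsPotential ((Ioo (0 : ℝ) 1).indicator q) where
  integrable := (integrable_indicator_iff measurableSet_Ioo).2 (hq.integrable one_le_two)
  memLp := hq.ae_eq (indicator_ae_eq q)

theorem hasSpectralAsymptotics {q₂ q₃ : ℝ → ℂ}
    (hq₂ : MemLp q₂ 2 (volume.restrict (Ioo (0 : ℝ) 1)))
    (hq₃ : MemLp q₃ 2 (volume.restrict (Ioo (0 : ℝ) 1))) :
    HasSpectralAsymptotics (spectrumSet 1 q₂ q₃) (eigenMultiplicity 1 q₂ q₃)
      (gammaCoeff 1 q₂ q₃) (omega q₂) := by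
  have h₂ := indicator_ae_eq q₂
  have h₃ := indicator_ae_eq q₃
  -- Cutting q₂ and q₃ off outside (0, 1) makes them integrable on the line and alters none of the
  -- data.
  rw [spectrumSet_congr h₂ h₃, eigenMultiplicity_congr h₂ h₃, gammaCoeff, omega_congr h₂,
    omega_congr h₃]
  exact hasSpectralAsymptotics_one (isPotential_indicator hq₂) (isPotential_indicator hq₃)

theorem corollary1 (q₂ q₃ : ℝ → ℂ)
    (hq₂ : MemLp q₂ 2 (volume.restrict (Ioo (0 : ℝ) 1)))
    (hq₃ : MemLp q₃ 2 (volume.restrict (Ioo (0 : ℝ) 1)))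
    (k : ℕ) (hk : k = 1 ∨ k = 2) :
    ∃ (μ η κ : ℤ → ℂ) (ξ ζ κ' : ℕ → ℂ),
      -- the spectrum is the union of the two subspectra, also with account of multiplicity
      spectrumSet k q₂ q₃ = μ '' {n | n ≠ 0} ∪ range ξ ∧
      (∀ lam : ℂ, eigenMultiplicity k q₂ q₃ lam =
        {n : ℤ | n ≠ 0 ∧ μ n = lam}.encard + {n : ℕ | ξ n = lam}.encard) ∧
      -- asymptotics of the first subspectrum
      Memℓp κ 2 ∧
      (∀ n : ℤ, n ≠ 0 → μ n = η n ^ 2 ∧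
        η n = (Real.pi : ℂ) * n + (sigma : ℂ)
          + (-1) ^ n * (gammaCoeff k q₂ q₃ / ((Real.pi : ℂ) * n)) + κ n / n) ∧
      -- asymptotics of the second subspectrum
      Memℓp κ' 2 ∧
      (∀ n : ℕ, ξ n = ζ n ^ 2) ∧
      (∀ n : ℕ, n ≠ 0 →
        ζ n = (Real.pi : ℂ) * n
          + (-1) ^ n * ((if k = 1 then omega q₂ else omega q₃) / (4 * (Real.pi : ℂ) * n))
          + κ' n / n) := by
  rcases hk with rfl | rfl
  · rw [if_pos rfl]
    exact hasSpectralAsymptotics hq₂ hq₃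
  · rw [spectrumSet_two, eigenMultiplicity_two, gammaCoeff_two, if_neg (by norm_num)]
    exact hasSpectralAsymptotics hq₃ hq₂
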